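/- **Setting.** Let $X$ be a source alphabet, $Y$ a reproduction alphabet, $d:X\times Y\to[0,\infty)$ a distortion and $D\ge 0$. *Without side information.* Let $p_X$ be a probability measure on $X$ and $$R_X(D)=\inf\{I(X;Y): X\sim p_X,\ \mathbb E\,d(X,Y)\le D\}\in[0,\infty]$$ (in bits). An attacker is a randomized, possibly non-causal map (a Markov kernel) from input sequences $x_1^\infty$ to output sequences $y_1^\infty$. Given $f:\mathbb N\to[0,\infty]$ with $f(n)\to0$, it is a $D$-distortion attacker with decay $f$ if, for an input iid $\sim p_X$, $$\sup_t \Pr\Big(\tfrac1n\sum_{u=t}^{t+n-1}d(X_u,Y_u)>D\Big)\le f(n)\qquad\text{for all } n\ge1 .$$ A rate $R\ge0$ is *achievable by iid $p_X$ random codes* if there are measurable decoders, one for each block length $n$, such that for every such $f$ and every $\varepsilon>0$ there is $N$ with the following property. Let $n\ge N$, let the attacker be any $D$-distortion attacker with decay $f$, let $t$ be any time and let $m$ be any of $M=\lceil 2^{nR}\rceil$ messages. Draw $M$ independent codewords in $X^n$ with iid $p_X$ entries (common randomness, known to encoder and decoder but not to the attacker), send codeword $m$ at times $t,\dots,t+n-1$,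 and send independent iid $p_X$ symbols at all other times. Then the decoder, which sees the codebook and the attacker's output at times $t,\dots,t+n-1$, returns a message different from $m$ with probability at most $\varepsilon$. *With side information.* Let $V_1^\infty$ be iid $\sim p_V$ and, given $V_1^\infty$, let the inputs $X_i$ be independent with $X_i\sim p_{X|V=V_i}$, where $p_{X|V}$ is a Markov kernel. The attacker maps $(V_1^\infty,X_1^\infty)$ to $Y_1^\infty$; the distortion condition is the same, under the law of $(V_i,X_i)$ iid $\sim p_{VX}$. Codewords are independent given $V_1^\infty$, with independent entries of law $p_{X|V=V_u}$ at time $u$; $V$ is known to all parties (the decoder uses only its values in the block). Here $$R_{X|V}(D)=\inf\{I(X;Y|V): (V,X)\sim p_{VX},\ \mathbb E\,d(X,Y)\le D\},$$ and *achievable by iid $p_{X|V}$ random codes* is defined as above. *Conditions.* For Euclidean alphabets ($X,Y\subseteq\mathbb R^\gamma$ measurable, bounded or not) $d$ is a difference distortion, $d(x,y)=\rho(x-y)$ with $\rho:\mathbb R^\gamma\to[0,\infty)$ uniformly continuous, and we assume (N) either there is $B<\infty$ such that for almost every source letter $x$ there is $y\in Y$ with $d(x,y)\le B$, or $D\ne\mathbb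 E\inf_{y\in Y}d(X,y)$. The first alternative of (N) holds in particular if $X$ is bounded and $Y\neq\emptyset$, or if $X\subseteq Y$. If $V\subseteq\mathbb R^\eta$ is measurable (bounded or not) and $A\subseteq X$, condition $\mathrm{TC}(A)$ says: for every $r$, $$\lim_{\Delta'\downarrow0}\ \sup_{S}\Big(\sup_{s\in S\cap V,\,|s|\le r}p_{X|V}(A|s)-\inf_{s\in S\cap V,\,|s|\le r}p_{X|V}(A|s)\Big)=0,$$ where $S$ runs over those half-open cubes $\prod_i[c_i\Delta',(c_i+1)\Delta')$, $c\in\mathbb Z^\eta$, that meet $V\cap\{|s|\le r\}$. **Theorem.** * (Case 3) If $X,Y\subseteq\mathbb R^\gamma$ and (N) holds, every rate $R<R_X(D)$ is achievable by iid $p_X$ random codes. * (Case 4) If $X,Y\subseteq\mathbb R^\gamma$, $V$ is finite and (N) holds, every rate $R<R_{X|V}(D)$ is achievable by iid $p_{X|V}$ random codes. * (Case 5) If $X,Y$ are finite ($d\ge0$ arbitrary), $V\subseteq\mathbb R^\eta$, and $\mathrm{TC}(\{i\})$ holds for every $i\in X$, every rate $R<R_{X|V}(D)$ is achievable by iid $p_{X|V}$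 random codes. * (Case 6) If $X,Y\subseteq\mathbb R^\gamma$, $V\subseteq\mathbb R^\eta$, (N) holds, and $\mathrm{TC}(X\cap Q)$ holds for every $\Delta>0$ and every cube $Q=\prod_i[c_i\Delta,(c_i+1)\Delta)$, $c\in\mathbb Z^\gamma$, every rate $R<R_{X|V}(D)$ is achievable by iid $p_{X|V}$ random codes. -/

import Mathlib

open MeasureTheory ProbabilityTheory Filter Topology
open scoped ENNReal NNReal

namespace DirectConverse

noncomputable section

variable {X Y V : Type*} [MeasurableSpace X] [MeasurableSpace Y] [MeasurableSpace V]

/-! ### Information quantities (in bits) and rate-distortion functions -/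

/-- The mutual information `I(X;Y)`, in bits, of a pair `(X, Y)` with joint law `P`. -/
def mutualInfo (P : Measure (X × Y)) : ℝ≥0∞ :=
  InformationTheory.klDiv P (P.fst.prod P.snd) / ENNReal.ofReal (Real.log 2)

/-- The conditional mutual information `I(X;Y|V)`, in bits, where `V ∼ pV` and `κ v` is the
conditional law of `(X, Y)` given `V = v`, namely the divergence of `P_V P_{XY|V}` from
`P_V P_{X|V} P_{Y|V}`. -/
def condMutualInfo (pV : Measure V) (κ : Kernel V (X × Y)) : ℝ≥0∞ :=
  InformationTheory.klDiv (pV ⊗ₘ κ) (pV ⊗ₘ (κ.fst ×ₖ κ.snd)) / ENNReal.ofReal (Real.log 2)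

/-- The rate-distortion function `R_X(D)`: the infimum of `I(X;Y)` over all joint laws of `(X, Y)`
with `X ∼ p` and `E d(X,Y) ≤ D`. A joint law with first marginal `p` is `p ⊗ₘ W` for a
conditional law `W` of `Y` given `X`. -/
def rateDistortion (p : Measure X) (d : X → Y → ℝ) (D : ℝ) : ℝ≥0∞ :=
  ⨅ (W : Kernel X Y) (_ : IsMarkovKernel W)
    (_ : ∫⁻ z, ENNReal.ofReal (d z.1 z.2) ∂(p ⊗ₘ W) ≤ ENNReal.ofReal D),
    mutualInfo (p ⊗ₘ W)

/-- The conditional rate-distortion function `R_{X|V}(D)`: the infimum of `I(X;Y|V)` over all joint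
laws of `(V, X, Y)` with `(V, X) ∼ p_{VX}` and `E d(X,Y) ≤ D`. Such a joint law is given by the
conditional law `W` of `Y` given `(V, X)`. -/
def condRateDistortion (pV : Measure V) (pXV : Kernel V X) (d : X → Y → ℝ) (D : ℝ) : ℝ≥0∞ :=
  ⨅ (W : Kernel (V × X) Y) (_ : IsMarkovKernel W)
    (_ : ∫⁻ z, ENNReal.ofReal (d z.2.1 z.2.2) ∂(pV ⊗ₘ (pXV ⊗ₖ W)) ≤ ENNReal.ofReal D),
    condMutualInfo pV (pXV ⊗ₖ W)

/-! ### Attackers -/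

/-- A `D`-distortion attacker (with decay function `f`) for an iid `p` input. The attacker is a
randomized map from whole input sequences to whole output sequences. -/
def IsAttacker (p : Measure X) [IsProbabilityMeasure p] (d : X → Y → ℝ) (D : ℝ)
    (f : ℕ → ℝ≥0∞) (A : Kernel (ℕ → X) (ℕ → Y)) : Prop :=
  ∀ n : ℕ, 0 < n → ∀ t : ℕ,
    (Measure.infinitePi (fun _ : ℕ => p) ⊗ₘ A)
      {ω | D < (1 / (n : ℝ)) * ∑ u ∈ Finset.range n, d (ω.1 (t + u)) (ω.2 (t + u))} ≤ f n

/-- A `D`-distortion attacker (with decay function `f`) in the conditional problem: the attacker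
takes in both the whole sequence `V` and the whole input sequence, where the pairs `(V_i, X_i)`
are iid with `V_i ∼ pV` and `X_i ∼ pXV v` given `V_i = v`. -/
def IsCondAttacker (pV : Measure V) [IsProbabilityMeasure pV] (pXV : Kernel V X)
    [IsMarkovKernel pXV] (d : X → Y → ℝ) (D : ℝ)
    (f : ℕ → ℝ≥0∞) (A : Kernel (ℕ → V × X) (ℕ → Y)) : Prop :=
  ∀ n : ℕ, 0 < n → ∀ t : ℕ,
    (Measure.infinitePi (fun _ : ℕ => pV ⊗ₘ pXV) ⊗ₘ A)
      {ω | D < (1 / (n : ℝ)) * ∑ u ∈ Finset.range n, d (ω.1 (t + u)).2 (ω.2 (t + u))} ≤ f n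

/-! ### Random codes -/

/-- The number of messages of a code of rate `R` (bits per symbol) and block length `n`. -/
def numMessages (R : ℝ≥0) (n : ℕ) : ℕ := ⌈(2 : ℝ) ^ ((n : ℝ) * (R : ℝ))⌉₊

/-- The probability of decoding error when message `m` out of `M` is sent in the time block
`t, …, t + n - 1`, using an iid `p` random code.

The table `ω.1 : ℕ → Fin M → X` has iid `p` entries. Its columns in the time block are the random
codebook, which is known to the decoder. The attacker sees the row `m` of the table and nothing
else: the codeword of `m` in the block, and independent iid `p` symbols at the other times. -/
def errorProb (p : Measure X) [IsProbabilityMeasure p] (A : Kernel (ℕ → X) (ℕ → Y)) {M n : ℕ}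
    (dec : (Fin M → Fin n → X) × (Fin n → Y) → Fin M) (t : ℕ) (m : Fin M) : ℝ≥0∞ :=
  (Measure.infinitePi (fun _ : ℕ => Measure.pi (fun _ : Fin M => p)) ⊗ₘ
      A.comap (fun (T : ℕ → Fin M → X) (u : ℕ) => T u m)
        (measurable_pi_lambda _ fun u => (measurable_pi_apply m).comp (measurable_pi_apply u)))
    {ω | dec (fun j i => ω.1 (t + i) j, fun i => ω.2 (t + i)) ≠ m}

/-- Given `v`, `M` conditionally independent samples of the law `κ v`. -/
def iidKernel (κ : Kernel V X) [IsMarkovKernel κ] (M : ℕ) : Kernel V (Fin M → X) where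
  toFun v := Measure.pi (fun _ : Fin M => κ v)
  measurable' := by
    refine Measurable.measure_of_isPiSystem_of_isProbabilityMeasure
      generateFrom_pi.symm isPiSystem_pi ?_
    rintro _ ⟨s, hs, rfl⟩
    simp only [Measure.pi_pi]
    exact Finset.measurable_prod _ fun i _ => κ.measurable_coe (hs i (Set.mem_univ i))

instance (κ : Kernel V X) [IsMarkovKernel κ] (M : ℕ) : IsMarkovKernel (iidKernel κ M) :=
  ⟨fun v => inferInstanceAs (IsProbabilityMeasure (Measure.pi (fun _ : Fin M => κ v)))⟩

/-- The probability of decoding error when message `m` out of `M` is sent in the time block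
`t, …, t + n - 1`, using a random code whose codewords are, given the sequence `V`, independent
with independent entries of law `p_{X|V}`.

The table `ω.1` holds at each time `u` a value `V_u ∼ pV` and `M` symbols that are iid `pXV v` given
`V_u = v`, independently over time. The decoder knows the values `V_u` and the columns of the table
in the time block (the codebook). The attacker sees the whole sequence `V` and row `m` of the table:
the codeword of `m` in the block, and independent symbols of law `p_{X|V}` at the other times. -/
def condErrorProb (pV : Measure V) [IsProbabilityMeasure pV] (pXV : Kernel V X)
    [IsMarkovKernel pXV] (A : Kernel (ℕ → V × X) (ℕ → Y)) {M n : ℕ}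
    (dec : (Fin n → V) × (Fin M → Fin n → X) × (Fin n → Y) → Fin M) (t : ℕ) (m : Fin M) :
    ℝ≥0∞ :=
  (Measure.infinitePi (fun _ : ℕ => pV ⊗ₘ iidKernel pXV M) ⊗ₘ
      A.comap (fun (T : ℕ → V × (Fin M → X)) (u : ℕ) => ((T u).1, (T u).2 m))
        (measurable_pi_lambda _ fun u =>
          (measurable_fst.comp (measurable_pi_apply u)).prodMk
            ((measurable_pi_apply m).comp (measurable_snd.comp (measurable_pi_apply u)))))
    {ω | dec (fun i => (ω.1 (t + i)).1, fun j i => (ω.1 (t + i)).2 j, fun i => ω.2 (t + i)) ≠ m}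

/-- Rate `R` is achievable over `D`-distortion attack channels by iid `p` random codes: there are
decoders, one for each block length, such that for every decay function `f` and every `ε > 0`, at
all sufficiently large block lengths, against every `D`-distortion attacker with decay function `f`,
in every time block, every message is decoded with error probability at most `ε`. -/
def Achievable (p : Measure X) [IsProbabilityMeasure p] (d : X → Y → ℝ) (D : ℝ) (R : ℝ≥0) : Prop :=
  ∃ dec : ∀ n : ℕ, (Fin (numMessages R n) → Fin n → X) × (Fin n → Y) → Fin (numMessages R n),
    (∀ n, Measurable (dec n)) ∧
    ∀ f : ℕ → ℝ≥0∞, Tendsto f atTop (𝓝 0) → ∀ ε : ℝ≥0∞, 0 < ε →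
      ∃ N : ℕ, ∀ n ≥ N, ∀ A : Kernel (ℕ → X) (ℕ → Y), IsMarkovKernel A → IsAttacker p d D f A →
        ∀ (t : ℕ) (m : Fin (numMessages R n)), errorProb p A (dec n) t m ≤ ε

/-- Rate `R` is achievable over `D`-distortion attack channels by iid `p_{X|V}` random codes, when
`V` is known noncausally to the encoder, the decoder and the attacker. -/
def CondAchievable (pV : Measure V) [IsProbabilityMeasure pV] (pXV : Kernel V X)
    [IsMarkovKernel pXV] (d : X → Y → ℝ) (D : ℝ) (R : ℝ≥0) : Prop :=
  ∃ dec : ∀ n : ℕ, (Fin n → V) × (Fin (numMessages R n) → Fin n → X) × (Fin n → Y) →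
      Fin (numMessages R n),
    (∀ n, Measurable (dec n)) ∧
    ∀ f : ℕ → ℝ≥0∞, Tendsto f atTop (𝓝 0) → ∀ ε : ℝ≥0∞, 0 < ε →
      ∃ N : ℕ, ∀ n ≥ N, ∀ A : Kernel (ℕ → V × X) (ℕ → Y), IsMarkovKernel A →
        IsCondAttacker pV pXV d D f A →
        ∀ (t : ℕ) (m : Fin (numMessages R n)), condErrorProb pV pXV A (dec n) t m ≤ ε

/-! ### Conditions -/

/-- Either almost every source letter can be reproduced within one common finite distortion, or `D`
is not equal to the smallest possible expected distortion `E inf_y d(X,y)`. -/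
def Nondegenerate (p : Measure X) (d : X → Y → ℝ) (D : ℝ) : Prop :=
  (∃ B : ℝ, ∀ᵐ x ∂p, ∃ y, d x y ≤ B) ∨
    ∫⁻ x, ⨅ y, ENNReal.ofReal (d x y) ∂p ≠ ENNReal.ofReal D

/-- The cells of the hypercube grid of side `Δ` in `ℝ^k`. -/
def gridCell {k : ℕ} (Δ : ℝ) (c : Fin k → ℤ) : Set (EuclideanSpace ℝ (Fin k)) :=
  {s | ∀ i, (c i : ℝ) * Δ ≤ s i ∧ s i < ((c i : ℝ) + 1) * Δ}

/-- The technical continuity condition for one subset `A` of the source alphabet: on every bounded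
part of the alphabet `𝒱`, the difference between the supremum and the infimum of `P(X ∈ A | V = s)`
over `s` in a grid cell of side `Δ'` tends to `0` as `Δ' → 0`, uniformly over the cells. -/
def TechnicalCondition {k : ℕ} {𝒱 : Set (EuclideanSpace ℝ (Fin k))} (pXV : Kernel 𝒱 X)
    (A : Set X) : Prop :=
  ∀ r : ℝ, Tendsto
    (fun Δ' : ℝ => ⨆ c : Fin k → ℤ,
      (⨆ s ∈ {s : 𝒱 | (s : EuclideanSpace ℝ (Fin k)) ∈ gridCell Δ' c ∧
          ‖(s : EuclideanSpace ℝ (Fin k))‖ ≤ r}, pXV s A) -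
      (⨅ s ∈ {s : 𝒱 | (s : EuclideanSpace ℝ (Fin k)) ∈ gridCell Δ' c ∧
          ‖(s : EuclideanSpace ℝ (Fin k))‖ ≤ r}, pXV s A))
    (𝓝[>] 0) (𝓝 0)

end

end DirectConverse

namespace DirectConverse

noncomputable section

set_option linter.unusedSectionVars false

open InformationTheory

/-! ### Minimizing the mean negative logarithm over a mixture-closed family. -/

section

variable {X Y V : Type*} [MeasurableSpace X] [MeasurableSpace Y] [MeasurableSpace V]

/-! ### The negative logarithm on `[0, ∞]` -/

/-! The decoder thresholds the product over the block of a(v,x,y) = α(v,x) K(x,y), where typically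
K(x,y) = exp(-l d(x,y)) and α is a bounded positive multiplier such that ∫ a(v,x,y) p(dx|v) ≤ 1 for
almost every (v,y), under every law of (V,Y) with the right V-marginal. A codeword that was not sent
is, given V, independent of the attacker's output, so its product has mean at most 1; Markov's
inequality and a union bound handle all such codewords when the threshold exp(nr) beats 2^(nR). For
the sent codeword the two factors separate. The product of K is at least exp(-nlD) whenever the
distortion constraint holds, whatever else the attacker does. The product of α involves only the iid
pairs (V,X), which the attacker cannot influence, so the law of large numbers makes it about exp(n E
log α). The alphabets need no quantization, and the decoder depends neither on the attacker nor on
the decay function (`condErrorProb_thresholdDecoder_le`, `condAchievable_of_responses`).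

What remains is convex duality: find l and α with E log α - lD above the rate, in nats. For an
output kernel Q write g_Q(v,x) = ∫ K(x,y) Q(dy|v), its response. Tilting Q by K attains the Gibbs
bound, which relates E[-log g_Q] to divergence plus l times cost (`exists_channelDiv_add_le`), and a
supporting line of the divergence-cost region gives l (`exists_lagrange_multiplier`,
`exists_slope`). Hence every response satisfies E[-log g_Q] ≥ r' + lD with r' above the rate. The
multiplier comes from the first-order condition at a nearly log-optimal response g₀: E[g/g₀] is at
most about 1 for all responses g. Since Q is arbitrary, this becomes a bound on ∫ K(x,y)/g₀(v,x)
p(dx|v) by a function of v with mean about 1 (`exists_channel_bound`), and dividing by that function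
gives α (`exists_multiplier`).

Logarithms may be infinite and optimizers need not exist, so all responses are shifted by a small c
> 0. That this costs little uniformly is the analytic core
(`IsMixtureClosed.exists_forall_le_integral_log`): near-minimizers converge almost everywhere by
strong concavity of the logarithm, and mixing in one element of finite mean negative logarithm
restores domination.

A supporting line of finite slope may fail to exist when D equals the least expected distortion E
inf_y d(X,y). If inf_y d(X,y) is bounded and not constant, the central limit theorem rules out
attackers; if it is constant, the indicator of d ≤ D replaces the exponential kernel
(`condAchievable_of_eq_min`). The problem without side information is the case of a one-point V. -/

/-- The positive part of `- log x`, with value `∞` at `0`. -/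
def negLog (x : ℝ≥0∞) : ℝ≥0∞ := (-ENNReal.log x).toENNReal

lemma continuous_negLog : Continuous negLog :=
  EReal.continuous_toENNReal.comp (continuous_neg.comp ENNReal.continuous_log)

@[fun_prop]
lemma measurable_negLog : Measurable negLog := continuous_negLog.measurable

lemma antitone_negLog : Antitone negLog := fun _ _ h =>
  EReal.toENNReal_le_toENNReal (EReal.neg_le_neg_iff.2 (ENNReal.log_monotone h))

@[simp] lemma negLog_zero : negLog 0 = ⊤ := by simp [negLog]

@[simp] lemma negLog_one : negLog 1 = 0 := by simp [negLog]

lemma negLog_ofReal {x : ℝ} (hx : 0 < x) :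
    negLog (ENNReal.ofReal x) = ENNReal.ofReal (-Real.log x) := by
  rw [negLog, ENNReal.log_ofReal_of_pos hx, ← EReal.coe_neg, EReal.toENNReal_of_ne_top (by simp)]
  simp

lemma negLog_eq_top_iff {x : ℝ≥0∞} : negLog x = ⊤ ↔ x = 0 := by
  refine ⟨fun h => ?_, fun h => by simp [h]⟩
  by_contra h0
  rcases eq_or_ne x ⊤ with rfl | hx
  · simp [negLog] at h
  · rw [← ENNReal.ofReal_toReal hx, negLog_ofReal (ENNReal.toReal_pos h0 hx)] at h
    exact ENNReal.ofReal_ne_top h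

lemma negLog_of_le_one {x : ℝ≥0∞} (h0 : x ≠ 0) (h1 : x ≤ 1) :
    negLog x = ENNReal.ofReal (-Real.log x.toReal) := by
  have hx : x ≠ ⊤ := ne_top_of_le_ne_top ENNReal.one_ne_top h1
  conv_lhs => rw [← ENNReal.ofReal_toReal hx]
  exact negLog_ofReal (ENNReal.toReal_pos h0 hx)

/-- Truncation at 0 would destroy additivity for arguments above 1. This is why later estimates keep
all arguments in [0,1]. -/
lemma negLog_mul {x y : ℝ≥0∞} (hx : x ≤ 1) (hy : y ≤ 1) :
    negLog (x * y) = negLog x + negLog y := by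
  rcases eq_or_ne x 0 with rfl | hx0
  · simp
  rcases eq_or_ne y 0 with rfl | hy0
  · simp
  have h1 : x.toReal ≤ 1 := by simpa using ENNReal.toReal_mono ENNReal.one_ne_top hx
  have h2 : y.toReal ≤ 1 := by simpa using ENNReal.toReal_mono ENNReal.one_ne_top hy
  have h3 := ENNReal.toReal_pos hx0 (ne_top_of_le_ne_top ENNReal.one_ne_top hx)
  have h4 := ENNReal.toReal_pos hy0 (ne_top_of_le_ne_top ENNReal.one_ne_top hy)
  rw [negLog_of_le_one hx0 hx, negLog_of_le_one hy0 hy,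
    negLog_of_le_one (mul_ne_zero hx0 hy0) (mul_le_one' hx hy), ← ENNReal.ofReal_add,
    ENNReal.toReal_mul, Real.log_mul h3.ne' h4.ne', neg_add]
  · linarith [Real.log_nonpos h3.le h1]
  · linarith [Real.log_nonpos h4.le h2]

lemma negLog_pow {x : ℝ≥0∞} (hx : x ≤ 1) (n : ℕ) : negLog (x ^ n) = n * negLog x := by
  induction n with
  | zero => simp
  | succ n ih =>
    rw [pow_succ, negLog_mul (pow_le_one' hx n) hx, ih]
    push_cast; ring

/-! ### Log-optimal elements of convex families -/

/-- Quantitative concavity of the logarithm on (0,2], from log s ≤ s - 1 at the ratio s of squared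
geometric to squared arithmetic mean. It makes near-minimizers of E[-log g] close in L². -/
lemma sq_sub_div_le_log_midpoint {a b : ℝ} (ha : 0 < a) (hb : 0 < b) (ha2 : a ≤ 2) (hb2 : b ≤ 2) :
    (a - b) ^ 2 / 32 ≤ Real.log ((a + b) / 2) - (Real.log a + Real.log b) / 2 := by
  have hab : 0 < a + b := by positivity
  have h1 : Real.log (4 * (a * b) / (a + b) ^ 2) ≤ 4 * (a * b) / (a + b) ^ 2 - 1 :=
    Real.log_le_sub_one_of_pos (by positivity)
  have h2 : Real.log (4 * (a * b) / (a + b) ^ 2)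
      = Real.log a + Real.log b - 2 * Real.log ((a + b) / 2) := by
    have : 4 * (a * b) / (a + b) ^ 2 = (a * b) / ((a + b) / 2) ^ 2 := by field_simp; ring
    rw [this, Real.log_div (by positivity) (by positivity), Real.log_mul ha.ne' hb.ne',
      Real.log_pow]
    push_cast; ring
  have h3 : 4 * (a * b) / (a + b) ^ 2 - 1 = - ((a - b) ^ 2 / (a + b) ^ 2) := by
    field_simp; ring
  have h4 : (a - b) ^ 2 / 16 ≤ (a - b) ^ 2 / (a + b) ^ 2 := by
    apply div_le_div_of_nonneg_left (sq_nonneg _) (by positivity)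
    nlinarith
  linarith

/-- A family of `[0,1]`-valued measurable functions which is closed under countable mixtures. -/
structure IsMixtureClosed {Ω : Type*} [MeasurableSpace Ω] (C : Set (Ω → ℝ≥0∞)) : Prop where
  measurable : ∀ g ∈ C, Measurable g
  le_one : ∀ g ∈ C, ∀ ω, g ω ≤ 1
  mix : ∀ (w : ℕ → ℝ≥0∞) (g : ℕ → Ω → ℝ≥0∞), ∑' i, w i = 1 → (∀ i, g i ∈ C) →
    (fun ω => ∑' i, w i * g i ω) ∈ C

variable {Ω : Type*} [MeasurableSpace Ω] {C : Set (Ω → ℝ≥0∞)}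

lemma IsMixtureClosed.mix_two (hC : IsMixtureClosed C) {g h : Ω → ℝ≥0∞} (hg : g ∈ C) (hh : h ∈ C)
    {a b : ℝ≥0∞} (hab : a + b = 1) : (fun ω => a * g ω + b * h ω) ∈ C := by
  have key : ∀ F : ℕ → ℝ≥0∞, ∑' i, (if i = 0 then a else if i = 1 then b else 0) * F i
      = a * F 0 + b * F 1 := fun F => by
    rw [tsum_eq_sum (s := {0, 1})]
    · simp
    · intro i hi
      simp only [Finset.mem_insert, Finset.mem_singleton, not_or] at hi
      simp [hi.1, hi.2]
  have := hC.mix (fun i => if i = 0 then a else if i = 1 then b else 0)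
    (fun i => if i = 0 then g else h) (by simpa [hab] using key 1)
    (fun i => by split_ifs <;> assumption)
  convert this using 2 with ω
  rw [key (fun i => (if i = 0 then g else h) ω)]
  simp

lemma IsMixtureClosed.toReal_le (hC : IsMixtureClosed C) {g : Ω → ℝ≥0∞} (hg : g ∈ C) (ω : Ω) :
    (g ω).toReal ≤ 1 := by
  simpa using ENNReal.toReal_mono ENNReal.one_ne_top (hC.le_one g hg ω)

lemma IsMixtureClosed.ne_top (hC : IsMixtureClosed C) {g : Ω → ℝ≥0∞} (hg : g ∈ C) (ω : Ω) :
    g ω ≠ ⊤ := ne_top_of_le_ne_top ENNReal.one_ne_top (hC.le_one g hg ω)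

lemma IsMixtureClosed.integrable_log (hC : IsMixtureClosed C) (μ : Measure Ω) [IsFiniteMeasure μ]
    {g : Ω → ℝ≥0∞} (hg : g ∈ C) {c : ℝ} (hc : 0 < c) :
    Integrable (fun ω => -Real.log ((g ω).toReal + c)) μ := by
  have hm := (hC.measurable g hg).ennreal_toReal
  refine Integrable.of_bound (C := max |Real.log c| |Real.log (1 + c)|)
    (Real.measurable_log.comp (hm.add_const c)).neg.aestronglyMeasurable (ae_of_all _ fun ω => ?_)
  rw [norm_neg, Real.norm_eq_abs]
  have h0 : (0 : ℝ) ≤ (g ω).toReal := ENNReal.toReal_nonneg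
  exact abs_le_max_abs_abs (Real.log_le_log hc (by linarith))
    (Real.log_le_log (by linarith) (by linarith [hC.toReal_le hg ω]))

/-- If a sequence in the family converges to a limit whose negative logarithm is integrable, then
the family has an element whose negative logarithm is integrable. -/
lemma IsMixtureClosed.exists_lintegral_negLog_lt_top (hC : IsMixtureClosed C) {μ : Measure Ω}
    [IsFiniteMeasure μ] {g : ℕ → Ω → ℝ≥0∞} (hg : ∀ k, g k ∈ C) {u : Ω → ℝ≥0∞} (hu : Measurable u)
    (hu1 : ∀ᵐ ω ∂μ, u ω ≤ 1) (hlim : ∀ᵐ ω ∂μ, Tendsto (fun k => g k ω) atTop (𝓝 (u ω)))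
    (hfin : ∫⁻ ω, negLog (u ω) ∂μ < ⊤) : ∃ h ∈ C, ∫⁻ ω, negLog (h ω) ∂μ < ⊤ := by
  have hupos : ∀ᵐ ω ∂μ, u ω ≠ 0 := by
    filter_upwards [ae_lt_top (measurable_negLog.comp hu) hfin.ne] with ω hω h0
    simp [h0] at hω
  -- Outside `B k`, the element `g k` is as good as u up to a factor 2. A subsequence with rapidly
  -- vanishing μ(B) is mixed geometrically. At ω the first good index τ gives a mixture value of at
  -- least 2^(-(τ+2)) u, costing τ + 2 extra units of log 2; τ is at most the number of bad sets
  -- containing ω, whose mean is at most 2.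
  set B : ℕ → Set Ω := fun k => {ω | g k ω < u ω / 2} with hB
  have hBm : ∀ k, MeasurableSet (B k) := fun k =>
    measurableSet_lt (hC.measurable _ (hg k)) (hu.div_const 2)
  have hBlim : Tendsto (fun k => μ (B k)) atTop (𝓝 0) := by
    have := tendsto_measure_of_ae_tendsto_indicator (μ := μ) (L := atTop) (A := ∅) (As := B)
      MeasurableSet.empty hBm (B := Set.univ) MeasurableSet.univ (measure_ne_top μ _)
      (Eventually.of_forall fun _ => Set.subset_univ _) ?_
    · simpa using this
    · filter_upwards [hupos, hlim, hu1] with ω h0 hl h1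
      have hlt : u ω / 2 < u ω :=
        ENNReal.half_lt_self h0 (ne_top_of_le_ne_top ENNReal.one_ne_top h1)
      filter_upwards [hl.eventually_const_lt hlt] with k hk
      simp [hB, hk.le]
  have hex : ∀ i : ℕ, ∃ k, μ (B k) < (2⁻¹ : ℝ≥0∞) ^ i := fun i =>
    (hBlim.eventually_lt_const (ENNReal.pow_pos (by simp) i)).exists
  choose ψ hψ using hex
  have hsum : ∑' i : ℕ, (2⁻¹ : ℝ≥0∞) ^ (i + 1) = 1 := by
    rw [ENNReal.tsum_geometric_add_one, ENNReal.one_sub_inv_two, inv_inv,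
      ENNReal.inv_mul_cancel (by simp) (by simp)]
  have hsum' : ∑' i : ℕ, (2⁻¹ : ℝ≥0∞) ^ i = 2 := ENNReal.tsum_geometric_two
  set κ := negLog 2⁻¹ with hκ
  have hκtop : κ ≠ ⊤ := by simp [hκ, negLog_eq_top_iff]
  have hκ0 : κ ≠ 0 := by
    have : (2⁻¹ : ℝ≥0∞) = ENNReal.ofReal 2⁻¹ := by
      rw [ENNReal.ofReal_inv_of_pos (by norm_num)]; simp
    rw [hκ, this, negLog_ofReal (by norm_num)]
    simp [Real.log_pos one_lt_two]
  refine ⟨_, hC.mix _ (fun i => g (ψ i)) hsum fun i => hg _, ?_⟩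
  have hbound : ∀ᵐ ω ∂μ, negLog (∑' i, (2⁻¹ : ℝ≥0∞) ^ (i + 1) * g (ψ i) ω) ≤
      negLog (u ω) + 2 * κ + κ * ∑' i, (B (ψ i)).indicator 1 ω := by
    filter_upwards [hu1] with ω h1
    by_cases hall : ∀ i, ω ∈ B (ψ i)
    · have : ∑' i, (B (ψ i)).indicator (1 : Ω → ℝ≥0∞) ω = ⊤ := by
        simp [hall]
      simp [this, ENNReal.mul_top hκ0]
    · push Not at hall
      classical
      have hτ := Nat.find_spec hall
      set τ := Nat.find hall
      have h2 : (2⁻¹ : ℝ≥0∞) ^ (τ + 2) * u ω ≤ ∑' i, (2⁻¹ : ℝ≥0∞) ^ (i + 1) * g (ψ i) ω := by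
        refine le_trans ?_ (ENNReal.le_tsum τ)
        rw [pow_succ, mul_assoc]
        gcongr
        have : u ω / 2 ≤ g (ψ τ) ω := by simpa [hB] using hτ
        rwa [mul_comm, ← div_eq_mul_inv]
      have h3 : (τ : ℝ≥0∞) ≤ ∑' i, (B (ψ i)).indicator 1 ω := by
        refine le_trans ?_ (ENNReal.sum_le_tsum (Finset.range τ))
        rw [Finset.sum_congr rfl (g := fun _ => (1 : ℝ≥0∞))]
        · simp
        · intro i hi
          have : ω ∈ B (ψ i) := by simpa using Nat.find_min hall (Finset.mem_range.1 hi)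
          simp [this]
      calc _ ≤ negLog ((2⁻¹ : ℝ≥0∞) ^ (τ + 2) * u ω) := antitone_negLog h2
        _ = (τ + 2 : ℕ) * κ + negLog (u ω) := by
          rw [negLog_mul (pow_le_one' (by simp) _) h1, negLog_pow (by simp)]
        _ = negLog (u ω) + 2 * κ + κ * τ := by push_cast; ring
        _ ≤ _ := by gcongr
  refine (lintegral_mono_ae hbound).trans_lt ?_
  have hBi : ∀ i, Measurable ((B (ψ i)).indicator (1 : Ω → ℝ≥0∞)) := fun i =>
    measurable_one.indicator (hBm _)
  rw [lintegral_add_right _ (by fun_prop), lintegral_add_right _ (by fun_prop),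
    lintegral_const_mul κ (by fun_prop), lintegral_tsum fun i => (hBi i).aemeasurable]
  simp only [lintegral_indicator_one (hBm _)]
  refine ENNReal.add_lt_top.2 ⟨ENNReal.add_lt_top.2 ⟨hfin, ?_⟩, ENNReal.mul_lt_top hκtop.lt_top ?_⟩
  · simp only [lintegral_const]
    exact ENNReal.mul_lt_top (ENNReal.mul_lt_top (by simp) hκtop.lt_top) (measure_lt_top _ _)
  · exact (ENNReal.tsum_le_tsum fun i => (hψ i).le).trans_lt (by rw [hsum']; simp)

/-- First-order optimality of a nearly log-optimal element. -/
theorem IsMixtureClosed.exists_forall_integral_div_le (hC : IsMixtureClosed C) {μ : Measure Ω}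
    [IsProbabilityMeasure μ] (hne : C.Nonempty) {c ε : ℝ} (hc : 0 < c) (hc1 : c ≤ 1)
    (hε : 0 < ε) : ∃ g₀ ∈ C, ∀ g ∈ C,
      ∫ ω, ((g ω).toReal + c) / ((g₀ ω).toReal + c) ∂μ ≤ 1 + ε := by
  wlog hε1 : ε ≤ 1 generalizing ε
  · obtain ⟨g₀, h₀, h⟩ := this one_pos le_rfl
    exact ⟨g₀, h₀, fun g hg => (h g hg).trans (by linarith)⟩
  have hint := fun (g : Ω → ℝ≥0∞) (hg : g ∈ C) => hC.integrable_log μ hg hc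
  set Φ : (Ω → ℝ≥0∞) → ℝ := fun g => ∫ ω, -Real.log ((g ω).toReal + c) ∂μ with hΦ
  have hbdd : BddBelow (Φ '' C) := ⟨-Real.log 2, by
    rintro _ ⟨g, hg, rfl⟩
    have : ∫ _, -Real.log 2 ∂μ ≤ Φ g := by
      refine integral_mono (integrable_const _) (hint g hg) fun ω => ?_
      have := hC.toReal_le hg ω
      have h0 : (0 : ℝ) ≤ (g ω).toReal := ENNReal.toReal_nonneg
      exact neg_le_neg (Real.log_le_log (by linarith) (by linarith))
    simpa using this⟩
  -- The step from g₀ towards g has length t. Its second-order error 2t²/c² equals tε/2, and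
  -- near-optimality within tε/2 costs as much again; dividing by t leaves ε.
  set t : ℝ := ε * c ^ 2 / 4 with ht
  have ht0 : 0 < t := by positivity
  have ht1 : t ≤ c / 4 := by rw [ht]; nlinarith [mul_pos hε hc, mul_pos hc hc]
  obtain ⟨_, ⟨g₀, hg₀, rfl⟩, hlt⟩ := exists_lt_of_csInf_lt (hne.image Φ)
    (lt_add_of_pos_right (sInf (Φ '' C)) (show 0 < t * (ε / 2) by positivity))
  refine ⟨g₀, hg₀, fun g hg => ?_⟩
  have htt : ENNReal.ofReal (1 - t) + ENNReal.ofReal t = 1 := by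
    rw [← ENNReal.ofReal_add (by linarith) ht0.le]; simp
  have hmix := hC.mix_two hg₀ hg htt
  have h1 := csInf_le hbdd ⟨_, hmix, rfl⟩
  have hm := fun (g : Ω → ℝ≥0∞) (hg : g ∈ C) => (hC.measurable g hg).ennreal_toReal
  have h0 : ∀ (g : Ω → ℝ≥0∞) ω, (0 : ℝ) ≤ (g ω).toReal := fun _ _ => ENNReal.toReal_nonneg
  have hzb : ∀ ω, |((g ω).toReal - (g₀ ω).toReal) / ((g₀ ω).toReal + c)| ≤ 1 / c := fun ω => by
    have := h0 g₀ ω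
    rw [abs_div, abs_of_pos (show 0 < (g₀ ω).toReal + c by linarith)]
    refine div_le_div₀ zero_le_one ?_ hc (by linarith)
    rw [abs_le]
    constructor <;> linarith [hC.toReal_le hg ω, hC.toReal_le hg₀ ω, h0 g ω]
  have hzi : Integrable (fun ω => ((g ω).toReal - (g₀ ω).toReal) / ((g₀ ω).toReal + c)) μ :=
    Integrable.of_bound (C := 1 / c) (((hm g hg).sub (hm g₀ hg₀)).div
      ((hm g₀ hg₀).add_const c)).aestronglyMeasurable (ae_of_all _ hzb)
  have h2 : Φ (fun ω => ENNReal.ofReal (1 - t) * g₀ ω + ENNReal.ofReal t * g ω) ≤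
      ∫ ω, (-Real.log ((g₀ ω).toReal + c)
        - (t * (((g ω).toReal - (g₀ ω).toReal) / ((g₀ ω).toReal + c))
          - 2 * t ^ 2 / c ^ 2)) ∂μ := by
    refine integral_mono (hint _ hmix) ((hint _ hg₀).sub ((hzi.const_mul t).sub
      (integrable_const _))) fun ω => ?_
    have hu : 0 < (g₀ ω).toReal + c := by linarith [h0 g₀ ω]
    set z := ((g ω).toReal - (g₀ ω).toReal) / ((g₀ ω).toReal + c) with hz
    have hzb' := hzb ω
    rw [← hz] at hzb'
    have hz2 : z ^ 2 ≤ 1 / c ^ 2 := by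
      rw [← sq_abs, ← one_div_pow]; exact pow_le_pow_left₀ (abs_nonneg _) hzb' 2
    have htz : |t * z| ≤ 1 / 4 := by
      rw [abs_mul, abs_of_pos ht0]
      calc t * |z| ≤ (c / 4) * (1 / c) := mul_le_mul ht1 hzb' (abs_nonneg _) (by positivity)
        _ = 1 / 4 := by field_simp
    obtain ⟨htz1, htz2⟩ := abs_le.1 htz
    have heq : (ENNReal.ofReal (1 - t) * g₀ ω + ENNReal.ofReal t * g ω).toReal + c
        = ((g₀ ω).toReal + c) * (1 + t * z) := by
      have := hC.ne_top hg ω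
      have := hC.ne_top hg₀ ω
      rw [ENNReal.toReal_add (by finiteness) (by finiteness), ENNReal.toReal_mul,
        ENNReal.toReal_mul, ENNReal.toReal_ofReal ht0.le, ENNReal.toReal_ofReal (by linarith), hz]
      field_simp; ring
    -- Second-order lower bound for the logarithm near 1, valid because |tz| ≤ 1/4.
    have hlog : t * z - 2 * (t * z) ^ 2 ≤ Real.log (1 + t * z) := by
      have h3 : 1 - (1 + t * z)⁻¹ ≤ Real.log (1 + t * z) :=
        Real.one_sub_inv_le_log_of_pos (by linarith)
      refine le_trans ?_ h3
      have h4 : 0 < 1 + t * z := by linarith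
      rw [← sub_nonneg]
      have : 1 - (1 + t * z)⁻¹ - (t * z - 2 * (t * z) ^ 2)
          = (t * z) ^ 2 * (1 + 2 * (t * z)) / (1 + t * z) := by
        field_simp; ring
      rw [this]
      exact div_nonneg (mul_nonneg (sq_nonneg _) (by linarith)) h4.le
    have h5 : 2 * (t * z) ^ 2 ≤ 2 * t ^ 2 / c ^ 2 := by
      rw [mul_pow, mul_div_assoc, div_eq_mul_one_div (t ^ 2)]
      gcongr
    beta_reduce
    rw [heq, Real.log_mul hu.ne' (by linarith)]
    linarith
  rw [integral_sub (hint _ hg₀) (by exact (hzi.const_mul t).sub (integrable_const _)),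
    integral_sub (hzi.const_mul t) (integrable_const _), integral_const_mul] at h2
  simp only [integral_const, probReal_univ, one_smul] at h2
  have h3 : t * ∫ ω, ((g ω).toReal - (g₀ ω).toReal) / ((g₀ ω).toReal + c) ∂μ ≤ t * ε := by
    have h4 : 2 * t ^ 2 / c ^ 2 = t * (ε / 2) := by rw [ht]; field_simp; ring
    simp only [hΦ] at h1 h2 hlt
    linarith
  have h4 := le_of_mul_le_mul_left h3 ht0
  have h5 : ∀ ω, ((g ω).toReal + c) / ((g₀ ω).toReal + c) =
      1 + ((g ω).toReal - (g₀ ω).toReal) / ((g₀ ω).toReal + c) := fun ω => by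
    have : (g₀ ω).toReal + c ≠ 0 := by linarith [h0 g₀ ω]
    field_simp; ring
  simp_rw [h5]
  rw [integral_add (integrable_const _) hzi]
  simpa using h4

/-- Integrals of logarithms over a mixture-closed family are continuous under adding a small
constant. -/
theorem IsMixtureClosed.exists_forall_le_integral_log (hC : IsMixtureClosed C) {μ : Measure Ω}
    [IsProbabilityMeasure μ] {A A' : ℝ} (hA : A' < A)
    (h : ∀ g ∈ C, ENNReal.ofReal A ≤ ∫⁻ ω, negLog (g ω) ∂μ) :
    ∃ c : ℝ, 0 < c ∧ c ≤ 1 ∧ ∀ g ∈ C, A' ≤ ∫ ω, -Real.log ((g ω).toReal + c) ∂μ := by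
  by_contra hcon
  push Not at hcon
  set Φ : ℝ → (Ω → ℝ≥0∞) → ℝ := fun c g => ∫ ω, -Real.log ((g ω).toReal + c) ∂μ with hΦ
  have hint := fun (g : Ω → ℝ≥0∞) (hg : g ∈ C) (c : ℝ) (hc : 0 < c) => hC.integrable_log μ hg hc
  set c : ℕ → ℝ := fun k => 1 / ((k : ℝ) + 1) with hcdef
  have hc0 : ∀ k, 0 < c k := fun k => by positivity
  have hc1 : ∀ k, c k ≤ 1 := fun k => by
    simp only [hcdef]; rw [div_le_one (by positivity)]; linarith [Nat.cast_nonneg (α := ℝ) k]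
  have hcanti : Antitone c := fun i j hij => one_div_le_one_div_of_le (by positivity) (by
    have : (i : ℝ) ≤ j := by exact_mod_cast hij
    linarith)
  have hclim : Tendsto c atTop (𝓝 0) := tendsto_one_div_add_atTop_nhds_zero_nat
  have hbdd : ∀ k, BddBelow (Φ (c k) '' C) := fun k => ⟨-Real.log 2, by
    rintro _ ⟨g, hg, rfl⟩
    have : ∫ _, -Real.log 2 ∂μ ≤ Φ (c k) g := by
      refine integral_mono (integrable_const _) (hint g hg _ (hc0 k)) fun ω => ?_
      have := hC.toReal_le hg ω
      have h0 : (0 : ℝ) ≤ (g ω).toReal := ENNReal.toReal_nonneg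
      exact neg_le_neg (Real.log_le_log (by linarith [hc0 k]) (by linarith [hc1 k]))
    simpa using this⟩
  have hne : ∀ k, (Φ (c k) '' C).Nonempty := fun k =>
    let ⟨g, hg, _⟩ := hcon (c k) (hc0 k) (hc1 k); ⟨_, g, hg, rfl⟩
  -- The infimum with shift c increases as c decreases, and by contradiction it stays at most A'. It
  -- therefore converges, which is what makes near-minimizers for different shifts comparable.
  set ℓ : ℕ → ℝ := fun k => sInf (Φ (c k) '' C) with hℓ
  have hℓle : ∀ k, ∀ g ∈ C, ℓ k ≤ Φ (c k) g := fun k g hg => csInf_le (hbdd k) ⟨g, hg, rfl⟩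
  have hℓA : ∀ k, ℓ k ≤ A' := fun k =>
    let ⟨g, hg, hlt⟩ := hcon (c k) (hc0 k) (hc1 k); (hℓle k g hg).trans hlt.le
  have hℓmono : Monotone ℓ := fun i j hij => le_csInf (hne j) (by
    rintro _ ⟨g, hg, rfl⟩
    refine (hℓle i g hg).trans (integral_mono (hint g hg _ (hc0 i)) (hint g hg _ (hc0 j))
      fun ω => neg_le_neg (Real.log_le_log ?_ ?_))
    · have h0 : (0 : ℝ) ≤ (g ω).toReal := ENNReal.toReal_nonneg
      linarith [hc0 j]
    · linarith [hcanti hij])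
  have hℓlim : Tendsto ℓ atTop (𝓝 (⨆ k, ℓ k)) :=
    tendsto_atTop_ciSup hℓmono ⟨A', by rintro _ ⟨k, rfl⟩; exact hℓA k⟩
  set L := ⨆ k, ℓ k
  have hℓL : ∀ k, ℓ k ≤ L := hℓmono.ge_of_tendsto hℓlim
  have hnear : ∀ k, ∃ g ∈ C, Φ (c k) g < ℓ k + c k := fun k => by
    obtain ⟨_, ⟨g, hg, rfl⟩, hlt⟩ := exists_lt_of_csInf_lt (hne k) (lt_add_of_pos_right _ (hc0 k))
    exact ⟨g, hg, hlt⟩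
  choose g hgC hgΦ using hnear
  -- the near-optimal elements are Cauchy
  have hgm : ∀ k, Measurable fun ω => (g k ω).toReal := fun k =>
    (hC.measurable _ (hgC k)).ennreal_toReal
  set u : ℕ → Ω → ℝ := fun k ω => (g k ω).toReal + c k with hu
  have hum : ∀ k, Measurable (u k) := fun k => (hgm k).add_const _
  have hupos : ∀ k ω, 0 < u k ω := fun k ω => by
    have h0 : (0 : ℝ) ≤ (g k ω).toReal := ENNReal.toReal_nonneg
    simp only [hu]; linarith [hc0 k]
  have hu2 : ∀ k ω, u k ω ≤ 2 := fun k ω => by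
    simp only [hu]; linarith [hc1 k, hC.toReal_le (hgC k) ω]
  have hsqint : ∀ j k, Integrable (fun ω => (u j ω - u k ω) ^ 2) μ := fun j k => by
    refine Integrable.of_bound (C := 4) (((hum j).sub (hum k)).pow_const 2).aestronglyMeasurable
      (ae_of_all _ fun ω => ?_)
    rw [Real.norm_eq_abs, abs_of_nonneg (sq_nonneg _)]
    nlinarith [hupos j ω, hupos k ω, hu2 j ω, hu2 k ω]
  -- The midpoint of two near-minimizers cannot beat ℓ_j, so the gain from concavity, the mean
  -- squared difference over 32, is bounded by the gap L - ℓ_j plus the tolerance c_j. The average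
  -- of the shifts c_j and c_k is at most c_j.
  have hcau : ∀ j k, j ≤ k → ∫ ω, (u j ω - u k ω) ^ 2 ∂μ ≤ 32 * (L - ℓ j + c j) := by
    intro j k hjk
    have hmid := hC.mix_two (hgC j) (hgC k) (a := 2⁻¹) (b := 2⁻¹) (ENNReal.inv_two_add_inv_two)
    have h1 := hℓle j _ hmid
    have h2 : ∫ ω, (u j ω - u k ω) ^ 2 / 32 ∂μ ≤ ∫ ω, (-(-Real.log
        ((2⁻¹ * g j ω + 2⁻¹ * g k ω).toReal + c j)) + ((-Real.log (u j ω)) / 2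
          + (-Real.log (u k ω)) / 2)) ∂μ := by
      refine integral_mono ((hsqint j k).div_const _)
        ((hint _ hmid _ (hc0 j)).neg.add (((hint _ (hgC j) _ (hc0 j)).div_const 2).add
          ((hint _ (hgC k) _ (hc0 k)).div_const 2))) fun ω => ?_
      have h3 := sq_sub_div_le_log_midpoint (hupos j ω) (hupos k ω) (hu2 j ω) (hu2 k ω)
      have h4 : (2⁻¹ * g j ω + 2⁻¹ * g k ω).toReal = ((g j ω).toReal + (g k ω).toReal) / 2 := by
        have := hC.ne_top (hgC j) ω
        have := hC.ne_top (hgC k) ω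
        rw [ENNReal.toReal_add (by finiteness) (by finiteness)]
        simp; ring
      have h5 : Real.log ((u j ω + u k ω) / 2) ≤
          Real.log ((2⁻¹ * g j ω + 2⁻¹ * g k ω).toReal + c j) := by
        refine Real.log_le_log (by linarith [hupos j ω, hupos k ω]) ?_
        rw [h4]; simp only [hu]; linarith [hcanti hjk]
      linarith
    rw [integral_div, integral_add, integral_neg, integral_add, integral_div, integral_div] at h2
    · have h3 := (hgΦ j).le
      have h4 := (hgΦ k).le
      have h5 := hℓL k
      have h6 := hcanti hjk
      have h7 := hℓL j
      simp only [hΦ] at h1 h3 h4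
      simp only [hu] at h2 ⊢
      linarith
    · exact (hint _ (hgC j) _ (hc0 j)).div_const 2
    · exact (hint _ (hgC k) _ (hc0 k)).div_const 2
    · exact (hint _ hmid _ (hc0 j)).neg
    · exact ((hint _ (hgC j) _ (hc0 j)).div_const 2).add ((hint _ (hgC k) _ (hc0 k)).div_const 2)
  have hlim0 : Tendsto (fun j => 32 * (L - ℓ j + c j)) atTop (𝓝 0) := by
    have := ((tendsto_const_nhds (x := L)).sub hℓlim).add hclim
    simpa using this.const_mul 32
  obtain ⟨φ, hφ, hφlim⟩ : ∃ φ : ℕ → ℕ, StrictMono φ ∧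
      ∀ᵐ ω ∂μ, ∃ l : ℝ, Tendsto (fun i => u (φ i) ω) atTop (𝓝 l) := by
    obtain ⟨φ, hφ, hφe⟩ := extraction_forall_of_eventually' (fun i : ℕ =>
      eventually_atTop.1 (hlim0.eventually_lt_const (u := ((1 / 2 : ℝ) ^ i) ^ 2) (by positivity)))
    refine ⟨φ, hφ, Lp.ae_tendsto_of_cauchy_eLpNorm (p := 1)
      (B := fun N => ENNReal.ofReal (2 * (1 / 2 : ℝ) ^ N))
      (fun i => (hum _).aestronglyMeasurable) le_rfl ?_ ?_⟩
    · exact (Summable.mul_left 2 summable_geometric_two).tsum_ofReal_ne_top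
    · intro N n m hn hm
      have hδ : (0 : ℝ) < (1 / 2) ^ N := by positivity
      have hsq : ∫ ω, (u (φ n) ω - u (φ m) ω) ^ 2 ∂μ ≤ ((1 / 2 : ℝ) ^ N) ^ 2 := by
        wlog hnm : n ≤ m generalizing n m
        · refine le_of_eq_of_le (integral_congr_ae (ae_of_all _ fun ω => ?_))
            (this m n hm hn (by omega))
          ring
        refine (hcau _ _ (hφ.monotone hnm)).trans ((?_ : _ ≤ _).trans (hφe N).le)
        have h1 := hℓmono (hφ.monotone hn)
        have h2 := hcanti (hφ.monotone hn)
        linarith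
      rw [eLpNorm_one_eq_lintegral_enorm]
      have hle : ∫⁻ ω, ‖(u (φ n) - u (φ m)) ω‖ₑ ∂μ ≤ ENNReal.ofReal ((1 / 2 : ℝ) ^ N) := by
        -- L² control becomes L¹ control by 2|x| ≤ δ + x²/δ with δ = 2^(-N).
        calc _ ≤ ∫⁻ ω, ENNReal.ofReal (((1 / 2 : ℝ) ^ N + (u (φ n) ω - u (φ m) ω) ^ 2
              / (1 / 2 : ℝ) ^ N) / 2) ∂μ := by
              refine lintegral_mono fun ω => ?_
              rw [← ofReal_norm]
              refine ENNReal.ofReal_le_ofReal ?_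
              rw [Real.norm_eq_abs, Pi.sub_apply, le_div_iff₀ two_pos, ← sub_le_iff_le_add',
                le_div_iff₀ hδ]
              nlinarith [sq_nonneg (|u (φ n) ω - u (φ m) ω| - (1 / 2 : ℝ) ^ N),
                sq_abs (u (φ n) ω - u (φ m) ω)]
          _ = ENNReal.ofReal (((1 / 2 : ℝ) ^ N
                + (∫ ω, (u (φ n) ω - u (φ m) ω) ^ 2 ∂μ) / (1 / 2 : ℝ) ^ N) / 2) := by
              rw [← ofReal_integral_eq_lintegral_ofReal, integral_div, integral_add,
                integral_div, integral_const]
              · simp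
              · exact integrable_const _
              · exact (hsqint _ _).div_const _
              · exact ((integrable_const _).add ((hsqint _ _).div_const _)).div_const _
              · exact ae_of_all _ fun ω => by positivity
          _ ≤ _ := by
              refine ENNReal.ofReal_le_ofReal ?_
              have : (∫ ω, (u (φ n) ω - u (φ m) ω) ^ 2 ∂μ) / (1 / 2 : ℝ) ^ N ≤ (1 / 2 : ℝ) ^ N := by
                rw [div_le_iff₀ hδ]; linarith [sq ((1 / 2 : ℝ) ^ N)]
              linarith
      refine hle.trans_lt ((ENNReal.ofReal_lt_ofReal_iff (by positivity)).2 (by linarith))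
  obtain ⟨U, hUm, hUlim⟩ : ∃ U : Ω → ℝ≥0∞, Measurable U ∧
      ∀ᵐ ω ∂μ, Tendsto (fun i => g (φ i) ω) atTop (𝓝 (U ω)) := by
    refine measurable_limit_of_tendsto_metrizable_ae
      (fun i => (hC.measurable _ (hgC (φ i))).aemeasurable) ?_
    filter_upwards [hφlim] with ω ⟨l, hl⟩
    refine ⟨ENNReal.ofReal l, ?_⟩
    have h1 : Tendsto (fun i => (g (φ i) ω).toReal) atTop (𝓝 l) := by
      simpa [hu] using hl.sub (hclim.comp hφ.tendsto_atTop)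
    refine (ENNReal.tendsto_ofReal h1).congr fun i => ENNReal.ofReal_toReal (hC.ne_top (hgC _) ω)
  have hU1 : ∀ᵐ ω ∂μ, U ω ≤ 1 := by
    filter_upwards [hUlim] with ω hω
    exact le_of_tendsto' hω fun i => hC.le_one _ (hgC _) ω
  have hlog2 : 0 < Real.log 2 := Real.log_pos one_lt_two
  have hhalf : (2⁻¹ : ℝ≥0∞) = ENNReal.ofReal 2⁻¹ := by
    rw [ENNReal.ofReal_inv_of_pos (by norm_num)]; simp
  have hhalf' : negLog 2⁻¹ = ENNReal.ofReal (Real.log 2) := by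
    rw [hhalf, negLog_ofReal (by norm_num), Real.log_inv, neg_neg]
  -- Halving brings g + c, which is at most 2, into [0,1], where `negLog` is additive and
  -- nonnegative, as Fatou's lemma needs. The factor 1/2 contributes the log 2 on both sides.
  have hfatou : ∫⁻ ω, negLog (U ω) ∂μ + ENNReal.ofReal (Real.log 2) ≤
      ENNReal.ofReal (Real.log 2 + A') := by
    have h1 : ∫⁻ ω, negLog (U ω) ∂μ + ENNReal.ofReal (Real.log 2) =
        ∫⁻ ω, negLog (U ω * 2⁻¹) ∂μ := by
      have : ∫⁻ ω, negLog (U ω * 2⁻¹) ∂μ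
          = ∫⁻ ω, (negLog (U ω) + ENNReal.ofReal (Real.log 2)) ∂μ := by
        refine lintegral_congr_ae ?_
        filter_upwards [hU1] with ω hω
        rw [negLog_mul hω (by simp), hhalf']
      rw [this, lintegral_add_right _ measurable_const]; simp
    rw [h1]
    have h2 : ∀ i, ∫⁻ ω, negLog ((g (φ i) ω + ENNReal.ofReal (c (φ i))) * 2⁻¹) ∂μ ≤
        ENNReal.ofReal (Real.log 2 + A' + c (φ i)) := fun i => by
      have h3 : ∀ ω, negLog ((g (φ i) ω + ENNReal.ofReal (c (φ i))) * 2⁻¹) =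
          ENNReal.ofReal (Real.log 2 + -Real.log (u (φ i) ω)) := fun ω => by
        have h4 : g (φ i) ω + ENNReal.ofReal (c (φ i)) = ENNReal.ofReal (u (φ i) ω) := by
          rw [ENNReal.ofReal_add ENNReal.toReal_nonneg (hc0 _).le,
            ENNReal.ofReal_toReal (hC.ne_top (hgC _) ω)]
        rw [h4, hhalf, ← ENNReal.ofReal_mul (hupos _ _).le,
          negLog_ofReal (mul_pos (hupos _ _) (by norm_num)),
          Real.log_mul (hupos _ _).ne' (by norm_num), Real.log_inv]
        congr 1; ring
      simp_rw [h3]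
      rw [← ofReal_integral_eq_lintegral_ofReal, integral_add (integrable_const _)
        (hint _ (hgC (φ i)) _ (hc0 _))]
      · refine ENNReal.ofReal_le_ofReal ?_
        have := (hgΦ (φ i)).le
        have := hℓA (φ i)
        simp only [hΦ] at *
        simp only [integral_const, probReal_univ, one_smul]
        linarith
      · exact (integrable_const _).add (hint _ (hgC (φ i)) _ (hc0 _))
      · refine ae_of_all _ fun ω => ?_
        have := Real.log_le_log (hupos (φ i) ω) (hu2 _ _)
        simp only [Pi.zero_apply]; linarith
    have hcφ : Tendsto (fun i => c (φ i)) atTop (𝓝 0) := hclim.comp hφ.tendsto_atTop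
    calc ∫⁻ ω, negLog (U ω * 2⁻¹) ∂μ = ∫⁻ ω, liminf (fun i =>
          negLog ((g (φ i) ω + ENNReal.ofReal (c (φ i))) * 2⁻¹)) atTop ∂μ := by
          refine lintegral_congr_ae ?_
          filter_upwards [hUlim] with ω hω
          refine (Tendsto.liminf_eq ((continuous_negLog.tendsto _).comp ?_)).symm
          have h3 := hω.add (ENNReal.tendsto_ofReal hcφ)
          simp only [ENNReal.ofReal_zero, add_zero] at h3
          exact ENNReal.Tendsto.mul_const h3 (Or.inr (by simp))
      _ ≤ liminf (fun i => ∫⁻ ω, negLog ((g (φ i) ω + ENNReal.ofReal (c (φ i))) * 2⁻¹) ∂μ) atTop :=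
          lintegral_liminf_le fun i => measurable_negLog.comp
            (((hC.measurable _ (hgC _)).add_const _).mul_const _)
      _ ≤ liminf (fun i => ENNReal.ofReal (Real.log 2 + A' + c (φ i))) atTop :=
          liminf_le_liminf (Eventually.of_forall h2)
      _ = ENNReal.ofReal (Real.log 2 + A') := by
          refine Tendsto.liminf_eq (ENNReal.tendsto_ofReal ?_)
          simpa using hcφ.const_add (Real.log 2 + A')
  have hA'0 : 0 ≤ A' := by
    have := le_trans le_add_self hfatou
    rw [ENNReal.ofReal_le_ofReal_iff'] at this
    rcases this with h | h <;> linarith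
  have hU : ∫⁻ ω, negLog (U ω) ∂μ ≤ ENNReal.ofReal A' := by
    rw [add_comm (Real.log 2), ENNReal.ofReal_add hA'0 hlog2.le] at hfatou
    exact (ENNReal.add_le_add_iff_right ENNReal.ofReal_ne_top).1 hfatou
  obtain ⟨g₁, hg₁, hg₁fin⟩ := hC.exists_lintegral_negLog_lt_top (fun i => hgC (φ i)) hUm hU1 hUlim
    (hU.trans_lt ENNReal.ofReal_lt_top)
  -- mix the near-optimal elements with a small multiple of `g₁`
  set t : ℝ := Real.exp (-((A - A') / 2)) with ht
  have ht0 : 0 < t := Real.exp_pos _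
  have ht1 : t < 1 := Real.exp_lt_one_iff.2 (by linarith)
  have htt : ENNReal.ofReal t + ENNReal.ofReal (1 - t) = 1 := by
    rw [← ENNReal.ofReal_add ht0.le (by linarith)]; simp
  have ht1' : ENNReal.ofReal t ≤ 1 := by simpa using ht1.le
  have ht2' : ENNReal.ofReal (1 - t) ≤ 1 := by simpa using ht0.le
  have hmixC := fun i => hC.mix_two (hgC (φ i)) hg₁ htt
  -- The limit U need not belong to C, so the hypothesis cannot be applied to it. The mixtures with
  -- g₁ do belong to C, and the share of g₁ bounds their negative logarithm uniformly by an
  -- integrable function. In the limit, dropping that share costs only -log t = (A - A')/2, which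
  -- contradicts the lower bound A.
  have hDCT : Tendsto (fun i => ∫⁻ ω, negLog (ENNReal.ofReal t * g (φ i) ω
      + ENNReal.ofReal (1 - t) * g₁ ω) ∂μ) atTop
      (𝓝 (∫⁻ ω, negLog (ENNReal.ofReal t * U ω + ENNReal.ofReal (1 - t) * g₁ ω) ∂μ)) := by
    refine tendsto_lintegral_of_dominated_convergence
      (fun ω => negLog (ENNReal.ofReal (1 - t)) + negLog (g₁ ω))
      (fun i => measurable_negLog.comp (hC.measurable _ (hmixC i))) ?_ ?_ ?_
    · refine fun i => ae_of_all _ fun ω => ?_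
      beta_reduce
      rw [← negLog_mul ht2' (hC.le_one _ hg₁ ω)]
      exact antitone_negLog le_add_self
    · rw [lintegral_add_left measurable_const]
      refine ENNReal.add_ne_top.2 ⟨?_, hg₁fin.ne⟩
      have : negLog (ENNReal.ofReal (1 - t)) ≠ ⊤ := by
        simp only [ne_eq, negLog_eq_top_iff, ENNReal.ofReal_eq_zero, not_le]; linarith
      simpa using this
    · filter_upwards [hUlim] with ω hω
      exact (continuous_negLog.tendsto _).comp
        ((ENNReal.Tendsto.const_mul hω (Or.inr (by simp))).add_const _)
  have h1 : ENNReal.ofReal A ≤ ∫⁻ ω, negLog (ENNReal.ofReal t * U ω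
      + ENNReal.ofReal (1 - t) * g₁ ω) ∂μ := ge_of_tendsto' hDCT fun i => h _ (hmixC i)
  have h2 : ∫⁻ ω, negLog (ENNReal.ofReal t * U ω + ENNReal.ofReal (1 - t) * g₁ ω) ∂μ ≤
      ENNReal.ofReal ((A - A') / 2) + ENNReal.ofReal A' := by
    calc _ ≤ ∫⁻ ω, (ENNReal.ofReal ((A - A') / 2) + negLog (U ω)) ∂μ := by
          refine lintegral_mono_ae ?_
          filter_upwards [hU1] with ω hω
          have h3 : ENNReal.ofReal ((A - A') / 2) = negLog (ENNReal.ofReal t) := by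
            rw [negLog_ofReal ht0, ht, Real.log_exp, neg_neg]
          rw [h3, ← negLog_mul ht1' hω]
          exact antitone_negLog le_self_add
      _ ≤ _ := by
          rw [lintegral_add_left measurable_const]
          simpa using hU
  rw [← ENNReal.ofReal_add (by linarith) hA'0] at h2
  have h3 := (ENNReal.ofReal_le_ofReal_iff (by linarith)).1 (h1.trans h2)
  linarith

end

/-! ### From first-order optimality to a multiplier that is valid at almost every output letter. -/

section

variable {X Y V : Type*} [MeasurableSpace X] [MeasurableSpace Y] [MeasurableSpace V]

/-! ### Test channels and their responses -/

/-- A countable mixture of kernels. -/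
def mixKernel (w : ℕ → ℝ≥0∞) (Q : ℕ → Kernel V Y) : Kernel V Y where
  toFun v := Measure.sum fun i => w i • Q i v
  measurable' := by
    refine Measure.measurable_of_measurable_coe _ fun s hs => ?_
    simp only [Measure.sum_apply _ hs, Measure.smul_apply, smul_eq_mul]
    exact Measurable.tsum fun i => ((Q i).measurable_coe hs).const_mul _

lemma isMarkovKernel_mixKernel {w : ℕ → ℝ≥0∞} (hw : ∑' i, w i = 1) (Q : ℕ → Kernel V Y)
    [∀ i, IsMarkovKernel (Q i)] : IsMarkovKernel (mixKernel w Q) :=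
  ⟨fun v => ⟨by simp [mixKernel, Measure.sum_apply _ MeasurableSet.univ, hw]⟩⟩

/-- The response `∫ K(x, y) Q(dy | v)` of the channel `Q` to the source letter `x`. -/
def response (K : X → Y → ℝ≥0∞) (Q : Kernel V Y) (z : V × X) : ℝ≥0∞ :=
  ∫⁻ y, K z.2 y ∂Q z.1

lemma measurable_response {K : X → Y → ℝ≥0∞} (hK : Measurable (Function.uncurry K))
    (Q : Kernel V Y) [IsSFiniteKernel Q] : Measurable (response K Q) := by
  have h : Measurable fun p : (V × X) × Y => K p.1.2 p.2 :=
    hK.comp ((measurable_snd.comp measurable_fst).prodMk measurable_snd)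
  exact Measurable.lintegral_kernel_prod_right' (κ := Q.comap Prod.fst measurable_fst) h

lemma response_mixKernel (K : X → Y → ℝ≥0∞) (w : ℕ → ℝ≥0∞) (Q : ℕ → Kernel V Y) (z : V × X) :
    response K (mixKernel w Q) z = ∑' i, w i * response K (Q i) z := by
  simp [response, mixKernel, lintegral_sum_measure]

/-- The responses of all channels. -/
def responses (V : Type*) [MeasurableSpace V] (K : X → Y → ℝ≥0∞) : Set (V × X → ℝ≥0∞) :=
  {g | ∃ Q : Kernel V Y, IsMarkovKernel Q ∧ response K Q = g}

lemma isMixtureClosed_responses {K : X → Y → ℝ≥0∞} (hK : Measurable (Function.uncurry K))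
    (hK1 : ∀ x y, K x y ≤ 1) : IsMixtureClosed (responses V K) where
  measurable := by
    rintro _ ⟨Q, hQ, rfl⟩
    exact measurable_response hK Q
  le_one := by
    rintro _ ⟨Q, hQ, rfl⟩ z
    calc response K Q z ≤ ∫⁻ _, 1 ∂Q z.1 := lintegral_mono fun y => hK1 _ _
      _ = 1 := by simp
  mix := by
    intro w g hw hg
    choose Q hQ hQg using hg
    refine ⟨mixKernel w Q, isMarkovKernel_mixKernel hw Q, ?_⟩
    ext z
    simp [response_mixKernel, hQg]

/-! ### An essential supremum over channels -/

/-- A jointly measurable function whose mean is bounded along every channel is dominated by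
a function of the first variable with the same bound on the mean. -/
theorem exists_channel_bound (pV : Measure V) [IsProbabilityMeasure pV] {F : V × Y → ℝ≥0∞}
    (hF : Measurable F) {b : ℝ≥0∞} (hb : b ≠ ⊤) [Nonempty Y]
    (h : ∀ Q : Kernel V Y, IsMarkovKernel Q → ∫⁻ v, ∫⁻ y, F (v, y) ∂Q v ∂pV ≤ b) :
    ∃ β : V → ℝ≥0∞, Measurable β ∧ ∫⁻ v, β v ∂pV ≤ b ∧
      ∀ Q : Kernel V Y, IsMarkovKernel Q → ∀ᵐ p ∂(pV ⊗ₘ Q), F p ≤ β p.1 := by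
  classical
  have hm : ∀ Q : Kernel V Y, IsMarkovKernel Q → Measurable fun v => ∫⁻ y, F (v, y) ∂Q v :=
    fun Q _ => hF.lintegral_kernel_prod_right'
  -- the better of two channels
  have hmax : ∀ Q Q' : Kernel V Y, IsMarkovKernel Q → IsMarkovKernel Q' → ∃ Q'' : Kernel V Y,
      IsMarkovKernel Q'' ∧ ∀ v, ∫⁻ y, F (v, y) ∂Q'' v
        = max (∫⁻ y, F (v, y) ∂Q v) (∫⁻ y, F (v, y) ∂Q' v) := by
    intro Q Q' hQ hQ'
    have hs : MeasurableSet {v | ∫⁻ y, F (v, y) ∂Q v ≤ ∫⁻ y, F (v, y) ∂Q' v} :=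
      measurableSet_le (hm Q hQ) (hm Q' hQ')
    refine ⟨Kernel.piecewise hs Q' Q, inferInstance, fun v => ?_⟩
    rw [Kernel.piecewise_apply]
    split_ifs with hv
    · exact (max_eq_right hv).symm
    · exact (max_eq_left (not_le.1 hv).le).symm
  -- Taking the pointwise better of finitely many channels makes a maximizing sequence monotone; β
  -- is its limit, and its mean is the supremum of the means.
  let S : Set ℝ≥0∞ := {r | ∃ Q : Kernel V Y, IsMarkovKernel Q ∧
    ∫⁻ v, ∫⁻ y, F (v, y) ∂Q v ∂pV = r}
  have hSne : S.Nonempty := by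
    obtain ⟨y⟩ := ‹Nonempty Y›
    exact ⟨_, Kernel.const V (Measure.dirac y), inferInstance, rfl⟩
  obtain ⟨r, -, hrlim, hrS⟩ := exists_seq_tendsto_sSup hSne (OrderTop.bddAbove S)
  choose Q hQ hQr using hrS
  let Q' : ℕ → {Q : Kernel V Y // IsMarkovKernel Q} := fun n => Nat.rec ⟨Q 0, hQ 0⟩
    (fun k P => ⟨(hmax P.1 (Q (k + 1)) P.2 (hQ _)).choose,
      (hmax P.1 (Q (k + 1)) P.2 (hQ _)).choose_spec.1⟩) n
  have hQ'succ : ∀ k v, ∫⁻ y, F (v, y) ∂(Q' (k + 1)).1 v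
      = max (∫⁻ y, F (v, y) ∂(Q' k).1 v) (∫⁻ y, F (v, y) ∂Q (k + 1) v) := fun k =>
    (hmax (Q' k).1 (Q (k + 1)) (Q' k).2 (hQ _)).choose_spec.2
  set G : ℕ → V → ℝ≥0∞ := fun k v => ∫⁻ y, F (v, y) ∂(Q' k).1 v with hG
  have hGm : ∀ k, Measurable (G k) := fun k => hm _ (Q' k).2
  have hGmono : Monotone G := monotone_nat_of_le_succ fun k v => by
    simp only [hG, hQ'succ]; exact le_max_left _ _
  have hGr : ∀ k, r k ≤ ∫⁻ v, G k v ∂pV := by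
    intro k
    rw [← hQr k]
    refine lintegral_mono fun v => ?_
    cases k with
    | zero => exact le_rfl
    | succ k => simp only [hG, hQ'succ]; exact le_max_right _ _
  set β : V → ℝ≥0∞ := fun v => ⨆ k, G k v with hβ
  have hβm : Measurable β := Measurable.iSup hGm
  have hβint : ∫⁻ v, β v ∂pV = ⨆ k, ∫⁻ v, G k v ∂pV := lintegral_iSup hGm hGmono
  have hβb : ∫⁻ v, β v ∂pV ≤ b := by
    rw [hβint]; exact iSup_le fun k => h _ (Q' k).2
  have hSβ : sSup S ≤ ∫⁻ v, β v ∂pV := by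
    refine le_of_tendsto' hrlim fun k => (hGr k).trans ?_
    rw [hβint]; exact le_iSup (fun k => ∫⁻ v, G k v ∂pV) k
  -- the mean along any channel is dominated
  have hdom : ∀ P : Kernel V Y, IsMarkovKernel P → ∀ᵐ v ∂pV, ∫⁻ y, F (v, y) ∂P v ≤ β v := by
    intro P hP
    -- If P beat β on a set of positive measure, switching to P there would exceed the supremum over
    -- channels.
    have h1 : ∫⁻ v, max (β v) (∫⁻ y, F (v, y) ∂P v) ∂pV ≤ ∫⁻ v, β v ∂pV := by
      have h2 : ∀ v, max (β v) (∫⁻ y, F (v, y) ∂P v)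
          = ⨆ k, max (G k v) (∫⁻ y, F (v, y) ∂P v) := fun v => iSup_sup
      simp_rw [h2]
      rw [lintegral_iSup (fun k => (hGm k).max (hm P hP))
        (fun i j hij v => max_le_max_right _ (hGmono hij v))]
      refine (iSup_le fun k => ?_).trans hSβ
      obtain ⟨R, hR, hRe⟩ := hmax (Q' k).1 P (Q' k).2 hP
      exact le_sSup ⟨R, hR, lintegral_congr hRe⟩
    have h3 := ae_eq_of_ae_le_of_lintegral_le (ae_of_all pV fun v => le_max_left (β v) _)
      (ne_top_of_le_ne_top hb hβb) (hβm.max (hm P hP)).aemeasurable h1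
    filter_upwards [h3] with v hv
    rw [hv]; exact le_max_right _ _
  refine ⟨β, hβm, hβb, fun P hP => ?_⟩
  set B : Set (V × Y) := {p | β p.1 < F p} with hB
  have hBm : MeasurableSet B := measurableSet_lt (hβm.comp measurable_fst) hF
  have hPB : Measurable fun v => P v (Prod.mk v ⁻¹' B) := Kernel.measurable_kernel_prodMk_left hBm
  -- condition the channel on the bad set
  let R : Kernel V Y :=
    { toFun v := if P v (Prod.mk v ⁻¹' B) = 0 then P v else
        (P v (Prod.mk v ⁻¹' B))⁻¹ • (P v).restrict (Prod.mk v ⁻¹' B)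
      measurable' := by
        refine Measurable.ite (hPB (measurableSet_singleton 0)) P.measurable ?_
        refine Measure.measurable_of_measurable_coe _ fun s hs => ?_
        simp only [Measure.smul_apply, smul_eq_mul, Measure.restrict_apply hs]
        refine hPB.inv.mul ?_
        have : ∀ v, s ∩ Prod.mk v ⁻¹' B = Prod.mk v ⁻¹' (Prod.snd ⁻¹' s ∩ B) := fun v => by
          ext y; simp
        simp_rw [this]
        exact Kernel.measurable_kernel_prodMk_left ((measurable_snd hs).inter hBm) }
  have hR : IsMarkovKernel R := ⟨fun v => by
    by_cases h0 : P v (Prod.mk v ⁻¹' B) = 0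
    · simp only [R, Kernel.coe_mk, h0, if_true]; infer_instance
    · refine ⟨?_⟩
      simp only [R, Kernel.coe_mk, h0, if_false, Measure.smul_apply, Measure.restrict_apply_univ,
        smul_eq_mul]
      exact ENNReal.inv_mul_cancel h0 (measure_ne_top _ _)⟩
  -- Under the conditioned channel R, the letter always falls in the set where F exceeds β, so its
  -- mean would exceed β strictly wherever P charges that set.
  have hnull : ∀ᵐ v ∂pV, P v (Prod.mk v ⁻¹' B) = 0 := by
    filter_upwards [hdom R hR] with v hv
    by_contra h0
    have hβtop : β v ≠ ⊤ := by
      intro htop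
      refine h0 ?_
      have : Prod.mk v ⁻¹' B = ∅ := by ext y; simp [hB, htop]
      simp [this]
    simp only [R, Kernel.coe_mk, h0, if_false, lintegral_smul_measure, smul_eq_mul] at hv
    rw [mul_comm, ← div_eq_mul_inv, ENNReal.div_le_iff h0 (measure_ne_top _ _)] at hv
    have hBv : MeasurableSet (Prod.mk v ⁻¹' B) := measurable_prodMk_left hBm
    have h1 := ae_eq_of_ae_le_of_lintegral_le (μ := (P v).restrict (Prod.mk v ⁻¹' B))
      (f := fun _ => β v) (g := fun y => F (v, y))
      ((ae_restrict_iff' hBv).2 (ae_of_all _ fun y hy => (show β v < F (v, y) from hy).le))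
      (by simpa using ENNReal.mul_ne_top hβtop (measure_ne_top _ _))
      (hF.comp measurable_prodMk_left).aemeasurable (by simpa using hv)
    have h2 : ∀ᵐ y ∂(P v).restrict (Prod.mk v ⁻¹' B), False := by
      filter_upwards [h1, ae_restrict_mem hBv] with y hy hyB
      exact (show β v < F (v, y) from hyB).ne hy
    exact h0 (by simpa [ae_iff] using h2)
  rw [Measure.ae_compProd_iff (by exact measurableSet_le hF (hβm.comp measurable_fst))]
  filter_upwards [hnull] with v hv
  rw [ae_iff]
  simpa [hB] using hv

/-- **Dual certificate.** If the logarithm of the response of every channel, shifted by `c > 0`,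
has mean at most `-A`, there is a bounded multiplier `α` whose logarithm has mean close to `A`
and for which the mean of `α(V, ·) K(·, Y)` given `(V, Y)` is at most one, for any law of
`(V, Y)` compatible with that of `V`. -/
theorem exists_multiplier [StandardBorelSpace Y] [Nonempty Y] (pV : Measure V)
    [IsProbabilityMeasure pV] (pXV : Kernel V X) [IsMarkovKernel pXV] {K : X → Y → ℝ≥0∞}
    (hK : Measurable (Function.uncurry K)) (hK1 : ∀ x y, K x y ≤ 1) {A c ε : ℝ} (hc : 0 < c)
    (hc1 : c ≤ 1) (hε : 0 < ε)
    (h : ∀ g ∈ responses V K, A ≤ ∫ z, -Real.log ((g z).toReal + c) ∂(pV ⊗ₘ pXV)) :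
    ∃ α : V × X → ℝ, Measurable α ∧ (∃ a b : ℝ, 0 < a ∧ ∀ z, a ≤ α z ∧ α z ≤ b) ∧
      A - ε ≤ ∫ z, Real.log (α z) ∂(pV ⊗ₘ pXV) ∧
      ∀ ν : Measure (V × Y), ν.fst = pV →
        ∀ᵐ p ∂ν, ∫⁻ x, ENNReal.ofReal (α (p.1, x)) * K x p.2 ∂pXV p.1 ≤ 1 := by
  have hC := isMixtureClosed_responses (V := V) hK hK1
  have hne : (responses V K).Nonempty := by
    obtain ⟨y⟩ := ‹Nonempty Y›
    exact ⟨_, Kernel.const V (Measure.dirac y), inferInstance, rfl⟩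
  obtain ⟨g₀, hg₀, hopt⟩ := hC.exists_forall_integral_div_le (μ := pV ⊗ₘ pXV) hne hc hc1 hε
  set u : V × X → ℝ := fun z => (g₀ z).toReal + c with hu
  have hum : Measurable u := (hC.measurable _ hg₀).ennreal_toReal.add_const c
  have huc : ∀ z, c ≤ u z := fun z => by
    have : (0 : ℝ) ≤ (g₀ z).toReal := ENNReal.toReal_nonneg
    simp only [hu]; linarith
  have hu2 : ∀ z, u z ≤ 2 := fun z => by
    have := hC.toReal_le hg₀ z
    simp only [hu]; linarith
  have hu0 : ∀ z, 0 < u z := fun z => hc.trans_le (huc z)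
  -- By Fubini, the mean of F along a channel Q is E[(g_Q + c)/(g₀ + c)], which first-order
  -- optimality bounds by 1 + ε.
  set F : V × Y → ℝ≥0∞ := fun p =>
    ∫⁻ x, (K x p.2 + ENNReal.ofReal c) * ENNReal.ofReal (1 / u (p.1, x)) ∂pXV p.1 with hFdef
  have hint : Measurable fun q : (V × Y) × X =>
      (K q.2 q.1.2 + ENNReal.ofReal c) * ENNReal.ofReal (1 / u (q.1.1, q.2)) := by
    refine ((hK.comp (measurable_snd.prodMk
      (measurable_snd.comp measurable_fst))).add_const _).mul ?_
    exact ((hum.comp ((measurable_fst.comp measurable_fst).prodMk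
      measurable_snd)).const_div 1).ennreal_ofReal
  have hF : Measurable F :=
    Measurable.lintegral_kernel_prod_right' (κ := pXV.comap Prod.fst measurable_fst) hint
  have hFlow : ∀ p, ENNReal.ofReal (c / 2) ≤ F p := fun p => by
    calc ENNReal.ofReal (c / 2) = ∫⁻ _, ENNReal.ofReal (c / 2) ∂pXV p.1 := by simp
      _ ≤ F p := lintegral_mono fun x => by
        rw [div_eq_mul_one_div c 2, ENNReal.ofReal_mul hc.le]
        gcongr
        · exact le_add_self
        · exact hu2 _
  have hFup : ∀ p, F p ≤ ENNReal.ofReal (2 / c) := fun p => by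
    calc F p ≤ ∫⁻ _, ENNReal.ofReal (2 / c) ∂pXV p.1 := lintegral_mono fun x => by
          rw [div_eq_mul_one_div 2 c, ENNReal.ofReal_mul two_pos.le]
          gcongr
          · calc K x p.2 + ENNReal.ofReal c ≤ 1 + 1 :=
                add_le_add (hK1 _ _) (by simpa using hc1)
              _ = ENNReal.ofReal 2 := by norm_num
          · exact huc _
      _ = _ := by simp
  have hFint : ∀ Q : Kernel V Y, IsMarkovKernel Q →
      ∫⁻ v, ∫⁻ y, F (v, y) ∂Q v ∂pV ≤ ENNReal.ofReal (1 + ε) := by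
    intro Q hQ
    have hg : response K Q ∈ responses V K := ⟨Q, hQ, rfl⟩
    have h1 : ∀ v, ∫⁻ y, F (v, y) ∂Q v = ∫⁻ x, ENNReal.ofReal
        (((response K Q (v, x)).toReal + c) / u (v, x)) ∂pXV v := fun v => by
      simp only [hFdef]
      rw [lintegral_lintegral_swap (by
        exact (hint.comp ((measurable_const.prodMk measurable_fst).prodMk
          measurable_snd)).aemeasurable)]
      refine lintegral_congr fun x => ?_
      have hKx : Measurable fun y => K x y := hK.comp measurable_prodMk_left
      rw [lintegral_mul_const _ (hKx.add_const _), lintegral_add_left hKx]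
      simp only [lintegral_const, measure_univ, mul_one]
      rw [div_eq_mul_one_div (_ + c) (u (v, x)), ENNReal.ofReal_mul (by positivity),
        ENNReal.ofReal_add ENNReal.toReal_nonneg hc.le, ENNReal.ofReal_toReal (hC.ne_top hg _)]
      rfl
    have hmq : Measurable fun z : V × X => ((response K Q z).toReal + c) / u z :=
      ((hC.measurable _ hg).ennreal_toReal.add_const c).div hum
    have hbd : ∀ z : V × X, 0 ≤ ((response K Q z).toReal + c) / u z ∧
        ((response K Q z).toReal + c) / u z ≤ 2 / c := fun z => by
      have h0 : (0 : ℝ) ≤ (response K Q z).toReal := ENNReal.toReal_nonneg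
      refine ⟨div_nonneg (by linarith) (hu0 z).le, div_le_div₀ (by norm_num) ?_ hc (huc z)⟩
      linarith [hC.toReal_le hg z]
    simp_rw [h1]
    rw [← Measure.lintegral_compProd (f := fun z => ENNReal.ofReal
      (((response K Q z).toReal + c) / u z)) hmq.ennreal_ofReal,
      ← ofReal_integral_eq_lintegral_ofReal
        (Integrable.of_bound (C := 2 / c) hmq.aestronglyMeasurable
          (ae_of_all _ fun z => by rw [Real.norm_eq_abs, abs_of_nonneg (hbd z).1]; exact (hbd z).2))
        (ae_of_all _ fun z => (hbd z).1)]
    exact ENNReal.ofReal_le_ofReal (hopt _ hg)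
  obtain ⟨β, hβm, hβb, hβ⟩ := exists_channel_bound pV hF ENNReal.ofReal_ne_top hFint
  -- F lies between c/2 and 2/c, so clipping β to this interval keeps it above F and, almost surely,
  -- not above β. It makes α bounded away from 0 and ∞.
  set γ : V → ℝ := fun v => (max (ENNReal.ofReal (c / 2)) (min (β v) (ENNReal.ofReal (2 / c)))).toReal
    with hγ
  have hγm : Measurable γ := (measurable_const.max (hβm.min measurable_const)).ennreal_toReal
  have hcc : c / 2 ≤ 2 / c := by
    rw [div_le_div_iff₀ two_pos hc]; nlinarith
  have hγtop : ∀ v, max (ENNReal.ofReal (c / 2)) (min (β v) (ENNReal.ofReal (2 / c))) ≠ ⊤ :=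
    fun v => (max_lt ENNReal.ofReal_lt_top
      ((min_le_right _ _).trans_lt ENNReal.ofReal_lt_top)).ne
  have hγlow : ∀ v, c / 2 ≤ γ v := fun v => by
    exact (ENNReal.ofReal_le_iff_le_toReal (hγtop v)).1 (le_max_left _ _)
  have hγup : ∀ v, γ v ≤ 2 / c := fun v => by
    refine ENNReal.toReal_le_of_le_ofReal (by positivity) ?_
    exact max_le (ENNReal.ofReal_le_ofReal hcc) (min_le_right _ _)
  have hγ0 : ∀ v, 0 < γ v := fun v => (half_pos hc).trans_le (hγlow v)
  have hγβ : ∀ᵐ v ∂pV, ENNReal.ofReal (γ v) ≤ β v := by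
    obtain ⟨_, Q, hQ, -⟩ := hne
    have h1 := hβ Q hQ
    rw [Measure.ae_compProd_iff (by exact measurableSet_le hF (hβm.comp measurable_fst))] at h1
    filter_upwards [h1] with v hv
    obtain ⟨y, hy⟩ := hv.exists
    rw [hγ, ENNReal.ofReal_toReal (hγtop v)]
    exact max_le ((hFlow _).trans hy) (min_le_left _ _)
  have hγint : Integrable γ pV := Integrable.of_bound (C := 2 / c) hγm.aestronglyMeasurable
    (ae_of_all _ fun v => by rw [Real.norm_eq_abs, abs_of_pos (hγ0 v)]; exact hγup v)
  have hγmean : ∫ v, γ v ∂pV ≤ 1 + ε := by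
    rw [← ENNReal.ofReal_le_ofReal_iff (by linarith),
      ofReal_integral_eq_lintegral_ofReal hγint (ae_of_all _ fun v => (hγ0 v).le)]
    exact (lintegral_mono_ae hγβ).trans hβb
  refine ⟨fun z => 1 / (γ z.1 * u z), (((hγm.comp measurable_fst).mul hum).const_div 1),
    ⟨c / 4, 1 / (c / 2 * c), by positivity, fun z => ⟨?_, ?_⟩⟩, ?_, ?_⟩
  · rw [div_le_div_iff₀ (by norm_num) (mul_pos (hγ0 _) (hu0 _))]
    have : γ z.1 * u z ≤ 2 / c * 2 :=
      mul_le_mul (hγup _) (hu2 _) (hu0 _).le (by positivity)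
    calc c * (γ z.1 * u z) ≤ c * (2 / c * 2) := by gcongr
      _ = 1 * 4 := by field_simp; norm_num
  · exact one_div_le_one_div_of_le (by positivity)
      (mul_le_mul (hγlow _) (huc _) hc.le (hγ0 _).le)
  · have h1 := h _ hg₀
    have hui : Integrable (fun z => -Real.log (u z)) (pV ⊗ₘ pXV) := hC.integrable_log _ hg₀ hc
    have hγi : Integrable (fun z : V × X => γ z.1 - 1) (pV ⊗ₘ pXV) := by
      refine (Integrable.of_bound (C := 2 / c) (hγm.comp measurable_fst).aestronglyMeasurable
        (ae_of_all _ fun z => ?_)).sub (integrable_const 1)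
      rw [Real.norm_eq_abs, Function.comp_apply, abs_of_pos (hγ0 _)]; exact hγup _
    have hli : Integrable (fun z : V × X => Real.log (1 / (γ z.1 * u z))) (pV ⊗ₘ pXV) := by
      refine Integrable.of_bound (C := max |Real.log (c / 4)| |Real.log (1 / (c / 2 * c))|)
        (Real.measurable_log.comp
          (((hγm.comp measurable_fst).mul hum).const_div 1)).aestronglyMeasurable
        (ae_of_all _ fun z => ?_)
      have hpos : 0 < γ z.1 * u z := mul_pos (hγ0 _) (hu0 _)
      refine abs_le_max_abs_abs (Real.log_le_log (by positivity) ?_)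
        (Real.log_le_log (by positivity) ?_)
      · rw [div_le_div_iff₀ (by norm_num) hpos]
        have : γ z.1 * u z ≤ 2 / c * 2 :=
          mul_le_mul (hγup _) (hu2 _) (hu0 _).le (by positivity)
        calc c * (γ z.1 * u z) ≤ c * (2 / c * 2) := by gcongr
          _ = 1 * 4 := by field_simp; norm_num
      · exact one_div_le_one_div_of_le (by positivity)
          (mul_le_mul (hγlow _) (huc _) hc.le (hγ0 _).le)
    -- Since log γ ≤ γ - 1 and γ has mean at most 1 + ε, the normalization by γ costs at most ε in E
    -- log α.
    have h2 : ∫ z, (-Real.log (u z) - (γ z.1 - 1)) ∂(pV ⊗ₘ pXV)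
        ≤ ∫ z : V × X, Real.log (1 / (γ z.1 * u z)) ∂(pV ⊗ₘ pXV) := by
      refine integral_mono (hui.sub hγi) hli fun z => ?_
      have h3 := Real.log_le_sub_one_of_pos (hγ0 z.1)
      beta_reduce
      rw [one_div, Real.log_inv, Real.log_mul (hγ0 _).ne' (hu0 _).ne']
      linarith
    have h4 : ∫ z : V × X, (γ z.1 - 1) ∂(pV ⊗ₘ pXV) = ∫ v, γ v ∂pV - 1 := by
      rw [Measure.integral_compProd hγi]
      simp only [integral_const, probReal_univ, one_smul]
      rw [integral_sub hγint (integrable_const 1)]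
      simp
    rw [integral_sub hui hγi, h4] at h2
    linarith
  · intro ν hν
    have : IsFiniteMeasure ν := ⟨by
      rw [← Measure.fst_univ, hν]; exact measure_lt_top _ _⟩
    -- Any law of (V,Y) with V-marginal `pV` arises from a channel by disintegration, so the bound
    -- valid along every channel applies.
    have h1 := hβ ν.condKernel inferInstance
    rw [← hν, ν.disintegrate ν.condKernel] at h1
    filter_upwards [h1] with p hp
    have h2 : F p ≤ ENNReal.ofReal (γ p.1) := by
      rw [hγ, ENNReal.ofReal_toReal (hγtop _)]
      exact le_max_of_le_right (le_min hp (hFup p))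
    calc ∫⁻ x, ENNReal.ofReal (1 / (γ p.1 * u (p.1, x))) * K x p.2 ∂pXV p.1
        ≤ ∫⁻ x, ENNReal.ofReal (1 / γ p.1) * ((K x p.2 + ENNReal.ofReal c) *
            ENNReal.ofReal (1 / u (p.1, x))) ∂pXV p.1 := lintegral_mono fun x => by
          rw [← one_div_mul_one_div, ENNReal.ofReal_mul (by have := hγ0 p.1; positivity),
            mul_assoc]
          refine mul_le_mul_right ?_ _
          rw [mul_comm]
          exact mul_le_mul_left le_self_add _
      _ = ENNReal.ofReal (1 / γ p.1) * F p := by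
          rw [lintegral_const_mul _ (by exact hint.comp measurable_prodMk_left)]
      _ ≤ ENNReal.ofReal (1 / γ p.1) * ENNReal.ofReal (γ p.1) := by gcongr
      _ = 1 := by
          rw [← ENNReal.ofReal_mul (by have := hγ0 p.1; positivity),
            one_div_mul_cancel (hγ0 _).ne', ENNReal.ofReal_one]

end

/-! ### Divergences of test channels and the Gibbs variational principle. -/

section

variable {X Y V : Type*} [MeasurableSpace X] [MeasurableSpace Y] [MeasurableSpace V]

/-! ### Convexity of the divergence -/

/-- On the disjoint union of two copies of Z the divergence is exactly the sum of the two terms.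
Folding the copies together is a measurable map, and data processing finishes. -/
lemma klDiv_add_le {Z : Type*} [MeasurableSpace Z] (μ₁ μ₂ ν₁ ν₂ : Measure Z) [IsFiniteMeasure μ₁]
    [IsFiniteMeasure μ₂] [IsFiniteMeasure ν₁] [IsFiniteMeasure ν₂] :
    klDiv (μ₁ + μ₂) (ν₁ + ν₂) ≤ klDiv μ₁ ν₁ + klDiv μ₂ ν₂ := by
  by_cases h₁ : μ₁ ≪ ν₁
  swap
  · simp [klDiv_of_not_ac h₁]
  by_cases h₂ : μ₂ ≪ ν₂
  swap
  · simp [klDiv_of_not_ac h₂]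
  set ν : Measure (Z ⊕ Z) := ν₁.map Sum.inl + ν₂.map Sum.inr with hν
  set f : Z ⊕ Z → ℝ≥0∞ := Sum.elim (μ₁.rnDeriv ν₁) (μ₂.rnDeriv ν₂) with hf
  have hfm : Measurable f := (Measure.measurable_rnDeriv _ _).sumElim (Measure.measurable_rnDeriv _ _)
  have hlin : ∀ F : Z ⊕ Z → ℝ≥0∞, Measurable F →
      ∫⁻ z, F z ∂ν = ∫⁻ z, F (Sum.inl z) ∂ν₁ + ∫⁻ z, F (Sum.inr z) ∂ν₂ := fun F hF => by
    rw [hν, lintegral_add_measure, lintegral_map hF measurable_inl, lintegral_map hF measurable_inr]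
  have hνf : IsFiniteMeasure ν := by rw [hν]; infer_instance
  have hμf : IsFiniteMeasure (ν.withDensity f) := by
    refine isFiniteMeasure_withDensity ?_
    rw [hlin f hfm]
    simp only [hf, Sum.elim_inl, Sum.elim_inr]
    exact ENNReal.add_ne_top.2 ⟨(Measure.lintegral_rnDeriv_lt_top _ _).ne,
      (Measure.lintegral_rnDeriv_lt_top _ _).ne⟩
  have hg : Measurable (Sum.elim id id : Z ⊕ Z → Z) := measurable_id.sumElim measurable_id
  have hmapν : ν.map (Sum.elim id id) = ν₁ + ν₂ := by
    rw [hν, Measure.map_add _ _ hg, Measure.map_map hg measurable_inl,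
      Measure.map_map hg measurable_inr]
    simp
  have hmapμ : (ν.withDensity f).map (Sum.elim id id) = μ₁ + μ₂ := by
    ext s hs
    rw [Measure.map_apply hg hs, withDensity_apply _ (hg hs), ← lintegral_indicator (hg hs),
      hlin _ (hfm.indicator (hg hs))]
    conv_rhs => rw [← Measure.withDensity_rnDeriv_eq _ _ h₁, ← Measure.withDensity_rnDeriv_eq _ _ h₂]
    rw [Measure.add_apply, withDensity_apply _ hs, withDensity_apply _ hs,
      ← lintegral_indicator hs, ← lintegral_indicator hs]
    rfl
  calc klDiv (μ₁ + μ₂) (ν₁ + ν₂) ≤ klDiv (ν.withDensity f) ν := by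
        rw [← hmapν, ← hmapμ]; exact klDiv_map_le _ _ hg
    _ = klDiv μ₁ ν₁ + klDiv μ₂ ν₂ := by
        rw [klDiv_eq_lintegral_klFun_of_ac (withDensity_absolutelyContinuous _ _),
          klDiv_eq_lintegral_klFun_of_ac h₁, klDiv_eq_lintegral_klFun_of_ac h₂]
        rw [lintegral_congr_ae (g := fun z => ENNReal.ofReal (klFun (f z).toReal))]
        · exact hlin _ (measurable_klFun.comp hfm.ennreal_toReal).ennreal_ofReal
        · filter_upwards [Measure.rnDeriv_withDensity ν hfm] with z hz
          rw [hz]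

lemma klDiv_convex {Z : Type*} [MeasurableSpace Z] (μ₁ μ₂ ν₁ ν₂ : Measure Z) [IsFiniteMeasure μ₁]
    [IsFiniteMeasure μ₂] [IsFiniteMeasure ν₁] [IsFiniteMeasure ν₂] (a b : ℝ≥0) :
    klDiv (a • μ₁ + b • μ₂) (a • ν₁ + b • ν₂) ≤ a * klDiv μ₁ ν₁ + b * klDiv μ₂ ν₂ := by
  rw [← klDiv_smul_same, ← klDiv_smul_same]
  exact klDiv_add_le _ _ _ _

/-! ### The divergence of a channel from an output kernel -/

/-- The divergence of the law `p_V p_{X|V} W` of `(V, X, Y)` from the law `p_V p_{X|V} Q` under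
which `X` and `Y` are independent given `V`. -/
def channelDiv (pV : Measure V) (pXV : Kernel V X) (W : Kernel (V × X) Y) (Q : Kernel V Y) : ℝ≥0∞ :=
  klDiv (pV ⊗ₘ (pXV ⊗ₖ W)) (pV ⊗ₘ (pXV ×ₖ Q))

/-- The expected distortion of a channel. -/
def meanCost (pV : Measure V) (pXV : Kernel V X) (d : X → Y → ℝ) (W : Kernel (V × X) Y) : ℝ≥0∞ :=
  ∫⁻ z, ENNReal.ofReal (d z.2.1 z.2.2) ∂(pV ⊗ₘ (pXV ⊗ₖ W))

section

variable (pV : Measure V) [IsProbabilityMeasure pV] (pXV : Kernel V X) [IsMarkovKernel pXV]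

lemma lintegral_channel (W : Kernel (V × X) Y) [IsMarkovKernel W] {F : V × X × Y → ℝ≥0∞}
    (hF : Measurable F) : ∫⁻ z, F z ∂(pV ⊗ₘ (pXV ⊗ₖ W))
      = ∫⁻ v, ∫⁻ x, ∫⁻ y, F (v, x, y) ∂W (v, x) ∂pXV v ∂pV := by
  rw [Measure.lintegral_compProd hF]
  refine lintegral_congr fun v => ?_
  exact Kernel.lintegral_compProd _ _ _ (hF.comp measurable_prodMk_left)

lemma lintegral_ref (Q : Kernel V Y) [IsMarkovKernel Q] {F : V × X × Y → ℝ≥0∞}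
    (hF : Measurable F) : ∫⁻ z, F z ∂(pV ⊗ₘ (pXV ×ₖ Q))
      = ∫⁻ v, ∫⁻ x, ∫⁻ y, F (v, x, y) ∂Q v ∂pXV v ∂pV := by
  rw [Measure.lintegral_compProd hF]
  refine lintegral_congr fun v => ?_
  exact Kernel.lintegral_prod _ _ _ (hF.comp measurable_prodMk_left)

/-- The law of `(V, X, Y)` under which `X` and `Y` are independent given `V`, with `X` listed
last. -/
lemma map_ref (Q : Kernel V Y) [IsMarkovKernel Q] :
    (pV ⊗ₘ (pXV ×ₖ Q)).map (fun z => ((z.1, z.2.2), z.2.1))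
      = (pV ⊗ₘ Q) ⊗ₘ (pXV.comap Prod.fst measurable_fst) := by
  have he : Measurable fun z : V × X × Y => ((z.1, z.2.2), z.2.1) := by fun_prop
  refine Measure.ext_of_lintegral _ fun F hF => ?_
  rw [lintegral_map hF he, lintegral_ref pV pXV Q (by exact hF.comp he), Measure.lintegral_compProd hF,
    Measure.lintegral_compProd (by exact hF.lintegral_kernel_prod_right')]
  refine lintegral_congr fun v => ?_
  rw [lintegral_lintegral_swap]
  · rfl
  · exact (hF.comp (he.comp measurable_prodMk_left)).aemeasurable

/-- The conditional mutual information is the smallest divergence from an output kernel. -/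
lemma klDiv_condMutualInfo_le_channelDiv [StandardBorelSpace X] (W : Kernel (V × X) Y)
    [IsMarkovKernel W] (Q : Kernel V Y) [IsMarkovKernel Q] :
    klDiv (pV ⊗ₘ (pXV ⊗ₖ W)) (pV ⊗ₘ ((pXV ⊗ₖ W).fst ×ₖ (pXV ⊗ₖ W).snd)) ≤
      channelDiv pV pXV W Q := by
  obtain ⟨v₀⟩ := nonempty_of_isProbabilityMeasure pV
  have : Nonempty X := nonempty_of_isProbabilityMeasure (pXV v₀)
  set P := pV ⊗ₘ (pXV ⊗ₖ W) with hP
  set S := (pXV ⊗ₖ W).snd with hS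
  have hSm : IsMarkovKernel S := by rw [hS]; infer_instance
  rw [Kernel.fst_compProd]
  set e : V × X × Y → (V × Y) × X := fun z => ((z.1, z.2.2), z.2.1) with he
  set e' : (V × Y) × X → V × X × Y := fun z => (z.1.1, z.2, z.1.2) with he'
  have hem : Measurable e := by fun_prop
  have hem' : Measurable e' := by fun_prop
  have hee : e' ∘ e = id := rfl
  have hfst : (P.map e).fst = pV ⊗ₘ S := by
    refine Measure.ext_of_lintegral _ fun F hF => ?_
    rw [Measure.fst, Measure.map_map measurable_fst hem, lintegral_map hF (measurable_fst.comp hem),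
      hP, Measure.lintegral_compProd (by exact hF.comp (measurable_fst.comp hem)),
      Measure.lintegral_compProd hF]
    refine lintegral_congr fun v => ?_
    rw [hS, Kernel.lintegral_snd _ _ (by exact hF.comp measurable_prodMk_left)]
    rfl
  have hfin : IsFiniteMeasure (P.map e) := by infer_instance
  have hdis : P.map e = (pV ⊗ₘ S) ⊗ₘ (P.map e).condKernel := by
    rw [← hfst]; exact ((P.map e).disintegrate _).symm
  have hback : ∀ M : Measure (V × X × Y), (M.map e).map e' = M := fun M => by
    rw [Measure.map_map hem' hem, hee, Measure.map_id]
  calc klDiv P (pV ⊗ₘ (pXV ×ₖ S))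
      = klDiv ((P.map e).map e') (((pV ⊗ₘ (pXV ×ₖ S)).map e).map e') := by rw [hback, hback]
    _ ≤ klDiv (P.map e) ((pV ⊗ₘ (pXV ×ₖ S)).map e) := klDiv_map_le _ _ hem'
    _ = klDiv ((pV ⊗ₘ S) ⊗ₘ (P.map e).condKernel)
          ((pV ⊗ₘ S) ⊗ₘ (pXV.comap Prod.fst measurable_fst)) := by rw [map_ref, ← hdis]
    _ ≤ klDiv ((pV ⊗ₘ S) ⊗ₘ (P.map e).condKernel)
          ((pV ⊗ₘ Q) ⊗ₘ (pXV.comap Prod.fst measurable_fst)) := by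
        -- By the chain rule, replacing the true output kernel S by Q adds the divergence between
        -- the laws of (V,Y), which is nonnegative.
        rw [klDiv_compProd_eq_add (pV ⊗ₘ S) (pV ⊗ₘ Q)]; exact le_add_self
    _ = klDiv (P.map e) ((pV ⊗ₘ (pXV ×ₖ Q)).map e) := by rw [map_ref, ← hdis]
    _ ≤ channelDiv pV pXV W Q := klDiv_map_le _ _ hem

/-- The channel obtained by tilting `Q` with the kernel `K` attains the Gibbs bound. -/
lemma exists_channelDiv_add_le (Q : Kernel V Y) [IsMarkovKernel Q] {K : X → Y → ℝ≥0∞}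
    (hK : Measurable (Function.uncurry K)) (hK1 : ∀ x y, K x y ≤ 1)
    (hfin : ∫⁻ z, negLog (response K Q z) ∂(pV ⊗ₘ pXV) ≠ ⊤) :
    ∃ W : Kernel (V × X) Y, IsMarkovKernel W ∧
      channelDiv pV pXV W Q + ∫⁻ z, negLog (K z.2.1 z.2.2) ∂(pV ⊗ₘ (pXV ⊗ₖ W)) ≤
        ∫⁻ z, negLog (response K Q z) ∂(pV ⊗ₘ pXV) := by
  have hC := isMixtureClosed_responses (V := V) hK hK1
  have hQ : response K Q ∈ responses V K := ⟨Q, inferInstance, rfl⟩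
  have hgm : Measurable (response K Q) := hC.measurable _ hQ
  set g := response K Q with hg
  have hgtop : ∀ z, g z ≠ ⊤ := hC.ne_top hQ
  -- The tilted density K/g. The value 1 where g = 0 only keeps W Markov there; finiteness of E[-log
  -- g] makes that set null.
  set f : V × X → Y → ℝ≥0∞ := fun z y => if g z = 0 then 1 else K z.2 y / g z with hf
  have hfm : Measurable (Function.uncurry f) := by
    refine Measurable.ite ((hgm.comp measurable_fst) (measurableSet_singleton 0)) measurable_const ?_
    exact (hK.comp ((measurable_snd.comp measurable_fst).prodMk measurable_snd)).div
      (hgm.comp measurable_fst)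
  set W : Kernel (V × X) Y := (Q.comap Prod.fst measurable_fst).withDensity f with hW
  have hWz : ∀ z, W z = (Q z.1).withDensity (f z) := fun z => by
    rw [hW, Kernel.withDensity_apply _ hfm]; rfl
  have hWm : IsMarkovKernel W := ⟨fun z => ⟨by
    rw [hWz, withDensity_apply _ MeasurableSet.univ, Measure.restrict_univ]
    by_cases h0 : g z = 0
    · simp [hf, h0]
    · simp only [hf, h0, if_false]
      simp_rw [div_eq_mul_inv]
      rw [lintegral_mul_const _ (by exact hK.comp measurable_prodMk_left)]
      exact ENNReal.mul_inv_cancel h0 (hgtop z)⟩⟩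
  refine ⟨W, hWm, ?_⟩
  set F : V × X × Y → ℝ≥0∞ := fun q => f (q.1, q.2.1) q.2.2 with hF
  have hFm : Measurable F := hfm.comp (by fun_prop : Measurable fun q : V × X × Y => ((q.1, q.2.1), q.2.2))
  have hPN : pV ⊗ₘ (pXV ⊗ₖ W) = (pV ⊗ₘ (pXV ×ₖ Q)).withDensity F := by
    refine Measure.ext_of_lintegral _ fun H hH => ?_
    rw [lintegral_channel pV pXV W hH, lintegral_withDensity_eq_lintegral_mul _ hFm hH,
      lintegral_ref pV pXV Q (hFm.mul hH)]
    refine lintegral_congr fun v => lintegral_congr fun x => ?_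
    rw [hWz, lintegral_withDensity_eq_lintegral_mul _ (by exact hfm.comp measurable_prodMk_left)
      (by exact hH.comp (measurable_prodMk_left.comp measurable_prodMk_left))]
    rfl
  set N := pV ⊗ₘ (pXV ×ₖ Q) with hN
  have hKm : Measurable fun q : V × X × Y => negLog (K q.2.1 q.2.2) :=
    measurable_negLog.comp (hK.comp measurable_snd)
  have hgm' : Measurable fun q : V × X × Y => negLog (g (q.1, q.2.1)) :=
    measurable_negLog.comp (hgm.comp (by fun_prop))
  have hPf : IsFiniteMeasure (N.withDensity F) := by rw [← hPN]; infer_instance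
  have hkl : channelDiv pV pXV W Q = ∫⁻ q, ENNReal.ofReal (klFun (F q).toReal) ∂N := by
    rw [channelDiv, hPN, klDiv_eq_lintegral_klFun_of_ac (withDensity_absolutelyContinuous _ _)]
    refine lintegral_congr_ae ?_
    filter_upwards [Measure.rnDeriv_withDensity N hFm] with q hq
    rw [hq]
  have hpos : ∀ᵐ q ∂N, g (q.1, q.2.1) ≠ 0 := by
    have h1 : ∀ᵐ z ∂(pV ⊗ₘ pXV), g z ≠ 0 := by
      filter_upwards [ae_lt_top (measurable_negLog.comp hgm) hfin] with z hz h0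
      simp [h0] at hz
    have h2 : N.map (fun q => (q.1, q.2.1)) = pV ⊗ₘ pXV := by
      refine Measure.ext_of_lintegral _ fun H hH => ?_
      rw [lintegral_map hH (by fun_prop), hN, lintegral_ref pV pXV Q (by fun_prop),
        Measure.lintegral_compProd hH]
      simp
    rw [← h2] at h1
    exact ae_of_ae_map (f := fun q : V × X × Y => (q.1, q.2.1)) (by fun_prop) h1
  have hF1 : ∫⁻ q, F q ∂N = 1 := by
    have := congrArg (fun M => M Set.univ) hPN
    simp only [withDensity_apply _ MeasurableSet.univ, Measure.restrict_univ] at this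
    rw [← this]; exact measure_univ
  -- This is log F = log K - log g multiplied by F, with klFun F = F log F + 1 - F. The terms are
  -- arranged so that no subtraction occurs in [0,∞]; F and 1 both integrate to 1 and cancel.
  have hmain : ∫⁻ q, (ENNReal.ofReal (klFun (F q).toReal) + negLog (K q.2.1 q.2.2) * F q + F q) ∂N
      = ∫⁻ q, (negLog (g (q.1, q.2.1)) * F q + 1) ∂N := by
    refine lintegral_congr_ae ?_
    filter_upwards [hpos] with q hq
    have hFq : F q = K q.2.1 q.2.2 / g (q.1, q.2.1) := by simp only [hF, hf, hq, if_false]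
    by_cases hK0 : K q.2.1 q.2.2 = 0
    · simp [hFq, hK0, klFun_zero]
    have hKt : K q.2.1 q.2.2 ≠ ⊤ := ne_top_of_le_ne_top ENNReal.one_ne_top (hK1 _ _)
    have hg1 := hC.le_one _ hQ (q.1, q.2.1)
    have hk := ENNReal.toReal_pos hK0 hKt
    have hγ := ENNReal.toReal_pos hq (hgtop _)
    have hk1 : (K q.2.1 q.2.2).toReal ≤ 1 := by
      simpa using ENNReal.toReal_mono ENNReal.one_ne_top (hK1 q.2.1 q.2.2)
    have hγ1 : (g (q.1, q.2.1)).toReal ≤ 1 := hC.toReal_le hQ _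
    have hFt : F q ≠ ⊤ := by rw [hFq]; exact ENNReal.div_ne_top hKt hq
    have hFr : (F q).toReal = (K q.2.1 q.2.2).toReal / (g (q.1, q.2.1)).toReal := by
      rw [hFq, ENNReal.toReal_div]
    have hx : 0 < (F q).toReal := by rw [hFr]; positivity
    have hlog : Real.log (F q).toReal
        = Real.log (K q.2.1 q.2.2).toReal - Real.log (g (q.1, q.2.1)).toReal := by
      rw [hFr, Real.log_div hk.ne' hγ.ne']
    have hl1 := Real.log_nonpos hk.le hk1
    have hl2 := Real.log_nonpos hγ.le hγ1
    rw [negLog_of_le_one hK0 (hK1 _ _), negLog_of_le_one hq hg1]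
    conv_lhs => rw [← ENNReal.ofReal_toReal hFt]
    conv_rhs => rw [← ENNReal.ofReal_toReal hFt]
    rw [ENNReal.toReal_ofReal hx.le, ← ENNReal.ofReal_mul (by linarith),
      ← ENNReal.ofReal_mul (by linarith), ← ENNReal.ofReal_one,
      ← ENNReal.ofReal_add (klFun_nonneg hx.le) (by nlinarith),
      ← ENNReal.ofReal_add (add_nonneg (klFun_nonneg hx.le) (by nlinarith)) hx.le,
      ← ENNReal.ofReal_add (by nlinarith) zero_le_one, klFun_apply, hlog]
    congr 1; ring
  have hgP : ∫⁻ q, negLog (g (q.1, q.2.1)) * F q ∂N = ∫⁻ z, negLog (g z) ∂(pV ⊗ₘ pXV) := by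
    calc _ = ∫⁻ q, negLog (g (q.1, q.2.1)) ∂(N.withDensity F) := by
          rw [lintegral_withDensity_eq_lintegral_mul _ hFm hgm']
          exact lintegral_congr fun q => mul_comm _ _
      _ = _ := by
          rw [← hPN, lintegral_channel pV pXV W hgm',
            Measure.lintegral_compProd (by exact measurable_negLog.comp hgm)]
          simp
  have hKP : ∫⁻ q, negLog (K q.2.1 q.2.2) * F q ∂N
      = ∫⁻ q, negLog (K q.2.1 q.2.2) ∂(pV ⊗ₘ (pXV ⊗ₖ W)) := by
    rw [hPN, lintegral_withDensity_eq_lintegral_mul _ hFm hKm]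
    exact lintegral_congr fun q => mul_comm _ _
  rw [lintegral_add_right _ hFm, lintegral_add_right _ (by exact hKm.mul hFm), ← hkl, hKP, hF1,
    lintegral_add_right _ measurable_const, hgP] at hmain
  simp only [lintegral_const, measure_univ, mul_one] at hmain
  exact ((ENNReal.add_left_inj ENNReal.one_ne_top).1 hmain).le

end

end

/-! ### Duality for the rate-distortion problem. -/

section

variable {X Y V : Type*} [MeasurableSpace X] [MeasurableSpace Y] [MeasurableSpace V]

/-! ### Lagrange multipliers -/

/-- A mixture of two kernels. -/
def mixTwo {S T : Type*} [MeasurableSpace S] [MeasurableSpace T] (a b : ℝ≥0) (Q₁ Q₂ : Kernel S T) :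
    Kernel S T where
  toFun s := a • Q₁ s + b • Q₂ s
  measurable' := by
    refine Measure.measurable_of_measurable_coe _ fun t ht => ?_
    simp only [Measure.add_apply, Measure.smul_apply]
    exact ((Q₁.measurable_coe ht).const_smul a).add ((Q₂.measurable_coe ht).const_smul b)

section mixTwo

variable {S T : Type*} [MeasurableSpace S] [MeasurableSpace T] {a b : ℝ≥0}
  (Q₁ Q₂ : Kernel S T)

lemma lintegral_mixTwo (s : S) (f : T → ℝ≥0∞) :
    ∫⁻ t, f t ∂mixTwo a b Q₁ Q₂ s = a * ∫⁻ t, f t ∂Q₁ s + b * ∫⁻ t, f t ∂Q₂ s := by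
  change ∫⁻ t, f t ∂(a • Q₁ s + b • Q₂ s) = _
  rw [lintegral_add_measure, lintegral_smul_measure, lintegral_smul_measure]
  rfl

lemma isMarkovKernel_mixTwo (hab : a + b = 1) [IsMarkovKernel Q₁] [IsMarkovKernel Q₂] :
    IsMarkovKernel (mixTwo a b Q₁ Q₂) :=
  ⟨fun s => ⟨by
    have : (a : ℝ≥0∞) + b = 1 := by exact_mod_cast hab
    have h := lintegral_mixTwo (a := a) (b := b) Q₁ Q₂ s 1
    simpa [this] using h⟩⟩

end mixTwo

section

variable (pV : Measure V) [IsProbabilityMeasure pV] (pXV : Kernel V X) [IsMarkovKernel pXV]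

lemma lintegral_channel_mixTwo {a b : ℝ≥0} (hab : a + b = 1) (W₁ W₂ : Kernel (V × X) Y)
    [IsMarkovKernel W₁] [IsMarkovKernel W₂] {F : V × X × Y → ℝ≥0∞} (hF : Measurable F) :
    ∫⁻ z, F z ∂(pV ⊗ₘ (pXV ⊗ₖ mixTwo a b W₁ W₂)) =
      a * ∫⁻ z, F z ∂(pV ⊗ₘ (pXV ⊗ₖ W₁)) + b * ∫⁻ z, F z ∂(pV ⊗ₘ (pXV ⊗ₖ W₂)) := by
  have := isMarkovKernel_mixTwo W₁ W₂ hab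
  have hm : ∀ (W : Kernel (V × X) Y) [IsMarkovKernel W],
      Measurable fun z : V × X => ∫⁻ y, F (z.1, z.2, y) ∂W z := fun W _ =>
    Measurable.lintegral_kernel_prod_right'
      (hF.comp (by fun_prop : Measurable fun q : (V × X) × Y => (q.1.1, q.1.2, q.2)))
  rw [lintegral_channel _ _ _ hF, lintegral_channel _ _ _ hF, lintegral_channel _ _ _ hF]
  simp_rw [lintegral_mixTwo]
  rw [← Measure.lintegral_compProd (f := fun z : V × X => ∫⁻ y, F (z.1, z.2, y) ∂W₁ z) (hm W₁),
    ← Measure.lintegral_compProd (f := fun z : V × X => ∫⁻ y, F (z.1, z.2, y) ∂W₂ z) (hm W₂),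
    ← Measure.lintegral_compProd (f := fun z : V × X => a * ∫⁻ y, F (z.1, z.2, y) ∂W₁ z
      + b * ∫⁻ y, F (z.1, z.2, y) ∂W₂ z) (((hm W₁).const_mul _).add ((hm W₂).const_mul _)),
    lintegral_add_left ((hm W₁).const_mul _), lintegral_const_mul _ (hm W₁),
    lintegral_const_mul _ (hm W₂)]

lemma lintegral_ref_mixTwo {a b : ℝ≥0} (hab : a + b = 1) (Q₁ Q₂ : Kernel V Y)
    [IsMarkovKernel Q₁] [IsMarkovKernel Q₂] {F : V × X × Y → ℝ≥0∞} (hF : Measurable F) :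
    ∫⁻ z, F z ∂(pV ⊗ₘ (pXV ×ₖ mixTwo a b Q₁ Q₂)) =
      a * ∫⁻ z, F z ∂(pV ⊗ₘ (pXV ×ₖ Q₁)) + b * ∫⁻ z, F z ∂(pV ⊗ₘ (pXV ×ₖ Q₂)) := by
  have := isMarkovKernel_mixTwo Q₁ Q₂ hab
  have hm : ∀ (W : Kernel V Y) [IsMarkovKernel W],
      Measurable fun z : V × X => ∫⁻ y, F (z.1, z.2, y) ∂W z.1 := fun W _ =>
    Measurable.lintegral_kernel_prod_right' (κ := W.comap Prod.fst measurable_fst)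
      (hF.comp (by fun_prop : Measurable fun q : (V × X) × Y => (q.1.1, q.1.2, q.2)))
  rw [lintegral_ref _ _ _ hF, lintegral_ref _ _ _ hF, lintegral_ref _ _ _ hF]
  simp_rw [lintegral_mixTwo]
  rw [← Measure.lintegral_compProd (f := fun z : V × X => ∫⁻ y, F (z.1, z.2, y) ∂Q₁ z.1) (hm Q₁),
    ← Measure.lintegral_compProd (f := fun z : V × X => ∫⁻ y, F (z.1, z.2, y) ∂Q₂ z.1) (hm Q₂),
    ← Measure.lintegral_compProd (f := fun z : V × X => a * ∫⁻ y, F (z.1, z.2, y) ∂Q₁ z.1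
      + b * ∫⁻ y, F (z.1, z.2, y) ∂Q₂ z.1) (((hm Q₁).const_mul _).add ((hm Q₂).const_mul _)),
    lintegral_add_left ((hm Q₁).const_mul _), lintegral_const_mul _ (hm Q₁),
    lintegral_const_mul _ (hm Q₂)]

/-- Both arguments of the divergence are linear in the pair (W,Q). This joint convexity is the
reason for keeping Q free instead of fixing it to the output kernel of W. -/
lemma channelDiv_mixTwo_le {a b : ℝ≥0} (hab : a + b = 1) (W₁ W₂ : Kernel (V × X) Y)
    [IsMarkovKernel W₁] [IsMarkovKernel W₂] (Q₁ Q₂ : Kernel V Y) [IsMarkovKernel Q₁]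
    [IsMarkovKernel Q₂] :
    channelDiv pV pXV (mixTwo a b W₁ W₂) (mixTwo a b Q₁ Q₂) ≤
      a * channelDiv pV pXV W₁ Q₁ + b * channelDiv pV pXV W₂ Q₂ := by
  have h1 : pV ⊗ₘ (pXV ⊗ₖ mixTwo a b W₁ W₂)
      = a • (pV ⊗ₘ (pXV ⊗ₖ W₁)) + b • (pV ⊗ₘ (pXV ⊗ₖ W₂)) := by
    refine Measure.ext_of_lintegral _ fun F hF => ?_
    rw [lintegral_channel_mixTwo _ _ hab _ _ hF, lintegral_add_measure, lintegral_smul_measure,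
      lintegral_smul_measure]
    rfl
  have h2 : pV ⊗ₘ (pXV ×ₖ mixTwo a b Q₁ Q₂)
      = a • (pV ⊗ₘ (pXV ×ₖ Q₁)) + b • (pV ⊗ₘ (pXV ×ₖ Q₂)) := by
    refine Measure.ext_of_lintegral _ fun F hF => ?_
    rw [lintegral_ref_mixTwo _ _ hab _ _ hF, lintegral_add_measure, lintegral_smul_measure,
      lintegral_smul_measure]
    rfl
  rw [channelDiv, h1, h2]
  exact klDiv_convex _ _ _ _ _ _

/-- **Lagrange duality** for the rate-distortion problem, under a Slater condition. -/
theorem exists_lagrange_multiplier {d : X → Y → ℝ} (hd : Measurable (Function.uncurry d))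
    {D r : ℝ} (hD : 0 ≤ D)
    (hr : ∀ (W : Kernel (V × X) Y) (Q : Kernel V Y), IsMarkovKernel W → IsMarkovKernel Q →
      meanCost pV pXV d W ≤ ENNReal.ofReal D → ENNReal.ofReal r ≤ channelDiv pV pXV W Q)
    (hslater : ∃ (W : Kernel (V × X) Y) (Q : Kernel V Y), IsMarkovKernel W ∧ IsMarkovKernel Q ∧
      meanCost pV pXV d W < ENNReal.ofReal D ∧ channelDiv pV pXV W Q ≠ ⊤) :
    ∃ l : ℝ, 0 ≤ l ∧ ∀ (W : Kernel (V × X) Y) (Q : Kernel V Y), IsMarkovKernel W →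
      IsMarkovKernel Q → channelDiv pV pXV W Q ≠ ⊤ → meanCost pV pXV d W ≠ ⊤ →
        r + l * D ≤ (channelDiv pV pXV W Q).toReal + l * (meanCost pV pXV d W).toReal := by
  let S : Set (ℝ × ℝ) := {p | ∃ (W : Kernel (V × X) Y) (Q : Kernel V Y), IsMarkovKernel W ∧
    IsMarkovKernel Q ∧ channelDiv pV pXV W Q ≠ ⊤ ∧ meanCost pV pXV d W ≠ ⊤ ∧
    p = ((meanCost pV pXV d W).toReal, (channelDiv pV pXV W Q).toReal)}
  have hrS : ∀ p ∈ S, p.1 ≤ D → r ≤ p.2 := by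
    rintro _ ⟨W, Q, hW, hQ, h1, h2, rfl⟩ hle
    have := hr W Q hW hQ (by rwa [← ENNReal.ofReal_toReal h2, ENNReal.ofReal_le_ofReal_iff hD])
    rw [← ENNReal.ofReal_toReal h1, ENNReal.ofReal_le_ofReal_iff ENNReal.toReal_nonneg] at this
    exact this
  have hconv : ∀ p ∈ S, ∀ q ∈ S, ∀ t : ℝ, 0 ≤ t → t ≤ 1 → t * p.1 + (1 - t) * q.1 ≤ D →
      r ≤ t * p.2 + (1 - t) * q.2 := by
    rintro _ ⟨W₁, Q₁, hW₁, hQ₁, h1, h2, rfl⟩ _ ⟨W₂, Q₂, hW₂, hQ₂, h3, h4, rfl⟩ t ht0 ht1 hle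
    lift t to ℝ≥0 using ht0
    set s : ℝ≥0 := 1 - t with hs
    have ht1' : t ≤ 1 := by exact_mod_cast ht1
    have hab : t + s = 1 := add_tsub_cancel_of_le ht1'
    have hs' : (1 : ℝ) - t = s := by rw [hs, NNReal.coe_sub ht1', NNReal.coe_one]
    rw [hs'] at hle ⊢
    have := isMarkovKernel_mixTwo W₁ W₂ hab
    have := isMarkovKernel_mixTwo Q₁ Q₂ hab
    have hdm : Measurable fun z : V × X × Y => ENNReal.ofReal (d z.2.1 z.2.2) :=
      (hd.comp measurable_snd).ennreal_ofReal
    have hcost : meanCost pV pXV d (mixTwo t s W₁ W₂)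
        = t * meanCost pV pXV d W₁ + s * meanCost pV pXV d W₂ :=
      lintegral_channel_mixTwo pV pXV hab W₁ W₂ hdm
    have h5 := hr (mixTwo t s W₁ W₂) (mixTwo t s Q₁ Q₂) inferInstance inferInstance (by
      rw [hcost, ← ENNReal.ofReal_toReal (a := t * meanCost pV pXV d W₁
        + s * meanCost pV pXV d W₂) (by finiteness), ENNReal.ofReal_le_ofReal_iff hD,
        ENNReal.toReal_add (by finiteness) (by finiteness)]
      simpa using hle)
    have h6 := h5.trans (channelDiv_mixTwo_le pV pXV hab W₁ W₂ Q₁ Q₂)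
    rw [← ENNReal.ofReal_toReal (a := t * channelDiv pV pXV W₁ Q₁ + s * channelDiv pV pXV W₂ Q₂)
      (by finiteness), ENNReal.ofReal_le_ofReal_iff ENNReal.toReal_nonneg,
      ENNReal.toReal_add (by finiteness) (by finiteness)] at h6
    simpa using h6
  obtain ⟨W₀, Q₀, hW₀, hQ₀, hlt, hfin⟩ := hslater
  have hp₀ : ((meanCost pV pXV d W₀).toReal, (channelDiv pV pXV W₀ Q₀).toReal) ∈ S :=
    ⟨W₀, Q₀, hW₀, hQ₀, hfin, (hlt.trans ENNReal.ofReal_lt_top).ne, rfl⟩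
  have hlt₀ : (meanCost pV pXV d W₀).toReal < D := by
    rwa [← ENNReal.ofReal_toReal (hlt.trans ENNReal.ofReal_lt_top).ne,
      ENNReal.ofReal_lt_ofReal_iff_of_nonneg ENNReal.toReal_nonneg] at hlt
  -- Slopes of the lines through (D,r) and points of the region to the left of D. Their infimum is
  -- the multiplier, and the Slater point makes the set nonempty.
  set T : Set ℝ := {x | ∃ p ∈ S, p.1 < D ∧ x = (p.2 - r) / (D - p.1)} with hT
  have hTne : T.Nonempty := ⟨_, _, hp₀, hlt₀, rfl⟩
  have hT0 : ∀ x ∈ T, 0 ≤ x := by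
    rintro _ ⟨p, hp, hpD, rfl⟩
    exact div_nonneg (by linarith [hrS p hp hpD.le]) (by linarith)
  refine ⟨sInf T, le_csInf hTne hT0, fun W Q hW hQ h1 h2 => ?_⟩
  have hq : ((meanCost pV pXV d W).toReal, (channelDiv pV pXV W Q).toReal) ∈ S :=
    ⟨W, Q, hW, hQ, h1, h2, rfl⟩
  set a := (meanCost pV pXV d W).toReal
  set b := (channelDiv pV pXV W Q).toReal
  rcases lt_trichotomy a D with ha | ha | ha
  · have := csInf_le ⟨0, hT0⟩ (show (b - r) / (D - a) ∈ T from ⟨_, hq, ha, rfl⟩)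
    rw [le_div_iff₀ (by linarith)] at this
    linarith
  · have := hrS _ hq ha.le
    rw [ha]; simpa using this
  -- For a point right of D, the segment to any point left of D crosses abscissa D at height at
  -- least r, by convexity. Hence the required slope on the right is at most every slope on the
  -- left.
  · have : (r - b) / (a - D) ≤ sInf T := by
      refine le_csInf hTne ?_
      rintro _ ⟨p, hp, hpD, rfl⟩
      rw [div_le_div_iff₀ (by linarith) (by linarith)]
      have hden : 0 < a - p.1 := by linarith
      have h3 := hconv p hp _ hq ((a - D) / (a - p.1)) (div_nonneg (by linarith) hden.le)
        (by rw [div_le_one hden]; linarith) (by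
          apply le_of_eq
          field_simp
          ring)
      have h4 : 1 - (a - D) / (a - p.1) = (D - p.1) / (a - p.1) := by field_simp; ring
      rw [h4, div_mul_eq_mul_div, div_mul_eq_mul_div, ← add_div, le_div_iff₀ hden] at h3
      linarith
    rw [div_le_iff₀ (by linarith)] at this
    linarith

end

/-! ### The exponential kernel of a distortion -/

/-- The kernel `exp (- l d(x, y))`. -/
def expKernel (l : ℝ) (d : X → Y → ℝ) (x : X) (y : Y) : ℝ≥0∞ :=
  ENNReal.ofReal (Real.exp (-(l * d x y)))

lemma measurable_expKernel {d : X → Y → ℝ} (hd : Measurable (Function.uncurry d)) (l : ℝ) :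
    Measurable (Function.uncurry (expKernel l d)) :=
  (Real.measurable_exp.comp (hd.const_mul l).neg).ennreal_ofReal

lemma expKernel_le_one {d : X → Y → ℝ} (hd0 : ∀ x y, 0 ≤ d x y) {l : ℝ} (hl : 0 ≤ l) (x : X)
    (y : Y) : expKernel l d x y ≤ 1 := by
  rw [expKernel, ENNReal.ofReal_le_one, Real.exp_le_one_iff]
  have := mul_nonneg hl (hd0 x y)
  linarith

lemma negLog_expKernel {d : X → Y → ℝ} {l : ℝ} (hl : 0 ≤ l) (x : X) (y : Y) :
    negLog (expKernel l d x y) = ENNReal.ofReal l * ENNReal.ofReal (d x y) := by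
  rw [expKernel, negLog_ofReal (Real.exp_pos _), Real.log_exp, neg_neg, ENNReal.ofReal_mul hl]

lemma expKernel_natCast (d : X → Y → ℝ) (k : ℕ) (x : X) (y : Y) :
    expKernel k d x y = expKernel 1 d x y ^ k := by
  rw [expKernel, expKernel, ← ENNReal.ofReal_pow (Real.exp_pos _).le, ← Real.exp_nat_mul]
  congr 2; ring

/-- Jensen's inequality. It compares the response at slope k with the k-th power of the response at
slope 1 and so dominates (1/k)(-log g) uniformly in k. -/
lemma lintegral_pow_le {T : Type*} [MeasurableSpace T] (ν : Measure T) [IsProbabilityMeasure ν]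
    {f : T → ℝ≥0∞} (hf : Measurable f) {k : ℕ} (hk : 1 ≤ k) :
    (∫⁻ t, f t ∂ν) ^ k ≤ ∫⁻ t, f t ^ k ∂ν := by
  have hk' : (1 : ℝ) ≤ k := by exact_mod_cast hk
  have hk0 : (k : ℝ) ≠ 0 := by positivity
  have h := eLpNorm'_le_eLpNorm'_of_exponent_le one_pos hk' ν hf.aestronglyMeasurable
  simp only [eLpNorm', enorm_eq_self, ENNReal.rpow_one, div_one] at h
  have h2 := ENNReal.rpow_le_rpow h (Nat.cast_nonneg (α := ℝ) k)
  rw [← ENNReal.rpow_mul, one_div_mul_cancel hk0, ENNReal.rpow_one] at h2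
  simpa using h2

section

variable (pV : Measure V) [IsProbabilityMeasure pV] (pXV : Kernel V X) [IsMarkovKernel pXV]

/-- The Slater condition: any expected distortion larger than the minimal one is attained by
a channel of finite divergence, as soon as there is a channel whose exponential response has an
integrable logarithm. -/
lemma exists_meanCost_lt {d : X → Y → ℝ} (hd : Measurable (Function.uncurry d))
    (hd0 : ∀ x y, 0 ≤ d x y) {y : ℕ → Y}
    (hy : ∀ x, ⨅ y', ENNReal.ofReal (d x y') = ⨅ j, ENNReal.ofReal (d x (y j))) {D : ℝ}
    (hlt : ∫⁻ z, ⨅ y', ENNReal.ofReal (d z.2 y') ∂(pV ⊗ₘ pXV) < ENNReal.ofReal D)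
    (Q₁ : Kernel V Y) [IsMarkovKernel Q₁]
    (hfin : ∫⁻ z, negLog (response (expKernel 1 d) Q₁ z) ∂(pV ⊗ₘ pXV) ≠ ⊤) :
    ∃ (W : Kernel (V × X) Y) (Q : Kernel V Y), IsMarkovKernel W ∧ IsMarkovKernel Q ∧
      meanCost pV pXV d W < ENNReal.ofReal D ∧ channelDiv pV pXV W Q ≠ ⊤ := by
  have hw : ∑' i : ℕ, (2⁻¹ : ℝ≥0∞) ^ (i + 1) = 1 := by
    rw [ENNReal.tsum_geometric_add_one, ENNReal.one_sub_inv_two, inv_inv,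
      ENNReal.inv_mul_cancel (by simp) (by simp)]
  set Q₂ : Kernel V Y := mixKernel (fun i => (2⁻¹ : ℝ≥0∞) ^ (i + 1))
    (fun j => Kernel.const V (Measure.dirac (y j))) with hQ₂
  have hQ₂m : IsMarkovKernel Q₂ := isMarkovKernel_mixKernel hw _
  have hab : (2⁻¹ : ℝ≥0) + 2⁻¹ = 1 := by norm_num
  have h2 : ((2⁻¹ : ℝ≥0) : ℝ≥0∞) = 2⁻¹ := by simp
  -- One half of Q supplies an integrable bound. The other half charges every y_j, so by Laplace's
  -- principle (1/k)(-log ∫ exp(-kd) dQ) has upper limit at most inf_y d(x,y).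
  set Q := mixTwo 2⁻¹ 2⁻¹ Q₁ Q₂ with hQ
  have hQm : IsMarkovKernel Q := isMarkovKernel_mixTwo _ _ hab
  have hKm := measurable_expKernel hd
  have hK1 := fun k : ℕ => expKernel_le_one hd0 (Nat.cast_nonneg (α := ℝ) k)
  have hgQ : ∀ (k : ℕ) (z : V × X), response (expKernel k d) Q z
      = 2⁻¹ * response (expKernel k d) Q₁ z + 2⁻¹ * response (expKernel k d) Q₂ z := fun k z => by
    rw [response, hQ, lintegral_mixTwo, h2]; rfl
  have hC := fun k : ℕ => isMixtureClosed_responses (V := V) (hKm (k : ℝ)) (hK1 k)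
  have hmem : ∀ k : ℕ, response (expKernel k d) Q ∈ responses V (expKernel (k : ℝ) d) :=
    fun k => ⟨Q, hQm, rfl⟩
  set κ := negLog 2⁻¹ with hκ
  have hκtop : κ ≠ ⊤ := by simp [hκ, negLog_eq_top_iff]
  -- domination
  have hdom : ∀ k : ℕ, 1 ≤ k → ∀ z : V × X, (k : ℝ≥0∞)⁻¹ * negLog (response (expKernel k d) Q z) ≤
      κ + negLog (response (expKernel 1 d) Q₁ z) := by
    intro k hk z
    have hk0 : (k : ℝ≥0∞) ≠ 0 := by simp; omega
    have h3 : response (expKernel 1 d) Q₁ z ≤ 1 := by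
      simpa using (hC 1).le_one _ ⟨Q₁, inferInstance, rfl⟩ z
    have h4 : response (expKernel 1 d) Q₁ z ^ k ≤ response (expKernel k d) Q₁ z := by
      simp only [response, expKernel_natCast]
      exact lintegral_pow_le _ ((hKm 1).comp measurable_prodMk_left) hk
    have h5 : negLog (response (expKernel k d) Q z) ≤
        κ + k * negLog (response (expKernel 1 d) Q₁ z) := by
      rw [← negLog_pow h3, hκ, ← negLog_mul (by simp) (pow_le_one' h3 k)]
      refine antitone_negLog ?_
      rw [hgQ]
      exact le_trans (mul_le_mul_right h4 _) le_self_add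
    calc (k : ℝ≥0∞)⁻¹ * negLog (response (expKernel k d) Q z)
        ≤ (k : ℝ≥0∞)⁻¹ * (κ + k * negLog (response (expKernel 1 d) Q₁ z)) := by gcongr
      _ = (k : ℝ≥0∞)⁻¹ * κ + negLog (response (expKernel 1 d) Q₁ z) := by
          rw [mul_add, ← mul_assoc, ENNReal.inv_mul_cancel hk0 (by simp), one_mul]
      _ ≤ _ := by
          gcongr
          exact mul_le_of_le_one_left' (ENNReal.inv_le_one.2 (by exact_mod_cast hk))
  -- pointwise limits
  have hpt : ∀ z : V × X, limsup (fun k : ℕ => ((k + 1 : ℕ) : ℝ≥0∞)⁻¹ *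
      negLog (response (expKernel (k + 1 : ℕ) d) Q z)) atTop ≤
        ⨅ y', ENNReal.ofReal (d z.2 y') := by
    intro z
    rw [hy]
    refine le_iInf fun j => ?_
    have h3 : ∀ k : ℕ, ((k + 1 : ℕ) : ℝ≥0∞)⁻¹ * negLog (response (expKernel (k + 1 : ℕ) d) Q z) ≤
        ((k + 1 : ℕ) : ℝ≥0∞)⁻¹ * ((j + 2 : ℕ) * κ) + ENNReal.ofReal (d z.2 (y j)) := by
      intro k
      have hk0 : ((k + 1 : ℕ) : ℝ≥0∞) ≠ 0 := by simp
      have h4 : (2⁻¹ : ℝ≥0∞) ^ (j + 1) * expKernel (k + 1 : ℕ) d z.2 (y j) ≤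
          response (expKernel (k + 1 : ℕ) d) Q₂ z := by
        rw [hQ₂, response_mixKernel]
        refine le_trans (le_of_eq ?_) (ENNReal.le_tsum j)
        congr 1
        rw [response, Kernel.const_apply, lintegral_dirac' _ (by exact (hKm _).comp measurable_prodMk_left)]
      have h5 : negLog (response (expKernel (k + 1 : ℕ) d) Q z) ≤
          (j + 2 : ℕ) * κ + (k + 1 : ℕ) * ENNReal.ofReal (d z.2 (y j)) := by
        have h6 := negLog_expKernel (d := d) (Nat.cast_nonneg (α := ℝ) (k + 1)) z.2 (y j)
        rw [ENNReal.ofReal_natCast] at h6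
        rw [← h6, hκ, ← negLog_pow (by simp),
          ← negLog_mul (pow_le_one' (by simp) _) (hK1 (k + 1) _ _)]
        refine antitone_negLog ?_
        rw [hgQ, pow_succ', mul_assoc]
        exact le_trans (mul_le_mul_right h4 _) le_add_self
      calc _ ≤ ((k + 1 : ℕ) : ℝ≥0∞)⁻¹ *
            ((j + 2 : ℕ) * κ + (k + 1 : ℕ) * ENNReal.ofReal (d z.2 (y j))) := by gcongr
        _ = _ := by rw [mul_add, ← mul_assoc _ ((k + 1 : ℕ) : ℝ≥0∞),
              ENNReal.inv_mul_cancel hk0 (by simp), one_mul]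
    refine (limsup_le_limsup (Eventually.of_forall h3)).trans (le_of_eq ?_)
    refine Tendsto.limsup_eq ?_
    have h7 : Tendsto (fun k : ℕ => ((k + 1 : ℕ) : ℝ≥0∞)⁻¹) atTop (𝓝 0) :=
      ENNReal.tendsto_inv_nat_nhds_zero.comp (tendsto_add_atTop_nat 1)
    have h8 := (ENNReal.Tendsto.mul_const (b := ((j + 2 : ℕ) : ℝ≥0∞) * κ) h7
      (Or.inr (by finiteness))).add_const (ENNReal.ofReal (d z.2 (y j)))
    simpa using h8
  -- Reverse Fatou lemma. It yields a slope n with E[-log g] < nD, and tilting by that kernel gives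
  -- a channel of cost below D and finite divergence.
  have hlimsup : limsup (fun k : ℕ => ∫⁻ z, ((k + 1 : ℕ) : ℝ≥0∞)⁻¹ *
      negLog (response (expKernel (k + 1 : ℕ) d) Q z) ∂(pV ⊗ₘ pXV)) atTop < ENNReal.ofReal D := by
    refine lt_of_le_of_lt ((limsup_lintegral_le
      (fun z => κ + negLog (response (expKernel 1 d) Q₁ z)) (fun k => ?_)
      (fun k => ae_of_all _ (hdom (k + 1) (by omega))) ?_).trans (lintegral_mono hpt)) hlt
    · exact (measurable_negLog.comp ((hC _).measurable _ (hmem _))).const_mul _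
    · rw [lintegral_add_left measurable_const]
      simpa using ⟨hκtop, hfin⟩
  obtain ⟨k, hk⟩ := (eventually_lt_of_limsup_lt hlimsup).exists
  rw [lintegral_const_mul _ (by exact measurable_negLog.comp ((hC _).measurable _ (hmem _)))] at hk
  set n : ℕ := k + 1
  have hn0 : (n : ℝ≥0∞) ≠ 0 := by simp [n]
  have hk' : ∫⁻ z, negLog (response (expKernel n d) Q z) ∂(pV ⊗ₘ pXV)
      < n * ENNReal.ofReal D := by
    rwa [← ENNReal.div_eq_inv_mul, ENNReal.div_lt_iff (Or.inl hn0) (Or.inl (by simp)),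
      mul_comm] at hk
  obtain ⟨W, hW, hWle⟩ := exists_channelDiv_add_le pV pXV Q (hKm n) (hK1 n)
    (hk'.trans_le le_top).ne
  have hcost : ∫⁻ z, negLog (expKernel n d z.2.1 z.2.2) ∂(pV ⊗ₘ (pXV ⊗ₖ W))
      = n * meanCost pV pXV d W := by
    simp_rw [negLog_expKernel (Nat.cast_nonneg (α := ℝ) n), ENNReal.ofReal_natCast]
    exact lintegral_const_mul _ (hd.comp measurable_snd).ennreal_ofReal
  rw [hcost] at hWle
  refine ⟨W, Q, hW, hQm, ?_, ?_⟩
  · exact (ENNReal.mul_lt_mul_iff_right hn0 (by simp)).1 ((le_add_self.trans hWle).trans_lt hk')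
  · exact ((le_self_add.trans hWle).trans_lt (hk'.trans_le le_top)).ne

/-- **Duality** away from the minimal expected distortion: for a suitable slope `l`, the negative
logarithm of the exponential response of every channel has a large mean. -/
theorem exists_slope {d : X → Y → ℝ} (hd : Measurable (Function.uncurry d))
    (hd0 : ∀ x y, 0 ≤ d x y) {y : ℕ → Y}
    (hy : ∀ x, ⨅ y', ENNReal.ofReal (d x y') = ⨅ j, ENNReal.ofReal (d x (y j))) {D r r' : ℝ}
    (hD : 0 ≤ D) (hrr : r' < r)
    (hne : ∫⁻ z, ⨅ y', ENNReal.ofReal (d z.2 y') ∂(pV ⊗ₘ pXV) ≠ ENNReal.ofReal D)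
    (hr : ∀ (W : Kernel (V × X) Y) (Q : Kernel V Y), IsMarkovKernel W → IsMarkovKernel Q →
      meanCost pV pXV d W ≤ ENNReal.ofReal D → ENNReal.ofReal r ≤ channelDiv pV pXV W Q) :
    ∃ l : ℝ, 0 ≤ l ∧ ∀ g ∈ responses V (expKernel l d),
      ENNReal.ofReal (r' + l * D) ≤ ∫⁻ z, negLog (g z) ∂(pV ⊗ₘ pXV) := by
  have hKm := measurable_expKernel hd
  rcases lt_or_gt_of_ne hne with hlt | hgt
  · by_cases hall : ∀ g ∈ responses V (expKernel 1 d), ∫⁻ z, negLog (g z) ∂(pV ⊗ₘ pXV) = ⊤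
    · exact ⟨1, zero_le_one, fun g hg => by rw [hall g hg]; exact le_top⟩
    push Not at hall
    obtain ⟨_, ⟨Q₁, hQ₁, rfl⟩, hfin⟩ := hall
    obtain ⟨l, hl, hlag⟩ := exists_lagrange_multiplier pV pXV hd hD hr
      (exists_meanCost_lt pV pXV hd hd0 hy hlt Q₁ hfin)
    -- The slope is made strictly positive so that a finite Gibbs value forces a finite cost. The
    -- excess δD is paid out of the gap r - r'.
    set δ := (r - r') / (D + 1) with hδ
    have hδ0 : 0 < δ := div_pos (by linarith) (by linarith)
    have hδD : δ * D ≤ r - r' := by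
      rw [hδ, div_mul_eq_mul_div, div_le_iff₀ (by linarith)]; nlinarith
    have hlδ : 0 < l + δ := by linarith
    refine ⟨l + δ, hlδ.le, ?_⟩
    rintro _ ⟨Q, hQ, rfl⟩
    by_cases hfin : ∫⁻ z, negLog (response (expKernel (l + δ) d) Q z) ∂(pV ⊗ₘ pXV) = ⊤
    · rw [hfin]; exact le_top
    obtain ⟨W, hW, hWle⟩ := exists_channelDiv_add_le pV pXV Q (hKm (l + δ))
      (expKernel_le_one hd0 hlδ.le) hfin
    refine le_trans ?_ hWle
    have hcost : ∫⁻ z, negLog (expKernel (l + δ) d z.2.1 z.2.2) ∂(pV ⊗ₘ (pXV ⊗ₖ W))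
        = ENNReal.ofReal (l + δ) * meanCost pV pXV d W := by
      simp_rw [negLog_expKernel hlδ.le]
      exact lintegral_const_mul _ (hd.comp measurable_snd).ennreal_ofReal
    rw [hcost] at hWle ⊢
    have h1 : channelDiv pV pXV W Q ≠ ⊤ := ne_top_of_le_ne_top hfin (le_self_add.trans hWle)
    have h2 : meanCost pV pXV d W ≠ ⊤ := fun h => by
      rw [h, ENNReal.mul_top (by simpa using hlδ)] at hWle
      exact hfin (top_le_iff.1 (le_add_self.trans hWle))
    have h3 := hlag W Q hW hQ h1 h2
    rw [← ENNReal.ofReal_toReal h1, ← ENNReal.ofReal_toReal h2, ← ENNReal.ofReal_mul hlδ.le,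
      ← ENNReal.ofReal_add ENNReal.toReal_nonneg (by positivity)]
    refine ENNReal.ofReal_le_ofReal ?_
    have h4 : 0 ≤ δ * (meanCost pV pXV d W).toReal := by positivity
    linarith
  -- Here D lies below the least expected distortion. Every response is at most exp(-l inf_y d), so
  -- a large l makes E[-log g] - lD as large as desired.
  · obtain ⟨D', hD'0, hDD', hD'⟩ := ENNReal.lt_iff_exists_real_btwn.1 hgt
    have hDD'' : D < D' := (ENNReal.ofReal_lt_ofReal_iff_of_nonneg hD).1 hDD'
    set l := max 0 (r' / (D' - D)) with hl
    have hl0 : 0 ≤ l := le_max_left _ _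
    have hlr : r' ≤ l * (D' - D) := by
      rw [← div_le_iff₀ (by linarith)]; exact le_max_right _ _
    refine ⟨l, hl0, ?_⟩
    rintro _ ⟨Q, hQ, rfl⟩
    have hpt : ∀ z : V × X, ENNReal.ofReal l * ⨅ y', ENNReal.ofReal (d z.2 y') ≤
        negLog (response (expKernel l d) Q z) := by
      intro z
      set m := ⨅ y', ENNReal.ofReal (d z.2 y') with hm
      have hmtop : m ≠ ⊤ := ne_top_of_le_ne_top ENNReal.ofReal_ne_top (iInf_le _ (y 0))
      have h1 : response (expKernel l d) Q z ≤ ENNReal.ofReal (Real.exp (-(l * m.toReal))) := by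
        calc _ ≤ ∫⁻ _, ENNReal.ofReal (Real.exp (-(l * m.toReal))) ∂Q z.1 := by
              refine lintegral_mono fun y' => ENNReal.ofReal_le_ofReal (Real.exp_le_exp.2 ?_)
              have : m.toReal ≤ d z.2 y' :=
                ENNReal.toReal_le_of_le_ofReal (hd0 _ _) (iInf_le _ y')
              have := mul_le_mul_of_nonneg_left this hl0
              linarith
          _ = _ := by simp
      refine le_trans (le_of_eq ?_) (antitone_negLog h1)
      rw [negLog_ofReal (Real.exp_pos _), Real.log_exp, neg_neg, ENNReal.ofReal_mul hl0,
        ENNReal.ofReal_toReal hmtop]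
    have hmm : Measurable fun z : V × X => ⨅ y', ENNReal.ofReal (d z.2 y') := by
      simp_rw [hy]
      exact Measurable.iInf fun j =>
        (hd.comp (measurable_snd.prodMk measurable_const)).ennreal_ofReal
    calc ENNReal.ofReal (r' + l * D) ≤ ENNReal.ofReal (l * D') :=
          ENNReal.ofReal_le_ofReal (by linarith)
      _ = ENNReal.ofReal l * ENNReal.ofReal D' := ENNReal.ofReal_mul hl0
      _ ≤ ENNReal.ofReal l * ∫⁻ z, ⨅ y', ENNReal.ofReal (d z.2 y') ∂(pV ⊗ₘ pXV) := by gcongr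
      _ = ∫⁻ z, ENNReal.ofReal l * ⨅ y', ENNReal.ofReal (d z.2 y') ∂(pV ⊗ₘ pXV) :=
          (lintegral_const_mul _ hmm).symm
      _ ≤ _ := lintegral_mono hpt

end

end

/-! ### Joint laws of the codewords and the attacker's output. -/

section

variable {X Y V : Type*} [MeasurableSpace X] [MeasurableSpace Y] [MeasurableSpace V]

/-! ### Products of kernels -/

lemma lintegral_infinitePi_prod {Ω : Type*} [MeasurableSpace Ω] (P : ℕ → Measure Ω)
    [∀ i, IsProbabilityMeasure (P i)] (s : Finset ℕ) {f : ℕ → Ω → ℝ≥0∞}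
    (hf : ∀ i, Measurable (f i)) :
    ∫⁻ x, ∏ i ∈ s, f i (x i) ∂Measure.infinitePi P = ∏ i ∈ s, ∫⁻ x, f i x ∂P i := by
  have hind := iIndepFun_infinitePi (P := P) (X := fun i => f i) hf
  have h := lintegral_prod_eq_prod_lintegral_of_indepFun s _ hind
    (fun i => (hf i).comp (measurable_pi_apply i))
  rw [← Finset.prod_congr rfl fun i _ => ?_] at h
  · exact h
  · rw [← Measure.infinitePi_map_eval P i, lintegral_map (hf i) (measurable_pi_apply i)]

/-- Given a sequence `ω`, independent samples of the laws `κ (ω u)`. -/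
def seqKernel {Ω : Type*} [MeasurableSpace Ω] (κ : Kernel Ω X) [IsMarkovKernel κ] :
    Kernel (ℕ → Ω) (ℕ → X) where
  toFun ω := Measure.infinitePi fun u => κ (ω u)
  measurable' := by
    refine Measurable.measure_of_isPiSystem_of_isProbabilityMeasure
      generateFrom_squareCylinders.symm (isPiSystem_squareCylinders
        (fun _ => MeasurableSpace.isPiSystem_measurableSet) fun _ => MeasurableSet.univ) ?_
    rintro _ ⟨s, S, hS, rfl⟩
    have hS' : ∀ i ∈ s, MeasurableSet (S i) := fun i _ => hS i (Set.mem_univ i)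
    simp only [Measure.infinitePi_pi _ hS']
    exact Finset.measurable_prod _ fun i hi =>
      (κ.measurable_coe (hS' i hi)).comp (measurable_pi_apply i)

section seqKernel

variable {Ω : Type*} [MeasurableSpace Ω] (κ : Kernel Ω X) [IsMarkovKernel κ]

instance : IsMarkovKernel (seqKernel κ) :=
  ⟨fun ω => inferInstanceAs (IsProbabilityMeasure (Measure.infinitePi fun u => κ (ω u)))⟩

/-- Sampling the whole first sequence and then the second coordinates is the same as sampling iid
pairs; checking boxes suffices. -/
lemma map_compProd_seqKernel (μ : Measure Ω) [IsProbabilityMeasure μ] :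
    (Measure.infinitePi (fun _ : ℕ => μ) ⊗ₘ seqKernel κ).map (fun z u => (z.1 u, z.2 u)) =
      Measure.infinitePi (fun _ : ℕ => μ ⊗ₘ κ) := by
  refine Measure.eq_infinitePi _ fun s S hS => ?_
  have hm : Measurable fun (z : (ℕ → Ω) × (ℕ → X)) (u : ℕ) => (z.1 u, z.2 u) := by fun_prop
  have hbox : MeasurableSet (Set.pi (s : Set ℕ) S) :=
    MeasurableSet.pi s.countable_toSet fun i _ => hS i
  rw [Measure.map_apply hm hbox, Measure.compProd_apply (hm hbox)]
  have : ∀ ω : ℕ → Ω, seqKernel κ ω (Prod.mk ω ⁻¹' ((fun (z : (ℕ → Ω) × (ℕ → X)) (u : ℕ) =>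
      (z.1 u, z.2 u)) ⁻¹' Set.pi (s : Set ℕ) S)) = ∏ i ∈ s, κ (ω i) (Prod.mk (ω i) ⁻¹' S i) := by
    intro ω
    change Measure.infinitePi (fun u => κ (ω u)) _ = _
    rw [← Measure.infinitePi_pi (μ := fun u => κ (ω u))
      (t := fun i => Prod.mk (ω i) ⁻¹' S i) fun i _ => measurable_prodMk_left (hS i)]
    rfl
  simp_rw [this]
  rw [lintegral_infinitePi_prod (fun _ => μ) s (f := fun i w => κ w (Prod.mk w ⁻¹' S i))]
  · simp_rw [← Measure.compProd_apply (hS _)]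
  · exact fun i => Kernel.measurable_kernel_prodMk_left (hS i)

end seqKernel

/-! ### Two rows of the codebook -/

section

variable (pV : Measure V) [IsProbabilityMeasure pV] (pXV : Kernel V X) [IsMarkovKernel pXV]

lemma map_iidKernel_eval {M : ℕ} (m : Fin M) :
    (pV ⊗ₘ iidKernel pXV M).map (fun z => (z.1, z.2 m)) = pV ⊗ₘ pXV := by
  have hm : Measurable fun z : V × (Fin M → X) => (z.1, z.2 m) := by fun_prop
  refine Measure.ext_of_lintegral _ fun f hf => ?_
  rw [lintegral_map hf hm, Measure.lintegral_compProd (by fun_prop),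
    Measure.lintegral_compProd hf]
  refine lintegral_congr fun v => ?_
  change ∫⁻ x, f (v, x m) ∂(Measure.pi fun _ : Fin M => pXV v) = _
  have h := (measurePreserving_eval (fun _ : Fin M => pXV v) m).lintegral_comp
    (f := fun x => f (v, x)) (by fun_prop)
  exact h

/-- At each time another row is a fresh sample of p(·|V), conditionally independent of the row shown
to the attacker. -/
lemma map_iidKernel_eval_two {M : ℕ} {m j : Fin M} (hj : m ≠ j) :
    (pV ⊗ₘ iidKernel pXV M).map (fun z => ((z.1, z.2 m), z.2 j)) =
      (pV ⊗ₘ pXV) ⊗ₘ pXV.comap Prod.fst measurable_fst := by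
  have hm : Measurable fun z : V × (Fin M → X) => ((z.1, z.2 m), z.2 j) := by fun_prop
  refine Measure.ext_of_lintegral _ fun f hf => ?_
  rw [lintegral_map hf hm, Measure.lintegral_compProd (by fun_prop),
    Measure.lintegral_compProd hf, Measure.lintegral_compProd
      (Measurable.lintegral_kernel_prod_right' hf)]
  refine lintegral_congr fun v => ?_
  change ∫⁻ x, f ((v, x m), x j) ∂(Measure.pi fun _ : Fin M => pXV v) =
    ∫⁻ x, ∫⁻ x', f ((v, x), x') ∂pXV v ∂pXV v
  have hind := (iIndepFun_pi (μ := fun _ : Fin M => pXV v) (X := fun _ x => x)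
    fun _ => measurable_id.aemeasurable).indepFun hj
  have h := (indepFun_iff_map_prod_eq_prod_map_map (measurable_pi_apply m).aemeasurable
    (measurable_pi_apply j).aemeasurable).1 hind
  rw [(measurePreserving_eval (fun _ : Fin M => pXV v) m).map_eq,
    (measurePreserving_eval (fun _ : Fin M => pXV v) j).map_eq] at h
  have hg : Measurable fun p : X × X => f ((v, p.1), p.2) := by fun_prop
  rw [← lintegral_prod _ hg.aemeasurable, ← h, lintegral_map hg (by fun_prop)]

variable (A : Kernel (ℕ → V × X) (ℕ → Y)) [IsMarkovKernel A]

lemma measurable_row {M : ℕ} (m : Fin M) :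
    Measurable fun (T : ℕ → V × (Fin M → X)) (u : ℕ) => ((T u).1, (T u).2 m) := by fun_prop

/-- The transmitted row and the attacker's output have the same law as an iid input and the
attacker's response to it. -/
lemma lintegral_row {M : ℕ} (m : Fin M) {F : (ℕ → V × X) × (ℕ → Y) → ℝ≥0∞} (hF : Measurable F) :
    ∫⁻ ω, F (fun u => ((ω.1 u).1, (ω.1 u).2 m), ω.2)
        ∂(Measure.infinitePi (fun _ : ℕ => pV ⊗ₘ iidKernel pXV M) ⊗ₘ
          A.comap _ (measurable_row m)) =
      ∫⁻ ω, F ω ∂(Measure.infinitePi (fun _ : ℕ => pV ⊗ₘ pXV) ⊗ₘ A) := by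
  rw [Measure.lintegral_compProd (by fun_prop), Measure.lintegral_compProd hF,
    ← map_iidKernel_eval pV pXV m,
    ← Measure.infinitePi_map_pi (f := fun (_ : ℕ) (z : V × (Fin M → X)) => (z.1, z.2 m))
      (μ := fun _ => pV ⊗ₘ iidKernel pXV M) (fun _ => by fun_prop),
    lintegral_map (Measurable.lintegral_kernel_prod_right' hF) (by fun_prop)]
  rfl

/-- The expected likelihood of a row of the codebook that was not transmitted. -/
lemma lintegral_other_row {M : ℕ} {m j : Fin M} (hj : m ≠ j) {a : V × X × Y → ℝ≥0∞}
    (ha : Measurable a) (s : Finset ℕ) :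
    ∫⁻ ω, ∏ u ∈ s, a ((ω.1 u).1, (ω.1 u).2 j, ω.2 u)
        ∂(Measure.infinitePi (fun _ : ℕ => pV ⊗ₘ iidKernel pXV M) ⊗ₘ
          A.comap _ (measurable_row m)) =
      ∫⁻ ω, ∏ u ∈ s, ∫⁻ x, a ((ω.1 u).1, x, ω.2 u) ∂pXV (ω.1 u).1
        ∂(Measure.infinitePi (fun _ : ℕ => pV ⊗ₘ pXV) ⊗ₘ A) := by
  have hin : ∀ u, Measurable fun ω : (ℕ → V × X) × (ℕ → Y) =>
      ∫⁻ x, a ((ω.1 u).1, x, ω.2 u) ∂pXV (ω.1 u).1 := fun u => by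
    have h : Measurable fun q : V × Y => ∫⁻ x, a (q.1, x, q.2) ∂pXV q.1 := by
      have := Measurable.lintegral_kernel_prod_right' (κ := pXV.comap Prod.fst measurable_fst)
        (f := fun z : (V × Y) × X => a (z.1.1, z.2, z.1.2)) (by fun_prop)
      exact this
    exact h.comp (by fun_prop : Measurable fun ω : (ℕ → V × X) × (ℕ → Y) => ((ω.1 u).1, ω.2 u))
  have hG : Measurable fun z : (ℕ → (V × X) × X) × (ℕ → Y) =>
      ∏ u ∈ s, a ((z.1 u).1.1, (z.1 u).2, z.2 u) := by fun_prop
  have hA : Measurable fun S : ℕ → (V × X) × X =>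
      ∫⁻ y, ∏ u ∈ s, a ((S u).1.1, (S u).2, y u) ∂A (fun u => (S u).1) := by
    have := Measurable.lintegral_kernel_prod_right'
      (κ := A.comap (fun (S : ℕ → (V × X) × X) (u : ℕ) => (S u).1) (by fun_prop)) hG
    exact this
  rw [Measure.lintegral_compProd (by fun_prop),
    Measure.lintegral_compProd (Finset.measurable_prod _ fun u _ => hin u)]
  calc ∫⁻ T, ∫⁻ y, ∏ u ∈ s, a ((T u).1, (T u).2 j, y u) ∂A (fun u => ((T u).1, (T u).2 m))
        ∂Measure.infinitePi (fun _ : ℕ => pV ⊗ₘ iidKernel pXV M)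
      = ∫⁻ S, ∫⁻ y, ∏ u ∈ s, a ((S u).1.1, (S u).2, y u) ∂A (fun u => (S u).1)
          ∂Measure.infinitePi
            (fun _ : ℕ => (pV ⊗ₘ pXV) ⊗ₘ pXV.comap Prod.fst measurable_fst) := by
        rw [← map_iidKernel_eval_two pV pXV hj,
          ← Measure.infinitePi_map_pi
            (f := fun (_ : ℕ) (z : V × (Fin M → X)) => ((z.1, z.2 m), z.2 j))
            (μ := fun _ => pV ⊗ₘ iidKernel pXV M) (fun _ => by fun_prop),
          lintegral_map hA (by fun_prop)]
    _ = ∫⁻ ω, ∫⁻ x, ∫⁻ y, ∏ u ∈ s, a ((ω u).1, x u, y u) ∂A ω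
          ∂seqKernel (pXV.comap (Prod.fst : V × X → V) measurable_fst) ω
          ∂Measure.infinitePi (fun _ : ℕ => pV ⊗ₘ pXV) := by
        rw [← map_compProd_seqKernel, lintegral_map hA (by fun_prop), Measure.lintegral_compProd]
        exact hA.comp (by fun_prop : Measurable fun (z : (ℕ → V × X) × (ℕ → X)) (u : ℕ) =>
          (z.1 u, z.2 u))
    _ = _ := by
        refine lintegral_congr fun ω => ?_
        -- The output depends only on V and the sent row, so the other row can be integrated first
        -- with the output fixed. The product then factorizes over time.
        rw [lintegral_lintegral_swap (Measurable.aemeasurable (by fun_prop))]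
        refine lintegral_congr fun y => ?_
        exact lintegral_infinitePi_prod (fun u => pXV (ω u).1) s
          (f := fun u x => a ((ω u).1, x, y u)) (fun u => by fun_prop)

/-- The single-letter bound is assumed for every law of (V,Y) with V-marginal `pV` because the law
of (V_u,Y_u) depends on the attacker and on u. -/
lemma lintegral_other_row_le {M : ℕ} {m j : Fin M} (hj : m ≠ j) {a : V × X × Y → ℝ≥0∞}
    (ha : Measurable a)
    (h1 : ∀ ν : Measure (V × Y), ν.fst = pV → ∀ᵐ p ∂ν, ∫⁻ x, a (p.1, x, p.2) ∂pXV p.1 ≤ 1)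
    (s : Finset ℕ) :
    ∫⁻ ω, ∏ u ∈ s, a ((ω.1 u).1, (ω.1 u).2 j, ω.2 u)
        ∂(Measure.infinitePi (fun _ : ℕ => pV ⊗ₘ iidKernel pXV M) ⊗ₘ
          A.comap _ (measurable_row m)) ≤ 1 := by
  rw [lintegral_other_row pV pXV A hj ha]
  set P := Measure.infinitePi (fun _ : ℕ => pV ⊗ₘ pXV) ⊗ₘ A
  have key : ∀ u, ∀ᵐ ω ∂P, ∫⁻ x, a ((ω.1 u).1, x, ω.2 u) ∂pXV (ω.1 u).1 ≤ 1 := fun u => by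
    have hm : Measurable fun ω : (ℕ → V × X) × (ℕ → Y) => ((ω.1 u).1, ω.2 u) := by fun_prop
    refine ae_of_ae_map (p := fun p => ∫⁻ x, a (p.1, x, p.2) ∂pXV p.1 ≤ 1) hm.aemeasurable
      (h1 _ ?_)
    rw [Measure.fst, Measure.map_map measurable_fst hm]
    have : P.map (Prod.fst ∘ fun ω => ((ω.1 u).1, ω.2 u)) =
        ((P.fst.map (fun z => z u)).map Prod.fst) := by
      rw [Measure.map_map measurable_fst (measurable_pi_apply u), Measure.fst,
        Measure.map_map (by fun_prop) measurable_fst]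
      rfl
    rw [this, Measure.fst_compProd, Measure.infinitePi_map_eval]
    exact Measure.fst_compProd _ _
  calc _ ≤ ∫⁻ _, 1 ∂P := by
        refine lintegral_mono_ae ?_
        filter_upwards [ae_all_iff.2 key] with ω hω
        exact Finset.prod_le_one' fun u _ => hω u
    _ = 1 := by simp [P]

end

end

section

variable {X Y V : Type*} [MeasurableSpace X] [MeasurableSpace Y] [MeasurableSpace V]

/-! ### Threshold decoding -/

/-- The product of `a` over a block. -/
def likelihood {n : ℕ} (a : V × X × Y → ℝ≥0∞) (v : Fin n → V) (x : Fin n → X) (y : Fin n → Y) :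
    ℝ≥0∞ := ∏ i, a (v i, x i, y i)

/-- Some member of a decidable subset of `Fin M`, if there is one. -/
def select {M : ℕ} (hM : 0 < M) (P : Fin M → Prop) : Fin M :=
  open Classical in if h : ∃ j, P j then h.choose else ⟨0, hM⟩

lemma select_spec {M : ℕ} {hM : 0 < M} {P : Fin M → Prop} {m : Fin M} (h : select hM P ≠ m) :
    ¬ P m ∨ ∃ j, m ≠ j ∧ P j := by
  by_cases hm : P m
  · right
    have hex : ∃ j, P j := ⟨m, hm⟩
    refine ⟨select hM P, h.symm, ?_⟩
    simp only [select, dif_pos hex]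
    exact hex.choose_spec
  · exact Or.inl hm

/-- The decoder that returns a codeword whose likelihood is at least `c`. -/
def thresholdDecoder {M n : ℕ} (hM : 0 < M) (a : V × X × Y → ℝ≥0∞) (c : ℝ≥0∞)
    (z : (Fin n → V) × (Fin M → Fin n → X) × (Fin n → Y)) : Fin M :=
  select hM fun j => c ≤ likelihood a z.1 (z.2.1 j) z.2.2

lemma measurable_thresholdDecoder {M n : ℕ} (hM : 0 < M) {a : V × X × Y → ℝ≥0∞}
    (ha : Measurable a) (c : ℝ≥0∞) :
    Measurable (thresholdDecoder (n := n) hM a c) := by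
  have h : Measurable fun (z : (Fin n → V) × (Fin M → Fin n → X) × (Fin n → Y)) (j : Fin M) =>
      c ≤ likelihood a z.1 (z.2.1 j) z.2.2 := by
    refine measurable_pi_lambda _ fun j => ?_
    refine measurableSet_setOfPred.1 (measurableSet_le measurable_const ?_)
    unfold likelihood
    fun_prop
  -- The selection rule is an arbitrary choice, but its domain, the predicates on `Fin M`, is
  -- discrete.
  exact (Measurable.of_discrete (f := select hM)).comp h

lemma prod_block {M : Type*} [CommMonoid M] (n t : ℕ) (F : ℕ → M) :
    ∏ i : Fin n, F (t + i) = ∏ u ∈ Finset.Ico t (t + n), F u := by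
  rw [Finset.prod_Ico_eq_prod_range, Fin.prod_univ_eq_prod_range (fun i => F (t + i)) n]
  simp

variable (pV : Measure V) [IsProbabilityMeasure pV] (pXV : Kernel V X) [IsMarkovKernel pXV]

/-- The error probability of the threshold decoder is at most the probability that the transmitted
codeword has a small likelihood plus the union bound for the other codewords. -/
lemma condErrorProb_thresholdDecoder_le (A : Kernel (ℕ → V × X) (ℕ → Y)) [IsMarkovKernel A]
    {M n : ℕ} (hM : 0 < M) {a : V × X × Y → ℝ≥0∞} (ha : Measurable a)
    (h1 : ∀ ν : Measure (V × Y), ν.fst = pV → ∀ᵐ p ∂ν, ∫⁻ x, a (p.1, x, p.2) ∂pXV p.1 ≤ 1)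
    {c : ℝ≥0∞} (hc0 : c ≠ 0) (hc : c ≠ ⊤) (t : ℕ) (m : Fin M) :
    condErrorProb pV pXV A (thresholdDecoder (n := n) hM a c) t m ≤
      (Measure.infinitePi (fun _ : ℕ => pV ⊗ₘ pXV) ⊗ₘ A)
        {ω | ∏ u ∈ Finset.Ico t (t + n), a ((ω.1 u).1, (ω.1 u).2, ω.2 u) < c} + M * c⁻¹ := by
  set s := Finset.Ico t (t + n)
  set P := Measure.infinitePi (fun _ : ℕ => pV ⊗ₘ iidKernel pXV M) ⊗ₘ
    A.comap _ (measurable_row m)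
  have hlik : ∀ (j : Fin M) (ω : (ℕ → V × (Fin M → X)) × (ℕ → Y)),
      likelihood a (fun i : Fin n => (ω.1 (t + i)).1) (fun i => (ω.1 (t + i)).2 j)
        (fun i => ω.2 (t + i)) = ∏ u ∈ s, a ((ω.1 u).1, (ω.1 u).2 j, ω.2 u) := fun j ω =>
    prod_block n t fun u => a ((ω.1 u).1, (ω.1 u).2 j, ω.2 u)
  have hsub : {ω : (ℕ → V × (Fin M → X)) × (ℕ → Y) | thresholdDecoder hM a c
      (fun i : Fin n => (ω.1 (t + i)).1, fun j i => (ω.1 (t + i)).2 j, fun i => ω.2 (t + i)) ≠ m} ⊆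
      {ω | ∏ u ∈ s, a ((ω.1 u).1, (ω.1 u).2 m, ω.2 u) < c} ∪
        ⋃ j ∈ {j | m ≠ j}, {ω | c ≤ ∏ u ∈ s, a ((ω.1 u).1, (ω.1 u).2 j, ω.2 u)} := by
    intro ω hω
    rcases select_spec hω with h | ⟨j, hj, h⟩
    · left
      rw [not_le] at h
      rwa [hlik] at h
    · right
      rw [hlik] at h
      exact Set.mem_biUnion (show j ∈ {j | m ≠ j} from hj) h
  have hbad : P {ω | ∏ u ∈ s, a ((ω.1 u).1, (ω.1 u).2 m, ω.2 u) < c} =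
      (Measure.infinitePi (fun _ : ℕ => pV ⊗ₘ pXV) ⊗ₘ A)
        {ω | ∏ u ∈ s, a ((ω.1 u).1, (ω.1 u).2, ω.2 u) < c} := by
    have hS : MeasurableSet {ω : (ℕ → V × X) × (ℕ → Y) |
        ∏ u ∈ s, a ((ω.1 u).1, (ω.1 u).2, ω.2 u) < c} :=
      measurableSet_lt (by fun_prop) measurable_const
    have h := lintegral_row pV pXV A m (F := Set.indicator _ 1) (measurable_one.indicator hS)
    rw [lintegral_indicator_one hS] at h
    rw [← h, ← lintegral_indicator_one (measurableSet_lt (by fun_prop) measurable_const)]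
    rfl
  have hother : ∀ j, m ≠ j → P {ω | c ≤ ∏ u ∈ s, a ((ω.1 u).1, (ω.1 u).2 j, ω.2 u)} ≤ c⁻¹ := by
    intro j hj
    refine (meas_ge_le_lintegral_div (by fun_prop) hc0 hc).trans ?_
    rw [ENNReal.div_eq_inv_mul]
    exact mul_le_of_le_one_right' (lintegral_other_row_le pV pXV A hj ha h1 s)
  calc condErrorProb pV pXV A (thresholdDecoder (n := n) hM a c) t m
      ≤ P ({ω | ∏ u ∈ s, a ((ω.1 u).1, (ω.1 u).2 m, ω.2 u) < c} ∪
          ⋃ j ∈ {j | m ≠ j}, {ω | c ≤ ∏ u ∈ s, a ((ω.1 u).1, (ω.1 u).2 j, ω.2 u)}) :=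
        measure_mono hsub
    _ ≤ _ := by
        refine (measure_union_le _ _).trans (add_le_add hbad.le ?_)
        calc P (⋃ j ∈ {j | m ≠ j}, {ω | c ≤ ∏ u ∈ s, a ((ω.1 u).1, (ω.1 u).2 j, ω.2 u)})
            ≤ ∑ j : Fin M, P (⋃ (_ : j ∈ {j | m ≠ j}),
                {ω | c ≤ ∏ u ∈ s, a ((ω.1 u).1, (ω.1 u).2 j, ω.2 u)}) :=
              measure_iUnion_fintype_le _ _
          _ ≤ ∑ _j : Fin M, c⁻¹ := by
              refine Finset.sum_le_sum fun j _ => ?_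
              by_cases hj : m ≠ j
              · simpa [hj] using hother j hj
              · simp [hj]
          _ = M * c⁻¹ := by simp

lemma numMessages_pos (R : ℝ≥0) (n : ℕ) : 0 < numMessages R n :=
  Nat.ceil_pos.2 (by positivity)

/-- Rounding up at most doubles 2^(nR), so the union bound still decays exponentially. -/
lemma tendsto_numMessages_mul_exp {R : ℝ≥0} {r : ℝ} (hr : R * Real.log 2 < r) :
    Tendsto (fun n : ℕ => (numMessages R n : ℝ≥0∞) * (ENNReal.ofReal (Real.exp (n * r)))⁻¹)
      atTop (𝓝 0) := by
  have hb : ∀ n : ℕ, (numMessages R n : ℝ≥0∞) * (ENNReal.ofReal (Real.exp (n * r)))⁻¹ ≤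
      ENNReal.ofReal (2 * Real.exp (R * Real.log 2 - r) ^ n) := by
    intro n
    have h1 : (1 : ℝ) ≤ 2 ^ ((n : ℝ) * (R : ℝ)) := Real.one_le_rpow one_le_two (by positivity)
    have h2 : (numMessages R n : ℝ) ≤ 2 * 2 ^ ((n : ℝ) * (R : ℝ)) := by
      have := (Nat.ceil_lt_add_one (a := (2 : ℝ) ^ ((n : ℝ) * (R : ℝ))) (by positivity)).le
      unfold numMessages
      linarith
    rw [← ENNReal.ofReal_inv_of_pos (Real.exp_pos _), ← ENNReal.ofReal_natCast,
      ← ENNReal.ofReal_mul (by positivity)]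
    refine ENNReal.ofReal_le_ofReal ?_
    rw [← Real.exp_neg, ← Real.exp_nat_mul]
    calc (numMessages R n : ℝ) * Real.exp (-(n * r))
        ≤ 2 * 2 ^ ((n : ℝ) * (R : ℝ)) * Real.exp (-(n * r)) := by gcongr
      _ = 2 * Real.exp (n * (R * Real.log 2 - r)) := by
          rw [Real.rpow_def_of_pos two_pos, mul_assoc, ← Real.exp_add]
          ring_nf
  refine tendsto_of_tendsto_of_tendsto_of_le_of_le tendsto_const_nhds ?_ (fun _ => zero_le) hb
  have h := (tendsto_pow_atTop_nhds_zero_of_lt_one (Real.exp_pos _).le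
    (Real.exp_lt_one_iff.2 (sub_neg.2 hr))).const_mul 2
  rw [mul_zero] at h
  simpa using ENNReal.tendsto_ofReal h

/-- A rate is achievable if there is a likelihood `a` that is a sub-density with respect to the
source for every reproduction letter and that exceeds the rate along every attacked sequence. -/
theorem condAchievable_of_likelihood {d : X → Y → ℝ} {D : ℝ} {R : ℝ≥0} {r : ℝ}
    (hr : R * Real.log 2 < r) {a : V × X × Y → ℝ≥0∞} (ha : Measurable a)
    (h1 : ∀ ν : Measure (V × Y), ν.fst = pV → ∀ᵐ p ∂ν, ∫⁻ x, a (p.1, x, p.2) ∂pXV p.1 ≤ 1)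
    (h2 : ∀ f : ℕ → ℝ≥0∞, Tendsto f atTop (𝓝 0) → ∀ ε : ℝ≥0∞, 0 < ε →
      ∃ N : ℕ, ∀ n ≥ N, ∀ A : Kernel (ℕ → V × X) (ℕ → Y), IsMarkovKernel A →
        IsCondAttacker pV pXV d D f A → ∀ t : ℕ,
          (Measure.infinitePi (fun _ : ℕ => pV ⊗ₘ pXV) ⊗ₘ A)
            {ω | ∏ u ∈ Finset.Ico t (t + n), a ((ω.1 u).1, (ω.1 u).2, ω.2 u) <
              ENNReal.ofReal (Real.exp (n * r))} ≤ ε) :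
    CondAchievable pV pXV d D R := by
  refine ⟨fun n => thresholdDecoder (numMessages_pos R n) a (ENNReal.ofReal (Real.exp (n * r))),
    fun n => measurable_thresholdDecoder _ ha _, fun f hf ε hε => ?_⟩
  have hε2 : 0 < ε / 2 := ENNReal.half_pos hε.ne'
  obtain ⟨N₁, hN₁⟩ := h2 f hf (ε / 2) hε2
  obtain ⟨N₂, hN₂⟩ := eventually_atTop.1 ((tendsto_numMessages_mul_exp hr).eventually_le_const hε2)
  refine ⟨max N₁ N₂, fun n hn A hA hatt t m => ?_⟩
  refine (condErrorProb_thresholdDecoder_le pV pXV A (numMessages_pos R n) ha h1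
    (ENNReal.ofReal_pos.2 (Real.exp_pos _)).ne' ENNReal.ofReal_ne_top t m).trans ?_
  refine (add_le_add (hN₁ n (le_trans (le_max_left _ _) hn) A hA hatt t)
    (hN₂ n (le_trans (le_max_right _ _) hn))).trans (ENNReal.add_halves ε).le

end

/-! ### Block estimates and the achievability proof. -/

section

variable {X Y V : Type*} [MeasurableSpace X] [MeasurableSpace Y] [MeasurableSpace V]

/-! ### Sums over blocks of an iid sequence -/

section blocks

variable {Ω : Type*} [MeasurableSpace Ω] (μ : Measure Ω) [IsProbabilityMeasure μ] {ψ : Ω → ℝ}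

lemma identDistrib_eval (hψ : Measurable ψ) (i : ℕ) :
    IdentDistrib (fun ω : ℕ → Ω => ψ (ω i)) ψ (Measure.infinitePi fun _ => μ) μ := by
  refine ⟨(hψ.comp (measurable_pi_apply i)).aemeasurable, hψ.aemeasurable, ?_⟩
  rw [← Function.comp_def ψ, ← Measure.map_map hψ (measurable_pi_apply i),
    Measure.infinitePi_map_eval]

lemma iIndepFun_eval (hψ : Measurable ψ) :
    iIndepFun (fun (i : ℕ) (ω : ℕ → Ω) => ψ (ω i)) (Measure.infinitePi fun _ => μ) :=
  iIndepFun_infinitePi (P := fun _ : ℕ => μ) (X := fun _ => ψ) fun _ => hψ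

/-- The weak law of large numbers, uniformly over the position of the block. -/
lemma exists_forall_measure_sum_lt_le (hψ : Measurable ψ) (hψ2 : MemLp ψ 2 μ) {c : ℝ}
    (hc : c < ∫ ω, ψ ω ∂μ) {ε : ℝ≥0∞} (hε : 0 < ε) :
    ∃ N : ℕ, ∀ n ≥ N, ∀ t : ℕ, (Measure.infinitePi fun _ : ℕ => μ)
      {ω | ∑ u ∈ Finset.Ico t (t + n), ψ (ω u) < n * c} ≤ ε := by
  set δ := ∫ ω, ψ ω ∂μ - c with hδ
  have hδ0 : 0 < δ := sub_pos.2 hc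
  set P := Measure.infinitePi fun _ : ℕ => μ
  have hbound : ∀ n : ℕ, 0 < n → ∀ t : ℕ, P {ω | ∑ u ∈ Finset.Ico t (t + n), ψ (ω u) < n * c} ≤
      ENNReal.ofReal (variance ψ μ / δ ^ 2 * (1 / (n : ℝ))) := by
    intro n hn t
    have hn' : (0 : ℝ) < n := by exact_mod_cast hn
    have hLp : ∀ i, MemLp (fun ω : ℕ → Ω => ψ (ω i)) 2 P := fun i =>
      (identDistrib_eval μ hψ i).memLp_iff.2 hψ2
    set S : (ℕ → Ω) → ℝ := ∑ u ∈ Finset.Ico t (t + n), fun ω => ψ (ω u) with hS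
    have hSap : ∀ ω, S ω = ∑ u ∈ Finset.Ico t (t + n), ψ (ω u) := fun ω => by
      simp [hS, Finset.sum_apply]
    have hSLp : MemLp S 2 P := memLp_finsetSum' _ fun i _ => hLp i
    have hvar : variance S P = n * variance ψ μ := by
      rw [hS, IndepFun.variance_sum (fun i _ => hLp i)
        fun i _ j _ hij => (iIndepFun_eval μ hψ).indepFun hij]
      simp [(identDistrib_eval μ hψ _).variance_eq, P]
    have hmean : ∫ ω, S ω ∂P = n * ∫ ω, ψ ω ∂μ := by
      simp_rw [hSap]
      rw [integral_finsetSum _ fun i _ => (hLp i).integrable one_le_two]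
      simp [(identDistrib_eval μ hψ _).integral_eq, P]
    -- Chebyshev's inequality: the variance of a block sum does not depend on the block's position,
    -- which gives uniformity in t.
    have h := meas_ge_le_variance_div_sq hSLp (c := n * δ) (by positivity)
    refine (measure_mono ?_).trans (h.trans_eq ?_)
    · intro ω hω
      simp only [Set.mem_ofPred_eq] at hω ⊢
      rw [hmean, hSap]
      refine le_trans ?_ (neg_le_abs _)
      rw [hδ]
      nlinarith
    · rw [hvar]
      congr 1
      field_simp
  have hlim : Tendsto (fun n : ℕ => ENNReal.ofReal (variance ψ μ / δ ^ 2 * (1 / (n : ℝ))))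
      atTop (𝓝 0) := by
    have h := (tendsto_one_div_atTop_nhds_zero_nat (𝕜 := ℝ)).const_mul (variance ψ μ / δ ^ 2)
    rw [mul_zero] at h
    simpa using ENNReal.tendsto_ofReal h
  obtain ⟨N, hN⟩ := eventually_atTop.1 (hlim.eventually_le_const hε)
  exact ⟨max N 1, fun n hn t => (hbound n (lt_of_lt_of_le one_pos
    (le_trans (le_max_right _ _) hn)) t).trans (hN n (le_trans (le_max_left _ _) hn))⟩

/-- A nonconstant random walk exceeds its mean with a probability that does not vanish. -/
lemma not_tendsto_measure_mean_lt_sum (hψ : Measurable ψ) (hψ2 : MemLp ψ 2 μ)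
    (hvar : variance ψ μ ≠ 0) {f : ℕ → ℝ≥0∞} (hf : Tendsto f atTop (𝓝 0)) :
    ∃ N : ℕ, ∀ n ≥ N, f n < (Measure.infinitePi fun _ : ℕ => μ)
      {ω | n * ∫ ω, ψ ω ∂μ < ∑ u ∈ Finset.range n, ψ (ω u)} := by
  set P := Measure.infinitePi fun _ : ℕ => μ
  set v := (variance ψ μ).toNNReal with hv
  have hv0 : v ≠ 0 := by
    rw [hv, Ne, Real.toNNReal_eq_zero, not_le]
    exact lt_of_le_of_ne (variance_nonneg _ _) hvar.symm
  have hid := identDistrib_eval μ hψ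
  -- By the central limit theorem the limit inferior is at least the mass that a nondegenerate
  -- centred Gaussian gives to (0,∞), which is positive.
  have hclt := tendstoInDistribution_inv_sqrt_mul_sum_sub (P := P)
    (X := fun (i : ℕ) (ω : ℕ → Ω) => ψ (ω i)) (Y := id) (P' := gaussianReal 0 v)
    (by rw [(hid 0).variance_eq]; exact HasLaw.id) ((hid 0).memLp_iff.2 hψ2)
    (iIndepFun_eval μ hψ) (fun i => (hid i).trans (hid 0).symm)
  have hlim := ProbabilityMeasure.le_liminf_measure_open_of_tendsto hclt.tendsto
    (isOpen_Ioi (a := (0 : ℝ)))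
  have hpos : 0 < gaussianReal 0 v (Set.Ioi 0) := by
    rw [pos_iff_ne_zero]
    intro h
    have := gaussianReal_absolutelyContinuous' 0 hv0 h
    simp at this
  have hpos' : 0 < liminf (fun n : ℕ =>
      P {ω | n * ∫ ω, ψ ω ∂μ < ∑ u ∈ Finset.range n, ψ (ω u)}) atTop := by
    refine hpos.trans_le ?_
    simp only [ProbabilityMeasure.coe_mk, Measure.map_id] at hlim
    refine hlim.trans_eq ?_
    refine liminf_congr ?_
    filter_upwards [eventually_gt_atTop 0] with n hn
    have hn' : (0 : ℝ) < n := by exact_mod_cast hn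
    rw [Measure.map_apply (by fun_prop) measurableSet_Ioi]
    congr 1
    ext ω
    simp only [Set.mem_preimage, Set.mem_Ioi, Set.mem_ofPred_eq]
    rw [(hid 0).integral_eq, mul_pos_iff_of_pos_left (by positivity), sub_pos]
  obtain ⟨c, hc0, hc⟩ := exists_between hpos'
  obtain ⟨N, hN⟩ := eventually_atTop.1 ((eventually_lt_of_lt_liminf hc).and
    (hf.eventually_lt_const hc0))
  exact ⟨N, fun n hn => (hN n hn).2.trans (hN n hn).1⟩

end blocks

/-! ### From bounds on responses to achievability -/

section

variable (pV : Measure V) [IsProbabilityMeasure pV] (pXV : Kernel V X) [IsMarkovKernel pXV]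

/-- Converts bits to nats and leaves strict room above the rate; the later approximations spend that
room. -/
lemma exists_rate_between [StandardBorelSpace X] {d : X → Y → ℝ} {D : ℝ} {R : ℝ≥0}
    (hR : (R : ℝ≥0∞) < condRateDistortion pV pXV d D) :
    ∃ r : ℝ, R * Real.log 2 < r ∧ ∀ (W : Kernel (V × X) Y) (Q : Kernel V Y), IsMarkovKernel W →
      IsMarkovKernel Q → meanCost pV pXV d W ≤ ENNReal.ofReal D →
        ENNReal.ofReal r ≤ channelDiv pV pXV W Q := by
  obtain ⟨q, hRq, hq⟩ := ENNReal.lt_iff_exists_nnreal_btwn.1 hR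
  have hlog : 0 < Real.log 2 := Real.log_pos one_lt_two
  refine ⟨q * Real.log 2, ?_, fun W Q hW hQ hcost => ?_⟩
  · exact mul_lt_mul_of_pos_right (by exact_mod_cast hRq) hlog
  · have h : (q : ℝ≥0∞) ≤ condMutualInfo pV (pXV ⊗ₖ W) :=
      hq.le.trans ((iInf_le _ W).trans ((iInf_le _ hW).trans (iInf_le _ hcost)))
    rw [condMutualInfo, ENNReal.le_div_iff_mul_le (Or.inl (ENNReal.ofReal_pos.2 hlog).ne')
      (Or.inl ENNReal.ofReal_ne_top)] at h
    rw [ENNReal.ofReal_mul q.coe_nonneg, ENNReal.ofReal_coe_nnreal]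
    exact h.trans (klDiv_condMutualInfo_le_channelDiv pV pXV W Q)

/-- If every response to `K` has a large mean negative logarithm, and `K` is not too small along
sequences of small distortion, then small rates are achievable. -/
theorem condAchievable_of_responses [StandardBorelSpace Y] [Nonempty Y] {d : X → Y → ℝ} {D : ℝ}
    {R : ℝ≥0} {K : X → Y → ℝ≥0∞} (hK : Measurable (Function.uncurry K)) (hK1 : ∀ x y, K x y ≤ 1)
    {G : X → Prop} (hG : ∀ᵐ z ∂(pV ⊗ₘ pXV), G z.2) {A b : ℝ} (hA : R * Real.log 2 + b < A)
    (hresp : ∀ g ∈ responses V K, ENNReal.ofReal A ≤ ∫⁻ z, negLog (g z) ∂(pV ⊗ₘ pXV))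
    (hKd : ∀ (s : Finset ℕ) (x : ℕ → X) (y : ℕ → Y), (∀ u, G (x u)) →
      ∑ u ∈ s, d (x u) (y u) ≤ s.card * D →
        ENNReal.ofReal (Real.exp (-(s.card * b))) ≤ ∏ u ∈ s, K (x u) (y u)) :
    CondAchievable pV pXV d D R := by
  -- Three losses are budgeted: A to A₁ for the shift by c, A₁ to A₂ for the multiplier, A₂ to A₃
  -- for the law of large numbers. The threshold exponent A₃ - b still exceeds R log 2.
  obtain ⟨A₁, hA₁, hA₁'⟩ := exists_between hA
  obtain ⟨A₂, hA₂, hA₂'⟩ := exists_between hA₁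
  obtain ⟨A₃, hA₃, hA₃'⟩ := exists_between hA₂
  obtain ⟨c, hc, hc1, hlog⟩ :=
    (isMixtureClosed_responses hK hK1).exists_forall_le_integral_log hA₁' hresp
  obtain ⟨α, hαm, ⟨lo, hi, hlo, hα⟩, hαint, hαone⟩ :=
    exists_multiplier pV pXV hK hK1 hc hc1 (sub_pos.2 hA₂') hlog
  rw [sub_sub_cancel] at hαint
  have hαpos : ∀ z, 0 < α z := fun z => hlo.trans_le (hα z).1
  have hψ2 : MemLp (fun z => Real.log (α z)) 2 (pV ⊗ₘ pXV) :=
    MemLp.of_bound hαm.log.aestronglyMeasurable (max |Real.log lo| |Real.log hi|)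
      (ae_of_all _ fun z => by
        rw [Real.norm_eq_abs]
        exact abs_le_max_abs_abs (Real.log_le_log hlo (hα z).1)
          (Real.log_le_log (hαpos z) (hα z).2))
  refine condAchievable_of_likelihood pV pXV (r := A₃ - b) (by linarith)
    (a := fun z => ENNReal.ofReal (α (z.1, z.2.1)) * K z.2.1 z.2.2) ?_ hαone ?_
  · exact (by fun_prop : Measurable fun z : V × X × Y => ENNReal.ofReal (α (z.1, z.2.1))).mul
      (hK.comp measurable_snd)
  intro f hf ε hε
  have hε2 : 0 < ε / 2 := ENNReal.half_pos hε.ne'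
  obtain ⟨N₁, hN₁⟩ := exists_forall_measure_sum_lt_le (pV ⊗ₘ pXV) hαm.log hψ2
    (hA₃'.trans_le hαint) hε2
  obtain ⟨N₂, hN₂⟩ := eventually_atTop.1 (hf.eventually_le_const hε2)
  refine ⟨max (max N₁ N₂) 1, fun n hn B hB hatt t => ?_⟩
  have hn1 : 0 < n := lt_of_lt_of_le one_pos (le_trans (le_max_right _ _) hn)
  have hnN₁ : N₁ ≤ n := ((le_max_left _ _).trans (le_max_left _ _)).trans hn
  have hnN₂ : N₂ ≤ n := ((le_max_right _ _).trans (le_max_left _ _)).trans hn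
  set μ := Measure.infinitePi fun _ : ℕ => pV ⊗ₘ pXV
  have hGall : ∀ᵐ ω ∂(μ ⊗ₘ B), ∀ u, G (ω.1 u).2 := by
    refine ae_all_iff.2 fun u => ?_
    have h : (μ ⊗ₘ B).map (fun ω => ω.1 u) = pV ⊗ₘ pXV := by
      have hfst : (μ ⊗ₘ B).map Prod.fst = μ := Measure.fst_compProd _ _
      rw [← Measure.infinitePi_map_eval (fun _ : ℕ => pV ⊗ₘ pXV) u]
      change _ = μ.map _
      rw [← hfst, Measure.map_map (measurable_pi_apply u) measurable_fst, hfst]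
      rfl
    refine ae_of_ae_map (f := fun ω : (ℕ → V × X) × (ℕ → Y) => ω.1 u) (p := fun z => G z.2)
      (by fun_prop) ?_
    rwa [h]
  set s := Finset.Ico t (t + n) with hs
  have hcard : s.card = n := by simp [hs]
  -- If the sum of log α and the distortion are both good, the product of the two lower bounds
  -- reaches the threshold. This holds pathwise, with no assumption on how the output was produced.
  have hsub : ∀ᵐ ω ∂(μ ⊗ₘ B), ω ∈ {ω : (ℕ → V × X) × (ℕ → Y) | ∏ u ∈ s,
        (ENNReal.ofReal (α ((ω.1 u).1, (ω.1 u).2)) * K (ω.1 u).2 (ω.2 u)) <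
          ENNReal.ofReal (Real.exp (n * (A₃ - b)))} →
      ω ∈ (Prod.fst ⁻¹' {ω : ℕ → V × X | ∑ u ∈ s, Real.log (α (ω u)) < n * A₃}) ∪
        {ω : (ℕ → V × X) × (ℕ → Y) |
          D < (1 / (n : ℝ)) * ∑ u ∈ Finset.range n, d (ω.1 (t + u)).2 (ω.2 (t + u))} := by
    filter_upwards [hGall] with ω hω hlt
    by_contra hcon
    simp only [Set.mem_union, Set.mem_preimage, Set.mem_ofPred_eq, not_or, not_lt] at hcon hlt
    obtain ⟨hlow, hdist⟩ := hcon
    have hn' : (0 : ℝ) < n := by exact_mod_cast hn1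
    have hsum : ∑ u ∈ s, d (ω.1 u).2 (ω.2 u) ≤ s.card * D := by
      rw [hcard, hs, Finset.sum_Ico_eq_sum_range, add_tsub_cancel_left]
      rw [one_div, inv_mul_le_iff₀ hn'] at hdist
      exact hdist
    have hKs := hKd s (fun u => (ω.1 u).2) ω.2 hω hsum
    rw [hcard] at hKs
    refine absurd hlt (not_lt.2 ?_)
    rw [Finset.prod_mul_distrib, ← ENNReal.ofReal_prod_of_nonneg fun u _ => (hαpos _).le]
    calc ENNReal.ofReal (Real.exp (n * (A₃ - b)))
        = ENNReal.ofReal (Real.exp (n * A₃)) * ENNReal.ofReal (Real.exp (-(n * b))) := by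
          rw [← ENNReal.ofReal_mul (Real.exp_pos _).le, ← Real.exp_add]
          ring_nf
      _ ≤ _ := by
          refine mul_le_mul' (ENNReal.ofReal_le_ofReal ?_) hKs
          calc Real.exp (n * A₃) ≤ Real.exp (∑ u ∈ s, Real.log (α (ω.1 u))) :=
                Real.exp_le_exp.2 hlow
            _ = ∏ u ∈ s, α (ω.1 u) := by
                rw [Real.exp_sum]
                exact Finset.prod_congr rfl fun u _ => Real.exp_log (hαpos _)
  refine (measure_mono_ae hsub).trans ((measure_union_le _ _).trans ?_)
  refine (add_le_add ?_ ((hatt n hn1 t).trans (hN₂ n hnN₂))).trans (ENNReal.add_halves ε).le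
  have hmeas : MeasurableSet {ω : ℕ → V × X | ∑ u ∈ s, Real.log (α (ω u)) < n * A₃} :=
    measurableSet_lt (by fun_prop) measurable_const
  rw [← Measure.map_apply measurable_fst hmeas]
  change (μ ⊗ₘ B).fst _ ≤ _
  rw [Measure.fst_compProd]
  exact hN₁ n hnN₁ t

/-- Achievability when `D` is not the minimal expected distortion. -/
theorem condAchievable_of_ne_min [StandardBorelSpace X] [StandardBorelSpace Y] {d : X → Y → ℝ}
    (hd : Measurable (Function.uncurry d)) (hd0 : ∀ x y, 0 ≤ d x y) {y : ℕ → Y}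
    (hy : ∀ x, ⨅ y', ENNReal.ofReal (d x y') = ⨅ j, ENNReal.ofReal (d x (y j))) {D : ℝ}
    (hD : 0 ≤ D)
    (hne : ∫⁻ z, ⨅ y', ENNReal.ofReal (d z.2 y') ∂(pV ⊗ₘ pXV) ≠ ENNReal.ofReal D) {R : ℝ≥0}
    (hR : (R : ℝ≥0∞) < condRateDistortion pV pXV d D) : CondAchievable pV pXV d D R := by
  have : Nonempty Y := ⟨y 0⟩
  obtain ⟨r, hRr, hr⟩ := exists_rate_between pV pXV hR
  obtain ⟨r', hr', hrr⟩ := exists_between hRr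
  obtain ⟨l, hl, hresp⟩ := exists_slope pV pXV hd hd0 hy hD hrr hne hr
  refine condAchievable_of_responses pV pXV (measurable_expKernel hd l)
    (fun x y => expKernel_le_one hd0 hl x y) (G := fun _ => True) (ae_of_all _ fun _ => trivial)
    (b := l * D) (by linarith) hresp fun s x y _ hs => ?_
  simp only [expKernel]
  rw [← ENNReal.ofReal_prod_of_nonneg fun u _ => (Real.exp_pos _).le, ← Real.exp_sum,
    Finset.sum_neg_distrib, ← Finset.mul_sum]
  refine ENNReal.ofReal_le_ofReal (Real.exp_le_exp.2 (neg_le_neg ?_))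
  nlinarith [mul_le_mul_of_nonneg_left hs hl]

/-- Achievability when almost every source letter has minimal distortion `D`. -/
theorem condAchievable_of_min_eq [StandardBorelSpace X] [StandardBorelSpace Y] [Nonempty Y]
    {d : X → Y → ℝ} (hd : Measurable (Function.uncurry d)) {D : ℝ}
    (hmin : ∀ᵐ z ∂(pV ⊗ₘ pXV), ∀ y, D ≤ d z.2 y) {R : ℝ≥0}
    (hR : (R : ℝ≥0∞) < condRateDistortion pV pXV d D) : CondAchievable pV pXV d D R := by
  classical
  obtain ⟨r, hRr, hr⟩ := exists_rate_between pV pXV hR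
  set K : X → Y → ℝ≥0∞ := fun x y => if d x y ≤ D then 1 else 0 with hKdef
  have hK : Measurable (Function.uncurry K) :=
    Measurable.ite (measurableSet_le hd measurable_const) measurable_const measurable_const
  have hK1 : ∀ x y, K x y ≤ 1 := fun x y => by
    simp only [hKdef]
    split_ifs <;> simp
  refine condAchievable_of_responses pV pXV hK hK1 (G := fun x => ∀ y, D ≤ d x y) hmin
    (A := r) (b := 0) (by linarith) ?_ fun s x y hx hs => ?_
  · rintro _ ⟨Q, hQ, rfl⟩
    by_contra hcon
    push Not at hcon
    obtain ⟨W, hW, hWle⟩ := exists_channelDiv_add_le pV pXV Q hK hK1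
      (hcon.trans ENNReal.ofReal_lt_top).ne
    have hlt := hWle.trans_lt hcon
    -- A finite mean of -log K, where K takes only the values 0 and 1, forces d ≤ D almost surely
    -- under W. So W is admissible, contradicting the lower bound r on its divergence.
    have hfin : ∫⁻ z, negLog (K z.2.1 z.2.2) ∂(pV ⊗ₘ (pXV ⊗ₖ W)) ≠ ⊤ :=
      ((le_add_self.trans_lt hlt).trans ENNReal.ofReal_lt_top).ne
    have hle : ∀ᵐ z ∂(pV ⊗ₘ (pXV ⊗ₖ W)), d z.2.1 z.2.2 ≤ D := by
      filter_upwards [ae_lt_top (measurable_negLog.comp (hK.comp measurable_snd)) hfin] with z hz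
      by_contra hd'
      have : K z.2.1 z.2.2 = 0 := if_neg hd'
      simp [Function.uncurry, this] at hz
    refine absurd (hr W Q hW hQ ?_) (not_le.2 (le_self_add.trans_lt hlt))
    calc meanCost pV pXV d W ≤ ∫⁻ _, ENNReal.ofReal D ∂(pV ⊗ₘ (pXV ⊗ₖ W)) := by
          refine lintegral_mono_ae ?_
          filter_upwards [hle] with z hz
          exact ENNReal.ofReal_le_ofReal hz
      _ = ENNReal.ofReal D := by simp
  -- No letter can have distortion below D, so an average of at most D forces equality at every
  -- time, and K equals 1 along the whole block.
  · have hD : ∀ u ∈ s, d (x u) (y u) = D := by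
      have hsum : ∑ u ∈ s, D = ∑ u ∈ s, d (x u) (y u) :=
        le_antisymm (Finset.sum_le_sum fun u _ => hx u (y u)) (by simpa using hs)
      intro u hu
      exact ((Finset.sum_eq_sum_iff_of_le fun u _ => hx u (y u)).1 hsum u hu).symm
    have : ∏ u ∈ s, K (x u) (y u) = 1 :=
      Finset.prod_eq_one fun u hu => if_pos (hD u hu).le
    simp [this]

/-- Achievability at the minimal expected distortion. -/
theorem condAchievable_of_eq_min [StandardBorelSpace X] [StandardBorelSpace Y] {d : X → Y → ℝ}
    (hd : Measurable (Function.uncurry d)) (hd0 : ∀ x y, 0 ≤ d x y) {y : ℕ → Y}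
    (hy : ∀ x, ⨅ y', ENNReal.ofReal (d x y') = ⨅ j, ENNReal.ofReal (d x (y j))) {D : ℝ}
    (hD : 0 ≤ D) {B : ℝ} (hB : ∀ᵐ z ∂(pV ⊗ₘ pXV), ∃ y, d z.2 y ≤ B)
    (heq : ∫⁻ z, ⨅ y', ENNReal.ofReal (d z.2 y') ∂(pV ⊗ₘ pXV) = ENNReal.ofReal D) {R : ℝ≥0}
    (hR : (R : ℝ≥0∞) < condRateDistortion pV pXV d D) : CondAchievable pV pXV d D R := by
  have : Nonempty Y := ⟨y 0⟩
  set q : V × X → ℝ≥0∞ := fun z => ⨅ y', ENNReal.ofReal (d z.2 y') with hq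
  have hqm : Measurable q := by
    simp only [hq, hy]
    refine Measurable.iInf fun j => ENNReal.measurable_ofReal.comp ?_
    exact hd.comp (by fun_prop : Measurable fun z : V × X => (z.2, y j))
  have hqtop : ∀ z, q z ≠ ⊤ := fun z =>
    ((iInf_le _ (y 0)).trans_lt ENNReal.ofReal_lt_top).ne
  set ψ : V × X → ℝ := fun z => (q z).toReal with hψdef
  have hψm : Measurable ψ := hqm.ennreal_toReal
  have hψd : ∀ z y', ψ z ≤ d z.2 y' := fun z y' =>
    ENNReal.toReal_le_of_le_ofReal (hd0 _ _) (iInf_le _ y')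
  have hψ2 : MemLp ψ 2 (pV ⊗ₘ pXV) := by
    refine MemLp.of_bound hψm.aestronglyMeasurable B ?_
    filter_upwards [hB] with z ⟨y', hy'⟩
    rw [Real.norm_eq_abs, abs_of_nonneg ENNReal.toReal_nonneg]
    exact (hψd z y').trans hy'
  have hmean : ∫ z, ψ z ∂(pV ⊗ₘ pXV) = D := by
    rw [integral_toReal hqm.aemeasurable (ae_of_all _ fun z => (hqtop z).lt_top), heq,
      ENNReal.toReal_ofReal hD]
  -- ψ(x) = inf_y d(x,y) is a lower bound on distortion that no attacker can beat, and its mean is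
  -- exactly D.
  by_cases hvar : variance ψ (pV ⊗ₘ pXV) = 0
  · have hconst := ae_eq_integral_of_variance_eq_zero hψ2 hvar
    refine condAchievable_of_min_eq pV pXV hd ?_ hR
    filter_upwards [hconst] with z hz y'
    rw [← hmean, ← hz]
    exact hψd z y'
  -- For large n the sum of ψ over the first n times exceeds nD with probability larger than f(n),
  -- so no attacker with decay f exists. Any decoder serves, here the one with zero likelihood.
  · refine condAchievable_of_likelihood pV pXV (r := R * Real.log 2 + 1) (by linarith)
      (a := fun _ => 0) measurable_const (by simp) fun f hf ε hε => ?_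
    obtain ⟨N, hN⟩ := not_tendsto_measure_mean_lt_sum (pV ⊗ₘ pXV) hψm hψ2 hvar hf
    refine ⟨max N 1, fun n hn A hA hatt => absurd (hN n (le_trans (le_max_left _ _) hn))
      (not_lt.2 ?_)⟩
    have hn1 : 0 < n := lt_of_lt_of_le one_pos (le_trans (le_max_right _ _) hn)
    have hn' : (0 : ℝ) < n := by exact_mod_cast hn1
    refine le_trans ?_ (hatt n hn1 0)
    have hmeas : MeasurableSet {ω : ℕ → V × X |
        n * ∫ z, ψ z ∂(pV ⊗ₘ pXV) < ∑ u ∈ Finset.range n, ψ (ω u)} :=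
      measurableSet_lt measurable_const (by fun_prop)
    have hfst := Measure.fst_compProd (Measure.infinitePi fun _ : ℕ => pV ⊗ₘ pXV) A
    refine (DFunLike.congr_fun hfst.symm _).le.trans ?_
    rw [Measure.fst, Measure.map_apply measurable_fst hmeas]
    refine measure_mono fun ω hω => ?_
    simp only [Set.mem_preimage, Set.mem_ofPred_eq, hmean, zero_add] at hω ⊢
    rw [one_div, lt_inv_mul_iff₀ hn']
    exact hω.trans_le (Finset.sum_le_sum fun u _ => hψd _ _)

/-- **Achievability for general alphabets.** -/
theorem condAchievable_of_nondegenerate [StandardBorelSpace X] [StandardBorelSpace Y]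
    {d : X → Y → ℝ} (hd : Measurable (Function.uncurry d)) (hd0 : ∀ x y, 0 ≤ d x y) {y : ℕ → Y}
    (hy : ∀ x, ⨅ y', ENNReal.ofReal (d x y') = ⨅ j, ENNReal.ofReal (d x (y j))) {D : ℝ}
    (hD : 0 ≤ D) (hN : Nondegenerate (pV ⊗ₘ pXV).snd d D) {R : ℝ≥0}
    (hR : (R : ℝ≥0∞) < condRateDistortion pV pXV d D) : CondAchievable pV pXV d D R := by
  by_cases hne : ∫⁻ z, ⨅ y', ENNReal.ofReal (d z.2 y') ∂(pV ⊗ₘ pXV) = ENNReal.ofReal D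
  · rcases hN with ⟨B, hB⟩ | h
    · exact condAchievable_of_eq_min pV pXV hd hd0 hy hD
        (ae_of_ae_map measurable_snd.aemeasurable hB) hne hR
    · refine absurd ?_ h
      rw [← hne, Measure.snd, lintegral_map _ measurable_snd]
      simp only [hy]
      refine Measurable.iInf fun j => ENNReal.measurable_ofReal.comp ?_
      exact hd.comp (by fun_prop : Measurable fun x : X => (x, y j))
  · exact condAchievable_of_ne_min pV pXV hd hd0 hy hD hne hR

/-- Without reproduction letters there are no attackers. -/
lemma condAchievable_of_isEmpty [IsEmpty Y] (d : X → Y → ℝ) (D : ℝ) (R : ℝ≥0) :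
    CondAchievable pV pXV d D R := by
  refine ⟨fun n _ => ⟨0, numMessages_pos R n⟩, fun n => measurable_const,
    fun f _ ε _ => ⟨0, fun n _ A hA _ => ?_⟩⟩
  obtain ⟨ω⟩ := nonempty_of_isProbabilityMeasure (Measure.infinitePi fun _ : ℕ => pV ⊗ₘ pXV)
  obtain ⟨y⟩ := nonempty_of_isProbabilityMeasure (A ω)
  exact isEmptyElim (y 0)

end

end

section

variable {X Y V : Type*} [MeasurableSpace X] [MeasurableSpace Y] [MeasurableSpace V]

/-! ### Removing the side information -/

lemma dirac_unit_compProd {S : Type*} [MeasurableSpace S] (κ : Kernel Unit S) [IsMarkovKernel κ] :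
    Measure.dirac () ⊗ₘ κ = (κ ()).map (Prod.mk ()) := by
  refine Measure.ext_of_lintegral _ fun f hf => ?_
  rw [Measure.lintegral_compProd hf, lintegral_map hf measurable_prodMk_left, lintegral_dirac]

/-- A one-point V carries no information. Dropping the trivial coordinate is a measurable map, so
data processing gives the inequality, the only direction needed. -/
lemma rateDistortion_le_condRateDistortion (p : Measure X) [IsProbabilityMeasure p]
    {d : X → Y → ℝ} (hd : Measurable (Function.uncurry d)) (D : ℝ) :
    rateDistortion p d D ≤ condRateDistortion (Measure.dirac ()) (Kernel.const Unit p) d D := by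
  refine le_iInf fun W => le_iInf fun hW => le_iInf fun hcost => ?_
  set W' : Kernel X Y := W.comap (Prod.mk ()) measurable_prodMk_left
  set κ := Kernel.const Unit p ⊗ₖ W
  have hκ : κ () = p ⊗ₘ W' := by
    refine Measure.ext_of_lintegral _ fun f hf => ?_
    rw [Kernel.lintegral_compProd _ _ _ hf, Measure.lintegral_compProd hf]
    rfl
  have hW' : IsMarkovKernel W' := inferInstance
  refine (iInf_le _ W').trans ((iInf_le _ hW').trans ((iInf_le _ ?_).trans ?_))
  · rw [dirac_unit_compProd, lintegral_map (by fun_prop) measurable_prodMk_left, hκ] at hcost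
    exact hcost
  · unfold mutualInfo condMutualInfo
    gcongr
    rw [dirac_unit_compProd, dirac_unit_compProd, Kernel.prod_apply, Kernel.fst_apply,
      Kernel.snd_apply, hκ]
    have hsnd : Measurable (Prod.snd : Unit × X × Y → X × Y) := measurable_snd
    have h := klDiv_map_le ((p ⊗ₘ W').map (Prod.mk ()))
      ((((p ⊗ₘ W').map Prod.fst).prod ((p ⊗ₘ W').map Prod.snd)).map (Prod.mk ())) hsnd
    rw [Measure.map_map hsnd measurable_prodMk_left,
      Measure.map_map hsnd measurable_prodMk_left] at h
    simpa [Function.comp_def, Measure.fst, Measure.snd] using h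

lemma map_compProd_comap {S T U : Type*} [MeasurableSpace S] [MeasurableSpace T]
    [MeasurableSpace U] (μ : Measure S) [SFinite μ] (A : Kernel T U) [IsMarkovKernel A] {φ : S → T}
    (hφ : Measurable φ) :
    (μ ⊗ₘ A.comap φ hφ).map (Prod.map φ id) = μ.map φ ⊗ₘ A := by
  refine Measure.ext_of_lintegral _ fun f hf => ?_
  rw [lintegral_map hf (by fun_prop), Measure.lintegral_compProd (by fun_prop),
    Measure.lintegral_compProd hf, lintegral_map (Measurable.lintegral_kernel_prod_right' hf) hφ]
  rfl

/-- The attacker and the decoder are fed a constant side sequence. Both the error event and the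
distortion event are transferred as preimages, in the direction that holds for sets not known to be
measurable. -/
lemma achievable_of_condAchievable (p : Measure X) [IsProbabilityMeasure p] {d : X → Y → ℝ}
    {D : ℝ} {R : ℝ≥0}
    (h : CondAchievable (Measure.dirac ()) (Kernel.const Unit p) d D R) : Achievable p d D R := by
  obtain ⟨dec, hdec, hach⟩ := h
  refine ⟨fun n z => dec n (fun _ => (), z), fun n => (hdec n).comp measurable_prodMk_left,
    fun f hf ε hε => ?_⟩
  obtain ⟨N, hN⟩ := hach f hf ε hε
  refine ⟨N, fun n hn A hA hatt t m => ?_⟩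
  have hφ : Measurable fun (S : ℕ → Unit × X) (u : ℕ) => (S u).2 := by fun_prop
  have hmap : (Measure.infinitePi fun _ : ℕ => Measure.dirac () ⊗ₘ Kernel.const Unit p).map
      (fun S u => (S u).2) = Measure.infinitePi fun _ => p := by
    rw [Measure.infinitePi_map_pi (f := fun (_ : ℕ) (z : Unit × X) => z.2)
      (μ := fun _ => Measure.dirac () ⊗ₘ Kernel.const Unit p) (fun _ => measurable_snd), dirac_unit_compProd, Measure.map_map measurable_snd
      measurable_prodMk_left]
    simp [Function.comp_def]
  refine le_trans ?_ (hN n hn (A.comap _ hφ) inferInstance (fun k hk s => ?_) t m)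
  · have hι : Measurable fun (T : ℕ → Fin (numMessages R n) → X) (u : ℕ) => ((), T u) := by
      fun_prop
    have hmap' : (Measure.infinitePi fun _ : ℕ => Measure.pi fun _ : Fin (numMessages R n) =>
        p).map (fun T u => ((), T u)) = Measure.infinitePi fun _ =>
          Measure.dirac () ⊗ₘ iidKernel (Kernel.const Unit p) (numMessages R n) := by
      rw [Measure.infinitePi_map_pi (f := fun (_ : ℕ) (x : Fin (numMessages R n) → X) => ((), x))
        (μ := fun _ => Measure.pi fun _ => p) (fun _ => measurable_prodMk_left),
        dirac_unit_compProd]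
      rfl
    have := map_compProd_comap (Measure.infinitePi fun _ : ℕ => Measure.pi
      fun _ : Fin (numMessages R n) => p) ((A.comap _ hφ).comap _ (measurable_row m)) hι
    rw [condErrorProb, ← hmap', ← this]
    exact Measure.le_map_apply (by fun_prop) _
  · refine le_trans ?_ (hatt k hk s)
    have := map_compProd_comap
      (Measure.infinitePi fun _ : ℕ => Measure.dirac () ⊗ₘ Kernel.const Unit p) A hφ
    rw [← hmap, ← this]
    exact Measure.le_map_apply (by fun_prop) _

end

section

variable {X Y V : Type*} [MeasurableSpace X] [MeasurableSpace Y] [MeasurableSpace V]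

/-! ### Euclidean and finite alphabets -/

/-- Countably many reproduction letters suffice for the infimum. This gives its measurability and
the countable mixture in the Slater construction. -/
lemma iInf_eq_iInf_denseSeq {T : Type*} [TopologicalSpace T] [TopologicalSpace.SeparableSpace T]
    [Nonempty T] {g : T → ℝ≥0∞} (hg : Continuous g) :
    ⨅ y, g y = ⨅ j, g (TopologicalSpace.denseSeq T j) := by
  refine le_antisymm (le_iInf fun j => iInf_le _ _) (le_iInf fun y => ?_)
  refine (TopologicalSpace.denseRange_denseSeq T).induction_on
    (p := fun y => ⨅ j, g (TopologicalSpace.denseSeq T j) ≤ g y) y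
    (isClosed_le continuous_const hg) fun j => iInf_le _ j

variable (pV : Measure V) [IsProbabilityMeasure pV]

theorem condAchievable_euclidean {k : ℕ} {𝒳 𝒴 : Set (EuclideanSpace ℝ (Fin k))}
    (h𝒳 : MeasurableSet 𝒳) (h𝒴 : MeasurableSet 𝒴) {ρ : EuclideanSpace ℝ (Fin k) → ℝ}
    (hρ0 : ∀ z, 0 ≤ ρ z) (hρ : Continuous ρ) (pXV : Kernel V 𝒳) [IsMarkovKernel pXV] {D : ℝ}
    (hD : 0 ≤ D)
    (hN : Nondegenerate (pV ⊗ₘ pXV).snd (fun (x : 𝒳) (y : 𝒴) => ρ (x - y)) D) {R : ℝ≥0}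
    (hR : (R : ℝ≥0∞) < condRateDistortion pV pXV (fun (x : 𝒳) (y : 𝒴) => ρ (x - y)) D) :
    CondAchievable pV pXV (fun (x : 𝒳) (y : 𝒴) => ρ (x - y)) D R := by
  have := h𝒳.standardBorel
  have := h𝒴.standardBorel
  rcases isEmpty_or_nonempty 𝒴 with hY | hY
  · exact condAchievable_of_isEmpty pV pXV _ D R
  · have hc : Continuous (Function.uncurry fun (x : 𝒳) (y : 𝒴) => ρ (x - y)) := by
      simp only [Function.uncurry_def]
      fun_prop
    exact condAchievable_of_nondegenerate pV pXV hc.measurable (fun x y => hρ0 _)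
      (fun x => iInf_eq_iInf_denseSeq (ENNReal.continuous_ofReal.comp
        (hc.comp (Continuous.prodMk_right x)))) hD hN hR

/-- Over a finite source the distortion to one fixed letter is bounded, so the first nondegeneracy
alternative is automatic. A surjection from ℕ plays the part of the dense sequence. -/
theorem condAchievable_finite [Finite X] [MeasurableSingletonClass X] [Finite Y]
    [MeasurableSingletonClass Y] {d : X → Y → ℝ} (hd0 : ∀ x y, 0 ≤ d x y) (pXV : Kernel V X)
    [IsMarkovKernel pXV] {D : ℝ} (hD : 0 ≤ D) {R : ℝ≥0}
    (hR : (R : ℝ≥0∞) < condRateDistortion pV pXV d D) : CondAchievable pV pXV d D R := by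
  rcases isEmpty_or_nonempty Y with hY | ⟨⟨y₀⟩⟩
  · exact condAchievable_of_isEmpty pV pXV _ D R
  · have : Nonempty Y := ⟨y₀⟩
    obtain ⟨y, hy⟩ := exists_surjective_nat Y
    obtain ⟨B, hB⟩ := (Set.finite_range fun x => d x y₀).bddAbove
    exact condAchievable_of_nondegenerate pV pXV (Measurable.of_discrete) hd0
      (y := y) (fun x => (hy.iInf_comp fun y' => ENNReal.ofReal (d x y')).symm) hD
      (Or.inl ⟨B, ae_of_all _ fun x => ⟨y₀, hB ⟨x, rfl⟩⟩⟩) hR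

theorem achievable_euclidean {k : ℕ} {𝒳 𝒴 : Set (EuclideanSpace ℝ (Fin k))}
    (h𝒳 : MeasurableSet 𝒳) (h𝒴 : MeasurableSet 𝒴) {ρ : EuclideanSpace ℝ (Fin k) → ℝ}
    (hρ0 : ∀ z, 0 ≤ ρ z) (hρ : Continuous ρ) (p : Measure 𝒳) [IsProbabilityMeasure p] {D : ℝ}
    (hD : 0 ≤ D) (hN : Nondegenerate p (fun (x : 𝒳) (y : 𝒴) => ρ (x - y)) D) {R : ℝ≥0}
    (hR : (R : ℝ≥0∞) < rateDistortion p (fun (x : 𝒳) (y : 𝒴) => ρ (x - y)) D) :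
    Achievable p (fun (x : 𝒳) (y : 𝒴) => ρ (x - y)) D R := by
  have hc : Continuous (Function.uncurry fun (x : 𝒳) (y : 𝒴) => ρ (x - y)) := by
    simp only [Function.uncurry_def]
    fun_prop
  have hsnd : (Measure.dirac () ⊗ₘ Kernel.const Unit p).snd = p := by
    rw [dirac_unit_compProd, Measure.snd, Measure.map_map measurable_snd measurable_prodMk_left]
    simp [Function.comp_def]
  exact achievable_of_condAchievable p (condAchievable_euclidean _ h𝒳 h𝒴 hρ0 hρ _ hD
    (by rwa [hsnd]) (hR.trans_le (rateDistortion_le_condRateDistortion p hc.measurable D)))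

end

end

end DirectConverse

open DirectConverse in
theorem mainTheorem4 :
    -- no `V`; source and reproduction alphabets in `ℝ^γ`
    (∀ (γ : ℕ) (𝒳 𝒴 : Set (EuclideanSpace ℝ (Fin γ))), MeasurableSet 𝒳 → MeasurableSet 𝒴 →
      ∀ (ρ : EuclideanSpace ℝ (Fin γ) → ℝ), (∀ z, 0 ≤ ρ z) → UniformContinuous ρ →
      ∀ (pX : Measure 𝒳) [IsProbabilityMeasure pX] (D : ℝ), 0 ≤ D →
      Nondegenerate pX (fun (x : 𝒳) (y : 𝒴) => ρ (x - y)) D →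
      ∀ R : ℝ≥0, (R : ℝ≥0∞) < rateDistortion pX (fun (x : 𝒳) (y : 𝒴) => ρ (x - y)) D →
        Achievable pX (fun (x : 𝒳) (y : 𝒴) => ρ (x - y)) D R) ∧
    -- `V` finite; source and reproduction alphabets in `ℝ^γ`
    (∀ (γ : ℕ) (𝒳 𝒴 : Set (EuclideanSpace ℝ (Fin γ))), MeasurableSet 𝒳 → MeasurableSet 𝒴 →
      ∀ (ρ : EuclideanSpace ℝ (Fin γ) → ℝ), (∀ z, 0 ≤ ρ z) → UniformContinuous ρ →
      ∀ (V : Type) [Finite V] [MeasurableSpace V] [MeasurableSingletonClass V]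
        (pV : Measure V) [IsProbabilityMeasure pV] (pXV : Kernel V 𝒳) [IsMarkovKernel pXV]
        (D : ℝ), 0 ≤ D →
      Nondegenerate (pV ⊗ₘ pXV).snd (fun (x : 𝒳) (y : 𝒴) => ρ (x - y)) D →
      ∀ R : ℝ≥0,
        (R : ℝ≥0∞) < condRateDistortion pV pXV (fun (x : 𝒳) (y : 𝒴) => ρ (x - y)) D →
        CondAchievable pV pXV (fun (x : 𝒳) (y : 𝒴) => ρ (x - y)) D R) ∧
    -- source and reproduction alphabets finite; `V` in `ℝ^η`
    (∀ (X Y : Type) [Finite X] [MeasurableSpace X] [MeasurableSingletonClass X]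
        [Finite Y] [MeasurableSpace Y] [MeasurableSingletonClass Y]
        (d : X → Y → ℝ), (∀ x y, 0 ≤ d x y) →
      ∀ (η : ℕ) (𝒱 : Set (EuclideanSpace ℝ (Fin η))), MeasurableSet 𝒱 →
      ∀ (pV : Measure 𝒱) [IsProbabilityMeasure pV] (pXV : Kernel 𝒱 X) [IsMarkovKernel pXV],
      (∀ i : X, TechnicalCondition pXV {i}) →
      ∀ D : ℝ, 0 ≤ D →
      ∀ R : ℝ≥0, (R : ℝ≥0∞) < condRateDistortion pV pXV d D → CondAchievable pV pXV d D R) ∧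
    -- source and reproduction alphabets in `ℝ^γ`; `V` in `ℝ^η`
    (∀ (γ : ℕ) (𝒳 𝒴 : Set (EuclideanSpace ℝ (Fin γ))), MeasurableSet 𝒳 → MeasurableSet 𝒴 →
      ∀ (ρ : EuclideanSpace ℝ (Fin γ) → ℝ), (∀ z, 0 ≤ ρ z) → UniformContinuous ρ →
      ∀ (η : ℕ) (𝒱 : Set (EuclideanSpace ℝ (Fin η))), MeasurableSet 𝒱 →
      ∀ (pV : Measure 𝒱) [IsProbabilityMeasure pV] (pXV : Kernel 𝒱 𝒳) [IsMarkovKernel pXV],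
      (∀ (Δ : ℝ), 0 < Δ → ∀ c : Fin γ → ℤ,
        TechnicalCondition pXV {x : 𝒳 | (x : EuclideanSpace ℝ (Fin γ)) ∈ gridCell Δ c}) →
      ∀ D : ℝ, 0 ≤ D →
      Nondegenerate (pV ⊗ₘ pXV).snd (fun (x : 𝒳) (y : 𝒴) => ρ (x - y)) D →
      ∀ R : ℝ≥0,
        (R : ℝ≥0∞) < condRateDistortion pV pXV (fun (x : 𝒳) (y : 𝒴) => ρ (x - y)) D →
        CondAchievable pV pXV (fun (x : 𝒳) (y : 𝒴) => ρ (x - y)) D R) := by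
  refine ⟨?_, ?_, ?_, ?_⟩
  · intro γ 𝒳 𝒴 h𝒳 h𝒴 ρ hρ0 hρ pX _ D hD hN R hR
    exact achievable_euclidean h𝒳 h𝒴 hρ0 hρ.continuous pX hD hN hR
  · intro γ 𝒳 𝒴 h𝒳 h𝒴 ρ hρ0 hρ V _ _ _ pV _ pXV _ D hD hN R hR
    exact condAchievable_euclidean pV h𝒳 h𝒴 hρ0 hρ.continuous pXV hD hN hR
  · intro X Y _ _ _ _ _ _ d hd0 η 𝒱 _ pV _ pXV _ _ D hD R hR
    exact condAchievable_finite pV hd0 pXV hD hR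
  · intro γ 𝒳 𝒴 h𝒳 h𝒴 ρ hρ0 hρ η 𝒱 _ pV _ pXV _ _ D hD hN R hR
    exact condAchievable_euclidean pV h𝒳 h𝒴 hρ0 hρ.continuous pXV hD hN hR
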